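/- Let $k$ be an algebraically closed field of characteristic zero. For $a\ge 0$ let $\mathbb{F}_a=\mathbb{P}(\mathcal{O}\oplus\mathcal{O}(-a))\to\mathbb{P}^1$ be the Hirzebruch surface, with fibre $f$ and with $C_0$ the section of self-intersection $-a$ (for $a=0$, a fibre of the second ruling of $\mathbb{F}_0=\mathbb{P}^1\times\mathbb{P}^1$). For an irreducible reduced curve $C$ on a smooth surface $S$ and $c\in\mathbb{Q}$, the pair $(S,cC)$ is called canonical (respectively terminal) if $c\le 1$ and the discrepancies $a(E,S,cC)$ of all exceptional divisors $E$ over $S$ are $\ge 0$ (respectively $>0$); it is terminal along a curve $Z\subset S$ if $c\le 1$ and $a(E,S,cC)>0$ for all exceptional divisors $E$ over $S$ whose centre lies on $Z$. By $\kappa(S,cC)$ we denote the Iitaka dimension of the $\mathbb{Q}$-divisor $K_S+cC$. A model is a pair $(S,C)$ of a surface $S$ and an irreducible reduced curve $C\subset S$ of one of the following kinds: 1. $S=\mathbb{P}^2$ and $C$ is a line; 2. $S=\mathbb{P}^2$, $C\sim\mathcal{O}(d)$ with $d>0$, $K_S+\frac3d C\equiv 0$, and $(S,\frac3d C)$ is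 terminal; 3. $S=\mathbb{F}_0$, $C\sim\alpha C_0+\beta f$ with $\alpha>0$, $K_S+\frac2\alpha C$ is nef, and $(S,\frac2\alpha C)$ is terminal; 4. $S=\mathbb{F}_a$ with $a\ge 0$, $C\sim\alpha C_0+\beta f$ with $\alpha>0$, $K_S+\frac2\alpha C$ is nef, and $(S,\frac2\alpha C)$ is canonical, and terminal along $C_0$. Let $(S,C)$ and $(S',C')$ be two models that are birational, i.e. there is a birational map $\Phi:S\dashrightarrow S'$ with $\Phi_*(C)=C'$, but not isomorphic, i.e. there is no isomorphism $S\to S'$ that maps $C$ onto $C'$. Then $S=\mathbb{F}_a$ and $S'=\mathbb{F}_{a'}$ for some $a,a'\ge 0$. Moreover, let $\Phi:S\dashrightarrow S'$ be any birational map with $\Phi_*(C)=C'$, and let $C\sim\alpha C_0+\beta f$ and $C'\sim\alpha' C_0+\beta' f$. Then (i) $\alpha=\alpha'$; (ii) if $\kappa(S,\frac2\alpha C)=1$, then $\Phi$ is an isomorphism on the generic fibres of the rulings $S\to\mathbb{P}^1$ and $S'\to\mathbb{P}^1$: it induces an isomorphism between the function fields of the two bases, and an isomorphism of the generic fibres over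 it. -/

import Mathlib

/-! Birational geometry of pairs on the projective plane and on the Hirzebruch surfaces over a
field `k`, in terms of their common function field `k(x, y)`.

An integral separated scheme of finite type with function field `K` is determined by the local
rings of its points, which are local subrings of `K`: those of an affine chart with coordinate ring
`A ⊆ K` are the localizations of `A` at its primes.  A surface is given here by its standard affine
charts, its points are these local rings, and its irreducible reduced curves are the points whose
local ring is a discrete valuation ring.  A birational map is an isomorphism of function fields. -/

noncomputable section

namespace PlanePairs

open KaehlerDifferential

/-- The function field `k(x, y)`. -/
abbrev FunField (k : Type*) [Field k] : Type _ := FractionRing (MvPolynomial (Fin 2) k)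

variable (k : Type*) [Field k]

/-- The first coordinate function `x`; on a Hirzebruch surface it is the coordinate of the base. -/
def x : FunField k := algebraMap (MvPolynomial (Fin 2) k) (FunField k) (MvPolynomial.X 0)

/-- The second coordinate function `y`; on a Hirzebruch surface it is a coordinate of the fibres. -/
def y : FunField k := algebraMap (MvPolynomial (Fin 2) k) (FunField k) (MvPolynomial.X 1)

/-- The projective plane and the Hirzebruch surfaces `𝔽_a = ℙ(𝒪 ⊕ 𝒪(-a))` over `ℙ¹`. -/
inductive Surface : Type
  | plane : Surface
  | hirzebruch (a : ℕ) : Surface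

/-- The standard affine charts (each an affine plane).
For `ℙ²` with homogeneous coordinates `[X₀ : X₁ : X₂]` we have `x = X₁/X₀`, `y = X₂/X₀`.
For `𝔽_a` the base has the charts `x` and `1/x`, and over them the fibre `ℙ¹` has the
affine coordinates `y` and `x ^ a * y` respectively. -/
def Surface.charts : Surface → Set (Subalgebra k (FunField k))
  | .plane =>
      {Algebra.adjoin k {x k, y k},
       Algebra.adjoin k {(x k)⁻¹, y k / x k},
       Algebra.adjoin k {(y k)⁻¹, x k / y k}}
  | .hirzebruch a =>
      {Algebra.adjoin k {x k, y k},
       Algebra.adjoin k {x k, (y k)⁻¹},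
       Algebra.adjoin k {(x k)⁻¹, x k ^ a * y k},
       Algebra.adjoin k {(x k)⁻¹, (x k ^ a * y k)⁻¹}}

/-- The points of the surface (closed points, generic points of curves, and the generic point),
each represented by its local ring. -/
def Surface.points (S : Surface) : Set (LocalSubring (FunField k)) :=
  {R | ∃ A ∈ S.charts k, ∃ (P : Ideal A.toSubring) (_ : P.IsPrime),
    R = LocalSubring.ofPrime A.toSubring P}

/-- A divisorial valuation of `k(x, y)` over `k`, given by its valuation ring: it is discrete of
rank one, trivial on `k`, and its residue field is not algebraic over `k` (hence of transcendence
degree one).  These are the valuations given by the prime divisors on the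
normal (equivalently, on the smooth) birational models of the surface. -/
structure DivisorialValuation where
  /-- the valuation ring -/
  ring : ValuationSubring (FunField k)
  isDVR : IsDiscreteValuationRing ring
  algebraMap_mem : ∀ c : k, algebraMap k (FunField k) c ∈ ring
  /-- some element of the valuation ring has a residue that is transcendental over `k` -/
  residue_transcendental : ∃ u ∈ ring, ∀ p : Polynomial k, p ≠ 0 →
    Polynomial.aeval u p ≠ 0 ∧ (Polynomial.aeval u p)⁻¹ ∈ ring

variable {k}

/-- The normalized order of a rational function along `E`, with the convention `ord 0 = 0`. -/
def DivisorialValuation.ord (E : DivisorialValuation k) (g : FunField k) : ℤ :=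
  haveI := E.isDVR;
  -WithZero.log ((IsDiscreteValuationRing.maximalIdeal E.ring).valuation (FunField k) g)

/-- `E` is a prime divisor (an irreducible reduced curve) on the surface `S`. -/
def Surface.IsPrimeDivisor (S : Surface) (E : DivisorialValuation k) : Prop :=
  E.ring.toLocalSubring ∈ S.points k

/-- The point with local ring `R` lies on the curve `E`. -/
def Passes (E : DivisorialValuation k) (R : LocalSubring (FunField k)) : Prop :=
  R.toSubring ≤ E.ring.toSubring

/-! ### Divisors -/

open Classical in
/-- The curve `C` as a divisor. -/
def curveDivisor (C : DivisorialValuation k) : DivisorialValuation k → ℤ :=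
  fun E => if E = C then 1 else 0

open Classical in
/-- The divisor of the curve (with multiplicity one) that is the closure in the surface of the zero
locus of the prime element `h` of the coordinate ring of the chart `A`. -/
def chartDivisor (A : Subalgebra k (FunField k)) (h : FunField k) : DivisorialValuation k → ℤ :=
  fun E => if A.toSubring ≤ E.ring.toSubring ∧ 0 < E.ord h then 1 else 0

variable (k) in
/-- The line `X₀ = 0` of `ℙ²`. -/
def lineDivisor : DivisorialValuation k → ℤ :=
  chartDivisor (Algebra.adjoin k {(x k)⁻¹, y k / x k}) (x k)⁻¹

variable (k) in
/-- The section `C₀ : y = 0` of `𝔽_a`, which has self-intersection `-a`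
(for `a = 0` a fibre of the second ruling). -/
def sectionDivisor : DivisorialValuation k → ℤ :=
  chartDivisor (Algebra.adjoin k {x k, y k}) (y k)

variable (k) in
/-- The fibre `f : x = 0` of the ruling of `𝔽_a`. -/
def fibreDivisor : DivisorialValuation k → ℤ :=
  chartDivisor (Algebra.adjoin k {x k, y k}) (x k)

/-- Linear equivalence of divisors on `S`; only the coefficients at the prime divisors
of `S` are relevant. -/
def Surface.LinEquiv (S : Surface) (D D' : DivisorialValuation k → ℤ) : Prop :=
  ∃ g : FunField k, g ≠ 0 ∧ ∀ E, S.IsPrimeDivisor E → D E = D' E + E.ord g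

/-! ### The canonical divisor -/

/-- The rational two-form `dp ∧ dq`. -/
def wedge (p q : FunField k) : ⋀[FunField k]^2 Ω[FunField k⁄k] :=
  exteriorPower.ιMulti (FunField k) 2 ![D k (FunField k) p, D k (FunField k) q]

/-- The order of the rational two-form `dx ∧ dy` along `E`.  With `V` the valuation ring of `E`, the
module of two-forms of `V` over `k` is free of rank one over `V` and generated by the forms
`dp ∧ dq = J • dx ∧ dy` with `p, q ∈ V`; a generator is one for which `E.ord J` is minimal, and the
order of `dx ∧ dy` is minus this minimum.  As a function of the prime divisors of a surface this is
its canonical divisor `div (dx ∧ dy)`. -/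
def canonicalDivisor (E : DivisorialValuation k) : ℤ :=
  -sInf {n : ℤ | ∃ p ∈ E.ring, ∃ q ∈ E.ring, ∃ J : FunField k,
    J ≠ 0 ∧ wedge p q = J • wedge (x k) (y k) ∧ n = E.ord J}

/-! ### Intersection numbers and nefness -/

/-- The stalk at the point `R` of the ideal sheaf `𝒪(-A)` of an effective divisor `A`. -/
def Surface.idealAt (S : Surface) (A : DivisorialValuation k → ℤ)
    (R : LocalSubring (FunField k)) : Ideal R.toSubring :=
  Ideal.span {r | r = 0 ∨ ∀ E, S.IsPrimeDivisor E → Passes E R → A E ≤ E.ord (r : FunField k)}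

/-- The intersection number of an effective divisor `A` with a curve `Γ` that is not a component of
`A`: the sum over the points `R` of `Γ` of the lengths of `𝒪_R / (𝒪(-A)_R + 𝒪(-Γ)_R)`.  (The generic
point of `Γ` contributes `0`, and the residue field at the closed points is the algebraically closed
field `k`.) -/
def Surface.properIntersection (S : Surface) (A : DivisorialValuation k →₀ ℕ)
    (Γ : DivisorialValuation k) : ℕ :=
  ∑ᶠ R ∈ {R | R ∈ S.points k ∧ Passes Γ R},
    (Module.length R.toSubring
      (R.toSubring ⧸ (S.idealAt (fun E => (A E : ℤ)) R ⊔ S.idealAt (curveDivisor Γ) R))).toNat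

/-- `n` is the intersection number `D · Γ` of a divisor `D` and a curve `Γ` on `S`: up to linear
equivalence, `D` is the difference of two effective divisors that do not contain `Γ`. -/
def Surface.IsIntersectionNumber (S : Surface) (D : DivisorialValuation k → ℤ)
    (Γ : DivisorialValuation k) (n : ℤ) : Prop :=
  ∃ A B : DivisorialValuation k →₀ ℕ, A Γ = 0 ∧ B Γ = 0 ∧
    S.LinEquiv D (fun E => (A E : ℤ) - (B E : ℤ)) ∧
    n = (S.properIntersection A Γ : ℤ) - (S.properIntersection B Γ : ℤ)

/-- The `ℚ`-divisor `K + c C`. -/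
def logDivisor (C : DivisorialValuation k) (c : ℚ) : DivisorialValuation k → ℚ :=
  fun E => (canonicalDivisor E : ℚ) + c * (curveDivisor C E : ℚ)

/-- A `ℚ`-divisor is nef if its intersection number with every curve is nonnegative;
this is tested on its integral multiples. -/
def Surface.IsNef (S : Surface) (D : DivisorialValuation k → ℚ) : Prop :=
  ∀ (N : ℕ) (D₀ : DivisorialValuation k → ℤ), 0 < N →
    (∀ E, S.IsPrimeDivisor E → (D₀ E : ℚ) = N * D E) →
    ∀ Γ, S.IsPrimeDivisor Γ → ∀ n, S.IsIntersectionNumber D₀ Γ n → 0 ≤ n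

/-- A `ℚ`-divisor is numerically trivial if its intersection number with every curve is zero. -/
def Surface.IsNumTrivial (S : Surface) (D : DivisorialValuation k → ℚ) : Prop :=
  ∀ (N : ℕ) (D₀ : DivisorialValuation k → ℤ), 0 < N →
    (∀ E, S.IsPrimeDivisor E → (D₀ E : ℚ) = N * D E) →
    ∀ Γ, S.IsPrimeDivisor Γ → ∀ n, S.IsIntersectionNumber D₀ Γ n → n = 0

/-! ### Singularities of pairs -/

/-- `h` is a local equation of the divisor `D` at the point `R` of `S`. -/
def Surface.IsLocalEquation (S : Surface) (D : DivisorialValuation k → ℤ)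
    (R : LocalSubring (FunField k)) (h : FunField k) : Prop :=
  h ≠ 0 ∧ ∀ E, S.IsPrimeDivisor E → Passes E R → E.ord h = D E

/-- The centre of `E` on `S` is the point `R`: the valuation ring of `E` dominates `R`. -/
def Surface.IsCentre (S : Surface) (E : DivisorialValuation k)
    (R : LocalSubring (FunField k)) : Prop :=
  R ∈ S.points k ∧ R ≤ E.ring.toLocalSubring

/-- `a` is the discrepancy `a(E, S, c C)` of a divisor `E` over `S` with centre `R`, that is, the
coefficient of `E` in `K_Y - π^*(K_S + c C)` for a smooth `π : Y ⟶ S` on which `E` is a divisor.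
The coefficient of `E` in the pull-back of a divisor is the order along `E` of a local equation of
that divisor at the centre of `E`. -/
def Surface.IsDiscrepancy (S : Surface) (C : DivisorialValuation k) (c : ℚ)
    (E : DivisorialValuation k) (R : LocalSubring (FunField k)) (a : ℚ) : Prop :=
  S.IsCentre E R ∧ ∃ hK hC : FunField k,
    S.IsLocalEquation canonicalDivisor R hK ∧ S.IsLocalEquation (curveDivisor C) R hC ∧
    a = (canonicalDivisor E : ℚ) - (E.ord hK : ℚ) - c * (E.ord hC : ℚ)

/-- `(S, c C)` is canonical: `c ≤ 1`, and all discrepancies of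
exceptional divisors over `S` are nonnegative. -/
def Surface.IsCanonicalPair (S : Surface) (C : DivisorialValuation k) (c : ℚ) : Prop :=
  c ≤ 1 ∧ ∀ E, ¬ S.IsPrimeDivisor E → ∀ R a, S.IsDiscrepancy C c E R a → 0 ≤ a

/-- `(S, c C)` is terminal: `c ≤ 1`, and all discrepancies of
exceptional divisors over `S` are positive. -/
def Surface.IsTerminalPair (S : Surface) (C : DivisorialValuation k) (c : ℚ) : Prop :=
  c ≤ 1 ∧ ∀ E, ¬ S.IsPrimeDivisor E → ∀ R a, S.IsDiscrepancy C c E R a → 0 < a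

/-- `(S, c C)` is terminal along the reduced divisor `Z`: `c ≤ 1`, and all discrepancies of
exceptional divisors whose centre lies on `Z` are positive. -/
def Surface.IsTerminalAlong (S : Surface) (C : DivisorialValuation k) (c : ℚ)
    (Z : DivisorialValuation k → ℤ) : Prop :=
  c ≤ 1 ∧ ∀ E, ¬ S.IsPrimeDivisor E → ∀ R a,
    (∃ F, S.IsPrimeDivisor F ∧ Z F ≠ 0 ∧ Passes F R) → S.IsDiscrepancy C c E R a → 0 < a

/-! ### Log Kodaira dimension -/

/-- The rational functions `g` with `div g + D ≥ 0` on `S` (together with `0`), that is,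
`H⁰(S, ⌊D⌋)`. -/
def Surface.sections (S : Surface) (D : DivisorialValuation k → ℚ) : Set (FunField k) :=
  {g | g = 0 ∨ ∀ E, S.IsPrimeDivisor E → 0 ≤ (E.ord g : ℚ) + D E}

/-- The Iitaka dimension of a `ℚ`-divisor: the supremum, over all `m > 0` such that `⌊m D⌋` has a
nonzero section, of the dimension of the image of the rational map given by the complete linear
system `|⌊m D⌋|` (the transcendence degree of the field generated by the quotients of sections);
`⊥` (for `-∞`) if there is no such `m`. -/
def Surface.iitakaDim (S : Surface) (D : DivisorialValuation k → ℚ) : WithBot ℕ∞ :=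
  ⨆ (m : ℕ) (_ : 0 < m) (_ : ∃ g ∈ S.sections (fun E => m * D E), g ≠ 0),
    ((Cardinal.toENat (Algebra.trdeg k (IntermediateField.adjoin k
      {r : FunField k | ∃ g ∈ S.sections (fun E => m * D E),
        ∃ h ∈ S.sections (fun E => m * D E), h ≠ 0 ∧ r = g / h}))) : WithBot ℕ∞)

/-- The log Kodaira dimension `κ(S, c C)`. -/
def Surface.logKodairaDim (S : Surface) (C : DivisorialValuation k) (c : ℚ) : WithBot ℕ∞ :=
  S.iitakaDim (logDivisor C c)

/-! ### Birational maps of pairs -/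

/-- A birational map `Φ : S ⇢ S'`, given by the isomorphism `φ = Φ^* : k(S') → k(S)` of function
fields, satisfies `Φ_*(C) = C'`: the generic point of `C` is mapped to that of `C'`. -/
def IsPairMap (C C' : DivisorialValuation k) (φ : FunField k ≃ₐ[k] FunField k) : Prop :=
  C.ring.comap (φ : FunField k →+* FunField k) = C'.ring

/-- The birational map with `Φ^* = φ` is a biregular map `S → S'`: it identifies
the local rings of the points of `S'` with those of the points of `S`. -/
def IsBiregular (S S' : Surface) (φ : FunField k ≃ₐ[k] FunField k) : Prop :=
  ∀ R : LocalSubring (FunField k),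
    R ∈ S'.points k ↔ R.map (φ : FunField k →+* FunField k) ∈ S.points k

/-- The birational map `Φ : S ⇢ S'` of surfaces ruled by the function `x`, with `Φ^* = φ`, is an
isomorphism on the generic fibre: `φ` induces an isomorphism between the fields `k(x)` of
rational functions of the bases, and it identifies the local rings of the points of the
generic fibre of `S'`, which are the local rings that contain `k(x)`, with those of `S`. -/
def IsIsoOnGenericFibre (S S' : Surface) (φ : FunField k ≃ₐ[k] FunField k) : Prop :=
  (IntermediateField.adjoin k {x k}).map (φ : FunField k →ₐ[k] FunField k) =
      IntermediateField.adjoin k {x k} ∧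
    ∀ R : LocalSubring (FunField k),
      (IntermediateField.adjoin k {x k}).toSubring ≤ R.toSubring →
      (R ∈ S'.points k ↔ R.map (φ : FunField k →+* FunField k) ∈ S.points k)

/-! ### The list of models -/

/-- `C ∼ α C₀ + β f`. -/
def Surface.HasClass (S : Surface) (C : DivisorialValuation k) (α β : ℤ) : Prop :=
  S.LinEquiv (curveDivisor C) (fun E => α * sectionDivisor k E + β * fibreDivisor k E)

/-- The list of standard models `(S, C)`. -/
inductive IsModel : Surface → DivisorialValuation k → Prop
  /-- `ℙ²` with a line -/
  | line (C : DivisorialValuation k) :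
      Surface.plane.IsPrimeDivisor C →
      Surface.plane.LinEquiv (curveDivisor C) (lineDivisor k) →
      IsModel .plane C
  /-- `ℙ²` with a curve of degree `d` such that `K + (3/d) C ≡ 0` and `(ℙ², (3/d) C)` is terminal -/
  | plane (C : DivisorialValuation k) (d : ℕ) :
      Surface.plane.IsPrimeDivisor C →
      0 < d →
      Surface.plane.LinEquiv (curveDivisor C) (fun E => d * lineDivisor k E) →
      Surface.plane.IsNumTrivial (logDivisor C (3 / d)) →
      Surface.plane.IsTerminalPair C (3 / d) →
      IsModel .plane C
  /-- `𝔽₀` with `C ∼ α f₀ + β f₁`, `K + (2/α) C` nef and `(𝔽₀, (2/α) C)` terminal -/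
  | quadric (C : DivisorialValuation k) (α β : ℤ) :
      (Surface.hirzebruch 0).IsPrimeDivisor C →
      0 < α →
      (Surface.hirzebruch 0).HasClass C α β →
      (Surface.hirzebruch 0).IsNef (logDivisor C (2 / α)) →
      (Surface.hirzebruch 0).IsTerminalPair C (2 / α) →
      IsModel (.hirzebruch 0) C
  /-- `𝔽_a` with `C ∼ α C₀ + β f`, `K + (2/α) C` nef and `(𝔽_a, (2/α) C)` canonical,
  and terminal along `C₀` -/
  | hirzebruch (a : ℕ) (C : DivisorialValuation k) (α β : ℤ) :
      (Surface.hirzebruch a).IsPrimeDivisor C →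
      0 < α →
      (Surface.hirzebruch a).HasClass C α β →
      (Surface.hirzebruch a).IsNef (logDivisor C (2 / α)) →
      (Surface.hirzebruch a).IsCanonicalPair C (2 / α) →
      (Surface.hirzebruch a).IsTerminalAlong C (2 / α) (sectionDivisor k) →
      IsModel (.hirzebruch a) C

end PlanePairs

end

noncomputable section

namespace PlanePairs

variable {k : Type*} [Field k]

/-! ### The order along a divisorial valuation -/

namespace DivisorialValuation

/-! The invariant behind the theorem is the threshold of a pair: the smallest `c` for which `K + cC`
is effective. A section of `nK + rC` is a rational function `G` such that the `n`-fold two-form `G •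
(dx ∧ dy)ⁿ` has at worst a pole of order `r` along `C` and no other poles. If `(S', cC')` is
canonical and `cn = r`, the order of such a form along any exceptional divisor over `S'` is at least
`n` times the discrepancy, hence nonnegative. So the form stays regular, up to the pole along the
curve, on every birational model, and sections pull back along any birational map of pairs
(`Surface.IsLogSection.exists_discrepancy`, `Surface.IsLogSection.pull`).

On the plane `nK + rC` has degree `rd - 3n`. On a Hirzebruch surface `K ∼ -2C₀ - (a + 2)f`, so `nK +
rC` has degree `rα - 2n` on the fibres, and nefness of `K + (2/α)C`, tested on `C₀`, makes this
divisor a nonnegative multiple of `f` (`class_nonneg_of_isNef`). Hence the thresholds are `3/d` and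
`2/α`. They agree on birational models (`Surface.HasThreshold.eq`), which gives (i). For a line, `K
+ cC` has negative degree for all `c ≤ 1`, so a line is birational to none of the other models,
while any two lines are projectively equivalent.

For two curves in the second kind of model, `K + (3/d)C` is trivial on both sides. A trivializing
form pulls back to a constant multiple of a trivializing form, whereas positive discrepancies would
make it vanish along a contracted curve. So no curve is contracted in either direction, the class of
the line is preserved, and the map is a projective transformation
(`isPrimeDivisor_comap_of_trivial`, `isBiregular_plane_of_isPrimeDivisor`). A ruled model and a
plane model cannot be birational: pulling back a pencil shows that `K + (2/α)C` is trivial too, so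
no curve of `𝔽_a` is contracted, which contradicts the independence of `C₀` and `f` against the
single class of the line (`IsRuledModel.not_isPairMap`). This leaves two Hirzebruch surfaces.

For (ii), Iitaka dimension one means that `K + (2/α)C` is a positive multiple of `f`. Its sections
have quotients in `k(x)`, and `x` is itself such a quotient. Pulling back in both directions
identifies the two fields `k(x)` (`IsRuledModel.pull_x`). The points of the generic fibre are
exactly the valuation rings containing this field, so they are identified as well
(`mem_points_iff_of_baseField_le`). -/

@[ext]
theorem ext {E E' : DivisorialValuation k} (h : E.ring = E'.ring) : E = E' := by
  cases E; cases E'; cases h; rfl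

variable (E : DivisorialValuation k) {g h : FunField k}

@[simp]
theorem ord_zero : E.ord 0 = 0 := by simp [ord]

@[simp]
theorem ord_one : E.ord 1 = 0 := by simp [ord]

theorem ord_mul (hg : g ≠ 0) (hh : h ≠ 0) : E.ord (g * h) = E.ord g + E.ord h := by
  have := E.isDVR
  simp only [ord, map_mul]
  rw [WithZero.log_mul (by simpa using hg) (by simpa using hh)]
  ring

@[simp]
theorem ord_inv (g : FunField k) : E.ord g⁻¹ = -E.ord g := by simp [ord, WithZero.log_inv]

theorem ord_div (hg : g ≠ 0) (hh : h ≠ 0) : E.ord (g / h) = E.ord g - E.ord h := by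
  rw [div_eq_mul_inv, E.ord_mul hg (inv_ne_zero hh), ord_inv]; ring

@[simp]
theorem ord_pow (g : FunField k) (n : ℕ) : E.ord (g ^ n) = n * E.ord g := by
  simp [ord, WithZero.log_pow]

@[simp]
theorem ord_zpow (g : FunField k) (n : ℤ) : E.ord (g ^ n) = n * E.ord g := by
  simp [ord, WithZero.log_zpow]

theorem mem_ring_iff (hg : g ≠ 0) : g ∈ E.ring ↔ 0 ≤ E.ord g := by
  have := E.isDVR
  have hv : (IsDiscreteValuationRing.maximalIdeal E.ring).valuation (FunField k) g ≠ 0 := by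
    simpa using hg
  have key : 0 ≤ E.ord g ↔
      (IsDiscreteValuationRing.maximalIdeal E.ring).valuation (FunField k) g ≤ 1 := by
    rw [← WithZero.log_le_log hv one_ne_zero]; simp [ord]
  rw [key]
  constructor
  · intro hm
    exact IsDedekindDomain.HeightOneSpectrum.valuation_le_one _ (⟨g, hm⟩ : E.ring)
  · intro hm
    obtain ⟨a, ha⟩ := IsDiscreteValuationRing.exists_lift_of_le_one hm
    rw [← ha]; exact a.2

theorem ord_nonneg (hg : g ∈ E.ring) : 0 ≤ E.ord g := by
  rcases eq_or_ne g 0 with rfl | h0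
  · simp
  · exact (E.mem_ring_iff h0).1 hg

theorem exists_ord_eq_one : ∃ t : FunField k, t ≠ 0 ∧ E.ord t = 1 := by
  have := E.isDVR
  obtain ⟨t, ht⟩ := (IsDiscreteValuationRing.maximalIdeal E.ring).valuation_exists_uniformizer
    (FunField k)
  refine ⟨t, ?_, ?_⟩
  · rintro rfl; rw [map_zero] at ht; exact WithZero.exp_ne_zero ht.symm
  · simp [ord, ht]

/-- Multiplication by the power `t ^ (-n)` of a uniformizer turns the bound into membership in the
valuation ring, which is closed under addition. Zero is listed separately because its order is `0`
by convention. -/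
theorem le_ord_add {n : ℤ} (hg : g = 0 ∨ n ≤ E.ord g) (hh : h = 0 ∨ n ≤ E.ord h) :
    g + h = 0 ∨ n ≤ E.ord (g + h) := by
  obtain ⟨t, ht0, ht⟩ := E.exists_ord_eq_one
  have key : ∀ z : FunField k, (z = 0 ∨ n ≤ E.ord z) ↔ z * t ^ (-n) ∈ E.ring := by
    intro z
    rcases eq_or_ne z 0 with rfl | hz
    · simp
    · rw [E.mem_ring_iff (mul_ne_zero hz (zpow_ne_zero _ ht0)),
        E.ord_mul hz (zpow_ne_zero _ ht0), ord_zpow, ht]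
      simp [hz]
  rw [key] at *
  rw [add_mul]
  exact add_mem hg hh

@[simp]
theorem ord_neg (g : FunField k) : E.ord (-g) = E.ord g := by simp [ord, Valuation.map_neg]

theorem ord_add_eq_of_lt (hg : g ≠ 0) (hh : h = 0 ∨ E.ord g < E.ord h) :
    g + h ≠ 0 ∧ E.ord (g + h) = E.ord g := by
  rcases hh with rfl | hh
  · simpa using hg
  have hne : g + h ≠ 0 := by
    intro h0
    rw [eq_neg_of_add_eq_zero_left h0, ord_neg] at hh
    exact lt_irrefl _ hh
  refine ⟨hne, le_antisymm ?_ ?_⟩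
  · by_contra! hlt
    have := E.le_ord_add (g := g + h) (h := -h) (n := E.ord g + 1) (Or.inr hlt)
      (Or.inr (by rw [ord_neg]; exact hh))
    rw [add_neg_cancel_right] at this
    rcases this with h0 | h1
    · exact hg h0
    · lia
  · exact (E.le_ord_add (n := E.ord g) (Or.inr le_rfl) (Or.inr hh.le)).resolve_left hne

/-- An expansion in a function with a simple pole. -/
theorem ord_sum_eq (f : ℕ → FunField k) (n : ℕ) (hn : f n ≠ 0) (hord : E.ord (f n) = -n)
    (hle : ∀ i < n, f i = 0 ∨ -(i : ℤ) ≤ E.ord (f i)) :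
    ∑ i ∈ Finset.range (n + 1), f i ≠ 0 ∧ E.ord (∑ i ∈ Finset.range (n + 1), f i) = -n := by
  -- The terms before the last have poles of order less than `n`, so the last term dominates.
  have key : ∀ m ≤ n, (∑ i ∈ Finset.range m, f i) = 0 ∨
      -(n : ℤ) + 1 ≤ E.ord (∑ i ∈ Finset.range m, f i) := by
    intro m
    induction m with
    | zero => simp
    | succ m ih =>
      intro hm
      rw [Finset.sum_range_succ]
      refine E.le_ord_add (ih (by lia)) ?_
      rcases hle m (by lia) with h | h
      · exact Or.inl h
      · right; lia
  rw [Finset.sum_range_succ, add_comm, ← hord]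
  refine E.ord_add_eq_of_lt hn ?_
  rcases key n le_rfl with h | h
  · exact Or.inl h
  · right; rw [hord]; lia

/-- A discrete valuation ring is maximal among the proper subrings of its fraction field: an element
with a pole, once adjoined, has powers that absorb every other pole. -/
theorem eq_of_ring_le {E E' : DivisorialValuation k} (hle : E.ring ≤ E'.ring) : E = E' := by
  refine ext (le_antisymm hle fun z hz => ?_)
  by_contra hzE
  have hz0 : z ≠ 0 := by rintro rfl; exact hzE (zero_mem _)
  obtain ⟨t, ht0, ht⟩ := E'.exists_ord_eq_one
  have hw0 : t⁻¹ ≠ 0 := inv_ne_zero ht0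
  have hw : t⁻¹ ∉ E.ring := fun hw => by
    have := E'.ord_nonneg (hle hw)
    rw [ord_inv] at this; lia
  rw [E.mem_ring_iff hz0] at hzE
  rw [E.mem_ring_iff hw0] at hw
  push Not at hzE hw
  set i := (-E.ord z).toNat with hi
  set j := (-E.ord t⁻¹).toNat with hj
  -- The exponents are chosen so that this quotient has order zero along `E`. Since `z` is in the
  -- larger ring, so is `t⁻¹ ^ i`, although its order along `E'` is `-i < 0`.
  have h1 : (t⁻¹ ^ i) / z ^ j ∈ E.ring := by
    rw [E.mem_ring_iff (div_ne_zero (pow_ne_zero _ hw0) (pow_ne_zero _ hz0)),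
      E.ord_div (pow_ne_zero _ hw0) (pow_ne_zero _ hz0), ord_pow, ord_pow]
    have h2 : (i : ℤ) = -E.ord z := by lia
    have h3 : (j : ℤ) = -E.ord t⁻¹ := by lia
    rw [h2, h3]; ring_nf; rfl
  have h2 : t⁻¹ ^ i ∈ E'.ring := by
    have := mul_mem (hle h1) (pow_mem hz j)
    rwa [div_mul_cancel₀ _ (pow_ne_zero _ hz0)] at this
  have := E'.ord_nonneg h2
  rw [ord_pow, ord_inv, ht] at this
  lia

/-- The order is the only normalized valuation with the given valuation ring. -/
theorem ord_eq_of_forall {t : FunField k} (ht0 : t ≠ 0) (ht : 0 < E.ord t)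
    (hmin : ∀ z : FunField k, z ≠ 0 → 0 < E.ord z → 0 ≤ E.ord (z / t)) : E.ord t = 1 := by
  obtain ⟨s, hs0, hs⟩ := E.exists_ord_eq_one
  have := hmin s hs0 (by lia)
  rw [E.ord_div hs0 ht0] at this
  lia

/-! ### Push-forward of divisors along birational maps. -/

/-- Transport of a divisorial valuation along an automorphism of the function field. -/
def comap (φ : FunField k ≃ₐ[k] FunField k) : DivisorialValuation k where
  ring := E.ring.comap (φ : FunField k →+* FunField k)
  isDVR := by
    have := E.isDVR
    let e : E.ring ≃+* E.ring.comap (φ : FunField k →+* FunField k) :=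
      { toFun := fun z => ⟨φ.symm z, by
          rw [ValuationSubring.mem_comap]
          simp⟩
        invFun := fun z => ⟨φ z, z.2⟩
        left_inv := fun z => by simp
        right_inv := fun z => by simp
        map_mul' := fun z w => by ext; simp
        map_add' := fun z w => by ext; simp }
    exact IsDiscreteValuationRing.RingEquivClass.isDiscreteValuationRing e
  algebraMap_mem c := by
    rw [ValuationSubring.mem_comap]
    simpa using E.algebraMap_mem c
  residue_transcendental := by
    obtain ⟨u, hu, h⟩ := E.residue_transcendental
    refine ⟨φ.symm u, by rw [ValuationSubring.mem_comap]; simpa using hu, fun p hp => ?_⟩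
    have h1 : Polynomial.aeval (φ.symm u) p = φ.symm (Polynomial.aeval u p) :=
      Polynomial.aeval_algHom_apply φ.symm u p
    rw [h1]
    refine ⟨by simpa using (h p hp).1, ?_⟩
    rw [ValuationSubring.mem_comap]
    simpa using (h p hp).2

variable (φ : FunField k ≃ₐ[k] FunField k)

theorem mem_comap_ring : g ∈ (E.comap φ).ring ↔ φ g ∈ E.ring := Iff.rfl

theorem comap_comap (ψ : FunField k ≃ₐ[k] FunField k) :
    (E.comap φ).comap ψ = E.comap (ψ.trans φ) := rfl

@[simp]
theorem comap_comap_symm : (E.comap φ).comap φ.symm = E := by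
  ext z; simp [mem_comap_ring]

@[simp]
theorem comap_symm_comap : (E.comap φ.symm).comap φ = E := by
  ext z; simp [mem_comap_ring]

theorem comap_injective {E E' : DivisorialValuation k} (h : E.comap φ = E'.comap φ) : E = E' := by
  rw [← E.comap_comap_symm φ, h, comap_comap_symm]

/-- Both sides are normalized discrete valuations with the same valuation ring. It suffices to
compare units and one uniformizer, since every function is a unit times a power of the latter. -/
theorem ord_comap (g : FunField k) : (E.comap φ).ord g = E.ord (φ g) := by
  rcases eq_or_ne g 0 with rfl | hg
  · simp
  obtain ⟨s, hs0, hs⟩ := (E.comap φ).exists_ord_eq_one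
  have hφ : ∀ {z : FunField k}, z ≠ 0 → φ z ≠ 0 := fun hz => by simpa using hz
  have nonneg_iff : ∀ z : FunField k, z ≠ 0 → (0 ≤ (E.comap φ).ord z ↔ 0 ≤ E.ord (φ z)) :=
    fun z hz => by rw [← mem_ring_iff _ hz, ← mem_ring_iff _ (hφ hz), mem_comap_ring]
  have zero_iff : ∀ z : FunField k, z ≠ 0 → (E.comap φ).ord z = 0 → E.ord (φ z) = 0 := by
    intro z hz h0
    have h1 := (nonneg_iff z hz).1 h0.ge
    have h2 := (nonneg_iff z⁻¹ (inv_ne_zero hz)).1 (by rw [ord_inv]; lia)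
    rw [map_inv₀, ord_inv] at h2
    lia
  have hs1 : E.ord (φ s) = 1 := by
    refine E.ord_eq_of_forall (hφ hs0) ?_ fun z hz hpos => ?_
    · have h1 := (nonneg_iff s hs0).1 (by lia)
      have h2 := (nonneg_iff s⁻¹ (inv_ne_zero hs0))
      rw [ord_inv, map_inv₀, ord_inv] at h2
      lia
    · have hz' : φ.symm z ≠ 0 := by simpa using hz
      have h1 := (nonneg_iff _ hz').2 (by simpa using hpos.le)
      have h2 : (E.comap φ).ord (φ.symm z) ≠ 0 := fun h0 => by
        have := zero_iff _ hz' h0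
        rw [AlgEquiv.apply_symm_apply] at this
        lia
      have h3 := (nonneg_iff (φ.symm z / s) (div_ne_zero hz' hs0)).1
        (by rw [ord_div _ hz' hs0]; lia)
      simpa using h3
  have h0 : g * s ^ (-(E.comap φ).ord g) ≠ 0 := mul_ne_zero hg (zpow_ne_zero _ hs0)
  have h1 := zero_iff _ h0 (by
    rw [ord_mul _ hg (zpow_ne_zero _ hs0), ord_zpow, hs]; ring)
  rw [map_mul, map_zpow₀, ord_mul _ (hφ hg) (zpow_ne_zero _ (hφ hs0)), ord_zpow, hs1] at h1
  lia

theorem ord_algebraMap (c : k) : E.ord (algebraMap k (FunField k) c) = 0 := by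
  rcases eq_or_ne c 0 with rfl | hc
  · simp
  have h1 := E.ord_nonneg (E.algebraMap_mem c)
  have h2 := E.ord_nonneg (E.algebraMap_mem c⁻¹)
  rw [map_inv₀, ord_inv] at h2
  lia

end DivisorialValuation

theorem isPairMap_iff {C C' : DivisorialValuation k} {φ : FunField k ≃ₐ[k] FunField k} :
    IsPairMap C C' φ ↔ C.comap φ = C' :=
  ⟨fun h => DivisorialValuation.ext h, fun h => congrArg DivisorialValuation.ring h⟩

end PlanePairs

end

noncomputable section

namespace PlanePairs

/-! ### Localizations of subrings of a field -/

section Localization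

variable {K : Type*} [Field K]

theorem mem_ofPrime {A : Subring K} {P : Ideal A} [P.IsPrime] {z : K} :
    z ∈ (LocalSubring.ofPrime A P).toSubring ↔
      ∃ a b : A, b ∉ P ∧ z = (a : K) / (b : K) := by
  constructor
  · intro hz
    obtain ⟨⟨a, b⟩, h⟩ := IsLocalization.surj P.primeCompl
      (⟨z, hz⟩ : (LocalSubring.ofPrime A P).toSubring)
    refine ⟨a, b, b.2, ?_⟩
    have hb : ((b : A) : K) ≠ 0 := fun h0 => b.2 (by
      rw [show (b : A) = 0 from Subtype.ext h0]; exact P.zero_mem)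
    rw [eq_div_iff hb]
    exact congrArg Subtype.val h
  · rintro ⟨a, b, hb, rfl⟩
    have hb0 : (b : K) ≠ 0 := fun h0 => hb (by
      rw [show b = 0 from Subtype.ext h0]; exact P.zero_mem)
    obtain ⟨c, hc⟩ := (IsLocalization.map_units (LocalSubring.ofPrime A P).toSubring
      (⟨b, hb⟩ : P.primeCompl)).exists_right_inv
    have h1 : (b : K) * (c : K) = 1 := congrArg Subtype.val hc
    rw [div_eq_mul_inv, inv_eq_of_mul_eq_one_right h1]
    exact mul_mem (LocalSubring.le_ofPrime A P a.2) c.2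

theorem isUnit_subring_iff {R : Subring K} (z : R) :
    IsUnit z ↔ (z : K) ≠ 0 ∧ (z : K)⁻¹ ∈ R := by
  constructor
  · intro h
    obtain ⟨w, hw⟩ := h.exists_right_inv
    have h1 : (z : K) * (w : K) = 1 := congrArg Subtype.val hw
    exact ⟨left_ne_zero_of_mul_eq_one h1, by rw [inv_eq_of_mul_eq_one_right h1]; exact w.2⟩
  · rintro ⟨h0, h⟩
    exact IsUnit.of_mul_eq_one ⟨_, h⟩ (Subtype.ext (mul_inv_cancel₀ h0))

theorem localSubring_le_iff {R V : LocalSubring K} :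
    R ≤ V ↔ R.toSubring ≤ V.toSubring ∧
      ∀ z ∈ R.toSubring, z ≠ 0 → z⁻¹ ∈ V.toSubring → z⁻¹ ∈ R.toSubring := by
  rw [LocalSubring.le_def]
  constructor
  · rintro ⟨h, hl⟩
    refine ⟨h, fun z hz h0 hv => ?_⟩
    have h1 := hl.map_nonunit ⟨z, hz⟩ ((isUnit_subring_iff _).2 ⟨h0, hv⟩)
    exact ((isUnit_subring_iff _).1 h1).2
  · rintro ⟨h, hl⟩
    refine ⟨h, ⟨fun z hz => ?_⟩⟩
    have h1 := (isUnit_subring_iff _).1 hz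
    exact (isUnit_subring_iff _).2 ⟨h1.1, hl z z.2 h1.1 h1.2⟩

/-- Domination means that `P` is the contraction of the maximal ideal of `V`. It is expressed
through inverses, so that all rings can be compared inside the common field. -/
theorem ofPrime_le_iff {A : Subring K} {P : Ideal A} [P.IsPrime] {V : LocalSubring K} :
    LocalSubring.ofPrime A P ≤ V ↔ A ≤ V.toSubring ∧
      ∀ a : A, a ∉ P ↔ (a : K) ≠ 0 ∧ (a : K)⁻¹ ∈ V.toSubring := by
  have hne : ∀ b : A, b ∉ P → (b : K) ≠ 0 := fun b hb h0 => hb (by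
    rw [show b = 0 from Subtype.ext h0]; exact P.zero_mem)
  have hinv : ∀ b : A, b ∉ P → (b : K)⁻¹ ∈ (LocalSubring.ofPrime A P).toSubring := fun b hb =>
    mem_ofPrime.2 ⟨1, b, hb, by simp⟩
  rw [localSubring_le_iff]
  constructor
  · rintro ⟨h, hl⟩
    have hA := (LocalSubring.le_ofPrime A P).trans h
    refine ⟨hA, fun a => ⟨fun ha => ⟨hne a ha, h (hinv a ha)⟩, ?_⟩⟩
    rintro ⟨h0, hv⟩ haP
    obtain ⟨c, b, hb, h1⟩ := mem_ofPrime.1 (hl a (LocalSubring.le_ofPrime A P a.2) h0 hv)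
    rw [inv_eq_iff_eq_inv, inv_div, eq_div_iff] at h1
    · exact hb (by
        rw [show b = a * c from Subtype.ext h1.symm]; exact P.mul_mem_right _ haP)
    · rintro hc
      rw [hc] at h1; simp [h0] at h1
  · rintro ⟨hA, h⟩
    refine ⟨fun z hz => ?_, fun z hz h0 hv => ?_⟩
    · obtain ⟨a, b, hb, rfl⟩ := mem_ofPrime.1 hz
      rw [div_eq_mul_inv]
      exact mul_mem (hA a.2) ((h b).1 hb).2
    · obtain ⟨a, b, hb, rfl⟩ := mem_ofPrime.1 hz
      have ha0 : (a : K) ≠ 0 := fun ha => h0 (by rw [ha, zero_div])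
      rw [inv_div] at hv ⊢
      have : (a : K)⁻¹ ∈ V.toSubring := by
        have := mul_mem hv ((h b).1 hb).2
        rwa [div_mul_eq_mul_div, mul_inv_cancel₀ (hne b hb), one_div] at this
      exact mem_ofPrime.2 ⟨b, a, (h a).2 ⟨ha0, this⟩, rfl⟩

/-- The prime ideal of the elements of `A` that are not units in `V`. -/
def centreIdeal (A : Subring K) (V : LocalSubring K) (h : A ≤ V.toSubring) : Ideal A :=
  (IsLocalRing.maximalIdeal V.toSubring).comap (Subring.inclusion h)

instance (A : Subring K) (V : LocalSubring K) (h : A ≤ V.toSubring) :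
    (centreIdeal A V h).IsPrime :=
  Ideal.comap_isPrime _ _

theorem notMem_centreIdeal {A : Subring K} {V : LocalSubring K} {h : A ≤ V.toSubring} {a : A} :
    a ∉ centreIdeal A V h ↔ (a : K) ≠ 0 ∧ (a : K)⁻¹ ∈ V.toSubring := by
  rw [centreIdeal, Ideal.mem_comap, IsLocalRing.mem_maximalIdeal, mem_nonunits_iff, not_not,
    isUnit_subring_iff]
  rfl

theorem ofPrime_centreIdeal_le (A : Subring K) (V : LocalSubring K) (h : A ≤ V.toSubring) :
    LocalSubring.ofPrime A (centreIdeal A V h) ≤ V :=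
  ofPrime_le_iff.2 ⟨h, fun _ => notMem_centreIdeal⟩

/-- If `A'` is contained in the localization of `A` that `V` dominates, and vice versa, the two
localizations agree. -/
theorem ofPrime_eq_ofPrime {A A' : Subring K} {P : Ideal A} {P' : Ideal A'} [P.IsPrime]
    [P'.IsPrime] {V : LocalSubring K} (hP : LocalSubring.ofPrime A P ≤ V)
    (hP' : LocalSubring.ofPrime A' P' ≤ V)
    (h : A' ≤ (LocalSubring.ofPrime A P).toSubring)
    (h' : A ≤ (LocalSubring.ofPrime A' P').toSubring) :
    LocalSubring.ofPrime A P = LocalSubring.ofPrime A' P' := by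
  have key : ∀ {A A' : Subring K} {P : Ideal A} {P' : Ideal A'} [P.IsPrime] [P'.IsPrime],
      LocalSubring.ofPrime A P ≤ V → LocalSubring.ofPrime A' P' ≤ V →
      A' ≤ (LocalSubring.ofPrime A P).toSubring →
      (LocalSubring.ofPrime A' P').toSubring ≤ (LocalSubring.ofPrime A P).toSubring := by
    intro A A' P P' _ _ hP hP' h z hz
    obtain ⟨a, b, hb, rfl⟩ := mem_ofPrime.1 hz
    obtain ⟨h0, hv⟩ := ((ofPrime_le_iff.1 hP').2 b).1 hb
    rw [div_eq_mul_inv]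
    exact mul_mem (h a.2) ((localSubring_le_iff.1 hP).2 _ (h b.2) h0 hv)
  exact LocalSubring.toSubring_injective (le_antisymm (key hP' hP h') (key hP hP' h))

end Localization

/-! ### The standard chart -/

variable {k : Type*} [Field k]

/-- The embedding of the polynomial ring into its field of fractions. -/
abbrev polyEmb (k : Type*) [Field k] : MvPolynomial (Fin 2) k →+* FunField k :=
  algebraMap (MvPolynomial (Fin 2) k) (FunField k)

theorem polyEmb_ne_zero {q : MvPolynomial (Fin 2) k} (hq : q ≠ 0) : polyEmb k q ≠ 0 := by
  simpa using hq

theorem mem_standardChart {z : FunField k} :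
    z ∈ Algebra.adjoin k {x k, y k} ↔ ∃ q, z = polyEmb k q := by
  have : Algebra.adjoin k {x k, y k} =
      (IsScalarTower.toAlgHom k (MvPolynomial (Fin 2) k) (FunField k)).range := by
    rw [← Algebra.map_top, ← MvPolynomial.adjoin_range_X, AlgHom.map_adjoin]
    congr 1
    ext z
    simp [x, y, eq_comm]
  rw [this]
  simp [eq_comm]

theorem exists_reduced (z : FunField k) :
    ∃ a b : MvPolynomial (Fin 2) k, IsRelPrime a b ∧ b ≠ 0 ∧ z = polyEmb k a / polyEmb k b := by
  obtain ⟨a, b, h, rfl⟩ := IsFractionRing.exists_reduced_fraction (A := MvPolynomial (Fin 2) k) z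
  exact ⟨a, b, h, nonZeroDivisors.ne_zero b.2, IsFractionRing.mk'_eq_div b⟩

theorem div_mem_divisors_aux {p a b : MvPolynomial (Fin 2) k} (hp : Prime p)
    (hb : b ≠ 0) (h : ¬ p ∣ b) {c d : MvPolynomial (Fin 2) k} (hd : d ≠ 0)
    (e : polyEmb k a / polyEmb k b = polyEmb k c / polyEmb k d) (hdp : p ∣ d) : p ∣ c := by
  rw [div_eq_div_iff (polyEmb_ne_zero hb) (polyEmb_ne_zero hd), ← map_mul, ← map_mul] at e
  have e' : a * d = c * b := IsFractionRing.injective _ (FunField k) e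
  exact (hp.dvd_or_dvd (e' ▸ hdp.mul_left a : p ∣ c * b)).resolve_right h

/-- The local ring of the standard chart at the generic point of the curve `p = 0`. -/
def irreducibleRing (p : MvPolynomial (Fin 2) k) (hp : Irreducible p) :
    ValuationSubring (FunField k) where
  carrier := {z | ∃ a b, ¬ p ∣ b ∧ z = polyEmb k a / polyEmb k b}
  zero_mem' := ⟨0, 1, hp.prime.not_dvd_one, by simp⟩
  one_mem' := ⟨1, 1, hp.prime.not_dvd_one, by simp⟩
  neg_mem' := by
    rintro _ ⟨a, b, hb, rfl⟩
    exact ⟨-a, b, hb, by simp [neg_div]⟩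
  mul_mem' := by
    rintro _ _ ⟨a, b, hb, rfl⟩ ⟨c, d, hd, rfl⟩
    exact ⟨a * c, b * d, hp.prime.not_dvd_mul hb hd, by simp [div_mul_div_comm]⟩
  add_mem' := by
    rintro _ _ ⟨a, b, hb, rfl⟩ ⟨c, d, hd, rfl⟩
    have hb0 : b ≠ 0 := by rintro rfl; exact hb (dvd_zero p)
    have hd0 : d ≠ 0 := by rintro rfl; exact hd (dvd_zero p)
    exact ⟨a * d + b * c, b * d, hp.prime.not_dvd_mul hb hd, by
      rw [div_add_div _ _ (polyEmb_ne_zero hb0) (polyEmb_ne_zero hd0)]; simp⟩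
  mem_or_inv_mem' z := by
    obtain ⟨a, b, hab, hb, rfl⟩ := exists_reduced z
    by_cases h : p ∣ b
    · exact Or.inr ⟨b, a, fun h' => hp.not_isUnit (hab h' h), by simp⟩
    · exact Or.inl ⟨a, b, h, rfl⟩

theorem isUnit_irreducibleRing_iff {p : MvPolynomial (Fin 2) k} {hp : Irreducible p}
    (z : irreducibleRing p hp) {a b : MvPolynomial (Fin 2) k} (hb : ¬ p ∣ b)
    (hz : (z : FunField k) = polyEmb k a / polyEmb k b) : IsUnit z ↔ ¬ p ∣ a := by
  have hb0 : b ≠ 0 := by rintro rfl; exact hb (dvd_zero p)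
  rw [show IsUnit z ↔ (z : FunField k) ≠ 0 ∧ (z : FunField k)⁻¹ ∈ irreducibleRing p hp from
    isUnit_subring_iff z]
  rw [hz, inv_div]
  constructor
  · rintro ⟨h0, c, d, hd, h⟩ hpa
    have ha0 : a ≠ 0 := by rintro rfl; simp at h0
    exact hb (div_mem_divisors_aux hp.prime (by rintro rfl; simp at hd) hd ha0 h.symm hpa)
  · intro ha
    have ha0 : a ≠ 0 := by rintro rfl; exact ha (dvd_zero p)
    exact ⟨div_ne_zero (polyEmb_ne_zero ha0) (polyEmb_ne_zero hb0), b, a, ha, rfl⟩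

/-- The polynomial `p` is a uniformizer: non-units are the fractions whose numerator is divisible by
`p`, and only finitely many factors `p` can be extracted from a nonzero numerator. -/
theorem isDVR_irreducibleRing (p : MvPolynomial (Fin 2) k) (hp : Irreducible p) :
    IsDiscreteValuationRing (irreducibleRing p hp) := by
  apply IsDiscreteValuationRing.ofHasUnitMulPowIrreducibleFactorization
  have h1 : ¬ p ∣ 1 := hp.prime.not_dvd_one
  let t : irreducibleRing p hp := ⟨polyEmb k p, p, 1, h1, by simp⟩
  have htn : ¬ IsUnit t := by
    rw [isUnit_irreducibleRing_iff t (a := p) (b := 1) h1 (by simp [t])]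
    simp
  have ht0 : t ≠ 0 := fun h => polyEmb_ne_zero hp.ne_zero (congrArg Subtype.val h)
  have hdvd : ∀ z : irreducibleRing p hp, ¬ IsUnit z → t ∣ z := by
    intro z hz
    obtain ⟨a, b, hb, hab⟩ := z.2
    rw [isUnit_irreducibleRing_iff z hb hab, not_not] at hz
    obtain ⟨c, rfl⟩ := hz
    refine ⟨⟨polyEmb k c / polyEmb k b, c, b, hb, rfl⟩, Subtype.ext ?_⟩
    change (z : FunField k) = polyEmb k p * (polyEmb k c / polyEmb k b)
    rw [hab, map_mul, mul_div_assoc]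
  refine ⟨t, ⟨htn, fun {z w} hzw => ?_⟩, fun {z} hz => ?_⟩
  · by_contra! hc
    obtain ⟨z', rfl⟩ := hdvd z hc.1
    obtain ⟨w', rfl⟩ := hdvd w hc.2
    apply htn
    refine IsUnit.of_mul_eq_one (z' * w') ?_
    apply mul_left_cancel₀ ht0
    linear_combination -hzw
  · obtain ⟨a, b, hb, hab⟩ := z.2
    have ha0 : a ≠ 0 := by
      rintro rfl; exact hz (Subtype.ext (by simpa using hab))
    obtain ⟨n, c, hc, rfl⟩ := WfDvdMonoid.max_power_factor ha0 hp
    refine ⟨n, ?_⟩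
    let w : irreducibleRing p hp := ⟨polyEmb k c / polyEmb k b, c, b, hb, rfl⟩
    have hw : IsUnit w := (isUnit_irreducibleRing_iff w hb rfl).2 hc
    refine ⟨hw.unit, Subtype.ext ?_⟩
    change polyEmb k p ^ n * (polyEmb k c / polyEmb k b) = (z : FunField k)
    rw [hab, map_mul, map_pow, mul_div_assoc]

/-- A plane curve does not lie both in a fibre of `X 0` and in a fibre of `X 1`. -/
theorem not_dvd_both {p : MvPolynomial (Fin 2) k} (hp : Irreducible p) (f g : Polynomial k)
    (hf : f ≠ 0) (hg : g ≠ 0) :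
    ¬ (p ∣ Polynomial.aeval (MvPolynomial.X 0) f ∧ p ∣ Polynomial.aeval (MvPolynomial.X 1) g) := by
  rintro ⟨h0, h1⟩
  -- A divisor of a polynomial in one variable has degree zero in the other one. Applied to both
  -- variables, this makes `p` a constant.
  have key : ∀ (i : Fin 2) (f : Polynomial k), f ≠ 0 →
      p ∣ Polynomial.aeval (MvPolynomial.X i : MvPolynomial (Fin 2) k) f →
      ∀ j, j ≠ i → MvPolynomial.degreeOf j p = 0 := by
    rintro i f hf ⟨q, hq⟩ j hj
    have hdeg : MvPolynomial.degreeOf j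
        (Polynomial.aeval (MvPolynomial.X i : MvPolynomial (Fin 2) k) f) = 0 := by
      rw [Polynomial.aeval_eq_sum_range]
      refine Nat.le_zero.1 ((MvPolynomial.degreeOf_sum_le _ _ _).trans (Finset.sup_le ?_))
      intro n _
      rw [MvPolynomial.smul_eq_C_mul]
      refine (MvPolynomial.degreeOf_C_mul_le _ _ _).trans ((MvPolynomial.degreeOf_pow_le _ _ _).trans ?_)
      rw [MvPolynomial.degreeOf_X_of_ne hj]; simp
    have hf' : Polynomial.aeval (MvPolynomial.X i : MvPolynomial (Fin 2) k) f ≠ 0 := by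
      have := MvPolynomial.algebraicIndependent_X (Fin 2) k
      exact fun h0 => hf ((transcendental_iff.1 (this.transcendental i)) f h0)
    rw [hq, MvPolynomial.degreeOf_mul_eq hp.ne_zero (by rintro rfl; simp [hq] at hf')] at hdeg
    lia
  have d1 := key 0 f hf h0 1 (by simp)
  have d0 := key 1 g hg h1 0 (by simp)
  have htot : p.totalDegree = 0 := by
    rw [MvPolynomial.totalDegree_eq_zero_iff]
    intro m hm i
    have h := MvPolynomial.monomial_le_degreeOf i hm
    fin_cases i
    · exact Nat.le_zero.1 (h.trans d0.le)
    · exact Nat.le_zero.1 (h.trans d1.le)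
  rw [MvPolynomial.totalDegree_eq_zero_iff_eq_C] at htot
  apply hp.not_isUnit
  rw [htot]
  refine (IsUnit.mk0 _ fun h => hp.ne_zero ?_).map MvPolynomial.C
  rw [htot, h, map_zero]

/-- The divisorial valuation of the plane curve `p = 0`. -/
def ofIrreducible (p : MvPolynomial (Fin 2) k) (hp : Irreducible p) : DivisorialValuation k where
  ring := irreducibleRing p hp
  isDVR := isDVR_irreducibleRing p hp
  algebraMap_mem c := ⟨MvPolynomial.C c, 1, hp.prime.not_dvd_one, by
    rw [map_one, div_one, IsScalarTower.algebraMap_apply k (MvPolynomial (Fin 2) k)]; rfl⟩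
  residue_transcendental := by
    -- One of the two coordinates is non-constant on the curve, so its residue is transcendental.
    have main : ∃ i : Fin 2, ∀ f : Polynomial k, f ≠ 0 →
        ¬ p ∣ Polynomial.aeval (MvPolynomial.X i : MvPolynomial (Fin 2) k) f := by
      by_contra! hc
      obtain ⟨f, hf, h0⟩ := hc 0
      obtain ⟨g, hg, h1⟩ := hc 1
      exact not_dvd_both hp f g hf hg ⟨h0, h1⟩
    obtain ⟨i, hi⟩ := main
    refine ⟨polyEmb k (MvPolynomial.X i), ⟨MvPolynomial.X i, 1, hp.prime.not_dvd_one, by simp⟩, fun f hf => ?_⟩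
    have h1 : Polynomial.aeval (polyEmb k (MvPolynomial.X i)) f =
        polyEmb k (Polynomial.aeval (MvPolynomial.X i) f) :=
      Polynomial.aeval_algebraMap_apply (FunField k) (MvPolynomial.X i) f
    rw [h1]
    refine ⟨polyEmb_ne_zero fun h0 => hi f hf (h0 ▸ dvd_zero p), 1, _, hi f hf, by simp⟩

theorem polyEmb_mem_ofIrreducible (p : MvPolynomial (Fin 2) k) (hp : Irreducible p)
    (q : MvPolynomial (Fin 2) k) : polyEmb k q ∈ (ofIrreducible p hp).ring :=
  ⟨q, 1, hp.prime.not_dvd_one, by simp⟩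

theorem ord_ofIrreducible_of_not_dvd {p : MvPolynomial (Fin 2) k} (hp : Irreducible p)
    {q : MvPolynomial (Fin 2) k} (h : ¬ p ∣ q) : (ofIrreducible p hp).ord (polyEmb k q) = 0 := by
  have h1 := (ofIrreducible p hp).ord_nonneg (polyEmb_mem_ofIrreducible p hp q)
  have h2 : (polyEmb k q)⁻¹ ∈ (ofIrreducible p hp).ring := ⟨1, q, h, by simp⟩
  have h3 := (ofIrreducible p hp).ord_nonneg h2
  rw [DivisorialValuation.ord_inv] at h3
  lia

theorem ord_ofIrreducible_self {p : MvPolynomial (Fin 2) k} (hp : Irreducible p) :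
    (ofIrreducible p hp).ord (polyEmb k p) = 1 := by
  have hp0 := polyEmb_ne_zero hp.ne_zero
  have hinv : (polyEmb k p)⁻¹ ∉ (ofIrreducible p hp).ring := by
    rintro ⟨a, b, hb, h⟩
    have : p ∣ 1 := div_mem_divisors_aux hp.prime (by rintro rfl; simp at hb) hb hp.ne_zero
      (a := a) (c := 1) (by rw [← h]; simp) dvd_rfl
    exact hp.prime.not_dvd_one this
  rw [DivisorialValuation.mem_ring_iff _ (inv_ne_zero hp0), DivisorialValuation.ord_inv] at hinv
  refine (ofIrreducible p hp).ord_eq_of_forall hp0 (by lia) fun z hz hpos => ?_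
  obtain ⟨a, b, hb, rfl⟩ := ((ofIrreducible p hp).mem_ring_iff hz).2 hpos.le
  have ha0 : polyEmb k a ≠ 0 := fun h => hz (by rw [h, zero_div])
  have hb0 : polyEmb k b ≠ 0 := fun h => hz (by rw [h, div_zero])
  rw [DivisorialValuation.ord_div _ ha0 hb0, ord_ofIrreducible_of_not_dvd hp hb] at hpos
  have : p ∣ a := by
    by_contra hpa
    rw [ord_ofIrreducible_of_not_dvd hp hpa] at hpos
    lia
  obtain ⟨c, rfl⟩ := this
  rw [← DivisorialValuation.mem_ring_iff _ (div_ne_zero hz hp0)]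
  refine ⟨c, b, hb, ?_⟩
  rw [map_mul]
  field_simp

theorem ord_ofIrreducible_pos_iff {p : MvPolynomial (Fin 2) k} (hp : Irreducible p)
    {q : MvPolynomial (Fin 2) k} (hq : q ≠ 0) :
    0 < (ofIrreducible p hp).ord (polyEmb k q) ↔ p ∣ q := by
  constructor
  · intro h
    by_contra hn
    rw [ord_ofIrreducible_of_not_dvd hp hn] at h
    lia
  · rintro ⟨r, rfl⟩
    have hr : r ≠ 0 := right_ne_zero_of_mul hq
    rw [map_mul, DivisorialValuation.ord_mul _ (polyEmb_ne_zero hp.ne_zero) (polyEmb_ne_zero hr),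
      ord_ofIrreducible_self]
    have := (ofIrreducible p hp).ord_nonneg (polyEmb_mem_ofIrreducible p hp r)
    lia

/-- A function without poles along the curves through the point `P` is regular at `P`. -/
theorem exists_div_of_ord_nonneg (P : Ideal (MvPolynomial (Fin 2) k)) [P.IsPrime] {z : FunField k}
    (h : ∀ p (hp : Irreducible p), p ∈ P → 0 ≤ (ofIrreducible p hp).ord z) :
    ∃ a b, b ∉ P ∧ z = polyEmb k a / polyEmb k b := by
  obtain ⟨a, b, hab, hb, rfl⟩ := exists_reduced z
  refine ⟨a, b, fun hbP => ?_, rfl⟩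
  rcases eq_or_ne a 0 with rfl | ha
  · have hu : IsUnit b := hab (dvd_zero b) dvd_rfl
    exact Ideal.IsPrime.ne_top ‹_› (Ideal.eq_top_of_isUnit_mem _ hbP hu)
  -- A prime ideal containing the denominator contains one of its prime factors, and the reduced
  -- fraction has a pole along the corresponding curve through `P`.
  obtain ⟨p, hpP, hp⟩ : ∃ p, p ∈ P ∧ (Irreducible p ∧ p ∣ b) := by
    have hprod : (UniqueFactorizationMonoid.factors b).prod ∈ P := by
      obtain ⟨u, hu⟩ := UniqueFactorizationMonoid.factors_prod hb
      rw [← hu] at hbP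
      exact (Ideal.IsPrime.mem_or_mem ‹_› hbP).resolve_right fun h =>
        Ideal.IsPrime.ne_top ‹_› (Ideal.eq_top_of_isUnit_mem _ h u.isUnit)
    obtain ⟨p, hpm, hpP⟩ := (Ideal.IsPrime.multiset_prod_mem_iff_exists_mem ‹_› _).1 hprod
    exact ⟨p, hpP, UniqueFactorizationMonoid.irreducible_of_factor p hpm,
      UniqueFactorizationMonoid.dvd_of_mem_factors hpm⟩
  have h1 := h p hp.1 hpP
  have hpa : ¬ p ∣ a := fun hpa => hp.1.not_isUnit (hab hpa hp.2)
  rw [DivisorialValuation.ord_div _ (polyEmb_ne_zero ha) (polyEmb_ne_zero hb),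
    ord_ofIrreducible_of_not_dvd hp.1 hpa] at h1
  have := (ord_ofIrreducible_pos_iff hp.1 hb).2 hp.2
  lia

/-- A rational function without poles on the standard chart is a polynomial. -/
theorem exists_poly_of_ord_nonneg {z : FunField k}
    (h : ∀ p (hp : Irreducible p), 0 ≤ (ofIrreducible p hp).ord z) : ∃ q, z = polyEmb k q := by
  obtain ⟨a, b, hab, hb, rfl⟩ := exists_reduced z
  rcases eq_or_ne a 0 with rfl | ha
  · exact ⟨0, by simp⟩
  have hu : IsUnit b := by
    by_contra hu
    obtain ⟨p, hp, hpb⟩ := WfDvdMonoid.exists_irreducible_factor hu hb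
    have h1 := h p hp
    have hpa : ¬ p ∣ a := fun hpa => hp.not_isUnit (hab hpa hpb)
    rw [DivisorialValuation.ord_div _ (polyEmb_ne_zero ha) (polyEmb_ne_zero hb),
      ord_ofIrreducible_of_not_dvd hp hpa] at h1
    have := (ord_ofIrreducible_pos_iff hp hb).2 hpb
    lia
  obtain ⟨c, hc⟩ := hu.exists_right_inv
  refine ⟨a * c, ?_⟩
  rw [div_eq_iff (polyEmb_ne_zero hb), ← map_mul, mul_assoc, mul_comm c b, hc, mul_one]

end PlanePairs

end

noncomputable section

universe u

namespace PlanePairs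

variable {k : Type*} [Field k]

/-! ### Coordinate systems of the function field -/

theorem x_ne_zero : x k ≠ 0 := polyEmb_ne_zero (MvPolynomial.X_ne_zero 0)

theorem y_ne_zero : y k ≠ 0 := polyEmb_ne_zero (MvPolynomial.X_ne_zero 1)

/-- With this bound, two functions over which the field is algebraic are automatically independent,
so that `exists_coordinateAut` only needs to know that they generate. -/
theorem two_le_trdeg_funField {k : Type u} [Field k] :
    Cardinal.lift.{u} (Cardinal.mk (Fin 2)) ≤ Cardinal.lift.{0} (Algebra.trdeg k (FunField k)) :=
  ((MvPolynomial.algebraicIndependent_X (Fin 2) k).map'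
    (f := IsScalarTower.toAlgHom k (MvPolynomial (Fin 2) k) (FunField k))
    (IsFractionRing.injective _ _)).lift_cardinalMk_le_trdeg

theorem exists_extension (f : MvPolynomial (Fin 2) k →ₐ[k] FunField k)
    (hf : Function.Injective f) :
    ∃ τ : FunField k →ₐ[k] FunField k, ∀ q, τ (polyEmb k q) = f q := by
  have hf' : Function.Injective f.toRingHom := hf
  refine ⟨IsFractionRing.liftAlgHom (K := FunField k) (g := f) hf, fun q => ?_⟩
  rw [IsFractionRing.liftAlgHom_apply]
  exact IsFractionRing.lift_algebraMap hf' q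

/-- Two functions that generate the function field are the images of `x` and `y` under
an automorphism. -/
theorem exists_coordinateAut {u v : FunField k}
    (hx : x k ∈ IntermediateField.adjoin k {u, v}) (hy : y k ∈ IntermediateField.adjoin k {u, v}) :
    ∃ σ : FunField k ≃ₐ[k] FunField k, σ (x k) = u ∧ σ (y k) = v := by
  have htop : ∀ (F : IntermediateField k (FunField k)), x k ∈ F → y k ∈ F → ∀ z, z ∈ F := by
    intro F hx hy z
    have hle : Algebra.adjoin k {x k, y k} ≤ F.toSubalgebra :=
      Algebra.adjoin_le (by rintro _ (rfl | rfl) <;> assumption)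
    obtain ⟨a, b, -, -, rfl⟩ := exists_reduced z
    exact div_mem (hle (mem_standardChart.2 ⟨a, rfl⟩)) (hle (mem_standardChart.2 ⟨b, rfl⟩))
  have hrange : Set.range ![u, v] = {u, v} := by simp [Set.pair_comm]
  have halg : Algebra.IsAlgebraic (Algebra.adjoin k (Set.range ![u, v])) (FunField k) := by
    constructor
    intro z
    have hz := htop _ hx hy z
    rw [IntermediateField.mem_adjoin_iff_div, ← hrange] at hz
    obtain ⟨r, hr, s, hs, rfl⟩ := hz
    rw [div_eq_mul_inv]
    exact (isAlgebraic_algebraMap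
      (⟨r, hr⟩ : Algebra.adjoin k (Set.range ![u, v]))).mul (isAlgebraic_algebraMap
      (⟨s, hs⟩ : Algebra.adjoin k (Set.range ![u, v]))).inv
  have hind : AlgebraicIndependent k ![u, v] :=
    (Algebra.IsAlgebraic.isTranscendenceBasis_of_lift_le_trdeg_of_finite k ![u, v]
      two_le_trdeg_funField).1
  obtain ⟨τ, hτ⟩ := exists_extension (MvPolynomial.aeval ![u, v]) hind
  have hτx : τ (x k) = u := by simp [x, hτ]
  have hτy : τ (y k) = v := by simp [y, hτ]
  have hsurj : Function.Surjective τ := by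
    have hle : IntermediateField.adjoin k {u, v} ≤ τ.fieldRange := by
      rw [IntermediateField.adjoin_le_iff]
      rintro _ (rfl | rfl)
      · exact ⟨_, hτx⟩
      · exact ⟨_, hτy⟩
    exact fun z => htop _ (hle hx) (hle hy) z
  exact ⟨AlgEquiv.ofBijective τ ⟨τ.injective, hsurj⟩, hτx, hτy⟩

/-- The standard chart in the coordinates given by `σ`. -/
def coordChart (σ : FunField k ≃ₐ[k] FunField k) : Subalgebra k (FunField k) :=
  (Algebra.adjoin k {x k, y k}).map (σ : FunField k →ₐ[k] FunField k)

theorem coordChart_eq (σ : FunField k ≃ₐ[k] FunField k) :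
    coordChart σ = Algebra.adjoin k {σ (x k), σ (y k)} := by
  rw [coordChart, AlgHom.map_adjoin, Set.image_pair]; rfl

theorem mem_coordChart {σ : FunField k ≃ₐ[k] FunField k} {z : FunField k} :
    z ∈ coordChart σ ↔ ∃ q, z = σ (polyEmb k q) := by
  rw [coordChart, Subalgebra.mem_map]
  constructor
  · rintro ⟨w, hw, rfl⟩
    obtain ⟨q, rfl⟩ := mem_standardChart.1 hw
    exact ⟨q, rfl⟩
  · rintro ⟨q, rfl⟩
    exact ⟨_, mem_standardChart.2 ⟨q, rfl⟩, rfl⟩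

theorem coordChart_refl : coordChart (AlgEquiv.refl : FunField k ≃ₐ[k] FunField k) =
    Algebra.adjoin k {x k, y k} := coordChart_eq _

section Generators

variable (u v : FunField k)

theorem fst_mem_field : u ∈ IntermediateField.adjoin k {u, v} :=
  IntermediateField.subset_adjoin k _ (by simp)

theorem snd_mem_field : v ∈ IntermediateField.adjoin k {u, v} :=
  IntermediateField.subset_adjoin k _ (by simp)

theorem fst_mem_algebra : u ∈ Algebra.adjoin k {u, v} := Algebra.subset_adjoin (by simp)

theorem snd_mem_algebra : v ∈ Algebra.adjoin k {u, v} := Algebra.subset_adjoin (by simp)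

end Generators

theorem exists_aut_x_inv_y : ∃ σ : FunField k ≃ₐ[k] FunField k,
    σ (x k) = x k ∧ σ (y k) = (y k)⁻¹ :=
  exists_coordinateAut (fst_mem_field _ _) (by
    simpa using inv_mem (snd_mem_field (x k) (y k)⁻¹))

theorem exists_aut_inv_x (a : ℕ) : ∃ σ : FunField k ≃ₐ[k] FunField k,
    σ (x k) = (x k)⁻¹ ∧ σ (y k) = x k ^ a * y k := by
  have h := inv_mem (fst_mem_field (x k)⁻¹ (x k ^ a * y k))
  rw [inv_inv] at h
  refine exists_coordinateAut h ?_
  have := div_mem (snd_mem_field (x k)⁻¹ (x k ^ a * y k)) (pow_mem h a)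
  rwa [mul_div_cancel_left₀ _ (pow_ne_zero a (x_ne_zero (k := k)))] at this

theorem exists_aut_inv_inv (a : ℕ) : ∃ σ : FunField k ≃ₐ[k] FunField k,
    σ (x k) = (x k)⁻¹ ∧ σ (y k) = (x k ^ a * y k)⁻¹ := by
  obtain ⟨σ, h1, h2⟩ := exists_aut_x_inv_y (k := k)
  obtain ⟨τ, h3, h4⟩ := exists_aut_inv_x (k := k) a
  exact ⟨σ.trans τ, by simp [h1, h3], by simp [h2, h4]⟩

theorem exists_aut_plane_x : ∃ σ : FunField k ≃ₐ[k] FunField k,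
    σ (x k) = (x k)⁻¹ ∧ σ (y k) = y k / x k := by
  have h := inv_mem (fst_mem_field (x k)⁻¹ (y k / x k))
  rw [inv_inv] at h
  refine exists_coordinateAut h ?_
  have := mul_mem (snd_mem_field (x k)⁻¹ (y k / x k)) h
  rwa [div_mul_cancel₀ _ x_ne_zero] at this

theorem exists_aut_plane_y : ∃ σ : FunField k ≃ₐ[k] FunField k,
    σ (x k) = (y k)⁻¹ ∧ σ (y k) = x k / y k := by
  have h := inv_mem (fst_mem_field (y k)⁻¹ (x k / y k))
  rw [inv_inv] at h
  refine exists_coordinateAut ?_ h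
  have := mul_mem (snd_mem_field (y k)⁻¹ (x k / y k)) h
  rwa [div_mul_cancel₀ _ y_ne_zero] at this

theorem Surface.exists_eq_coordChart (S : Surface) {A : Subalgebra k (FunField k)}
    (hA : A ∈ S.charts k) : ∃ σ : FunField k ≃ₐ[k] FunField k, A = coordChart σ := by
  cases S with
  | plane =>
    rcases hA with rfl | rfl | rfl
    · exact ⟨_, coordChart_refl.symm⟩
    · obtain ⟨σ, h1, h2⟩ := exists_aut_plane_x (k := k)
      exact ⟨σ, by rw [coordChart_eq, h1, h2]⟩
    · obtain ⟨σ, h1, h2⟩ := exists_aut_plane_y (k := k)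
      exact ⟨σ, by rw [coordChart_eq, h1, h2]⟩
  | hirzebruch a =>
    rcases hA with rfl | rfl | rfl | rfl
    · exact ⟨_, coordChart_refl.symm⟩
    · obtain ⟨σ, h1, h2⟩ := exists_aut_x_inv_y (k := k)
      exact ⟨σ, by rw [coordChart_eq, h1, h2]⟩
    · obtain ⟨σ, h1, h2⟩ := exists_aut_inv_x (k := k) a
      exact ⟨σ, by rw [coordChart_eq, h1, h2]⟩
    · obtain ⟨σ, h1, h2⟩ := exists_aut_inv_inv (k := k) a
      exact ⟨σ, by rw [coordChart_eq, h1, h2]⟩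

/-! ### Separatedness and completeness -/

/-- The elements of `A'` are fractions of elements of `A` whose denominators become invertible
in `A'`: the intersection of the two charts is a distinguished open subset of the first. -/
def ChartSep (A A' : Subalgebra k (FunField k)) : Prop :=
  ∀ a ∈ A', ∃ b ∈ A, ∃ m ∈ A, m ≠ 0 ∧ m⁻¹ ∈ A' ∧ a = b / m

theorem ChartSep.refl (A : Subalgebra k (FunField k)) : ChartSep A A := fun a ha =>
  ⟨a, ha, 1, one_mem _, one_ne_zero, by simp, by simp⟩

/-- The property passes to sums and products by taking common denominators, so generators suffice.
-/
theorem ChartSep.of_generators {A : Subalgebra k (FunField k)} {u v : FunField k}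
    (h : ∀ a ∈ ({u, v} : Set (FunField k)), ∃ b ∈ A, ∃ m ∈ A,
      m ≠ 0 ∧ m⁻¹ ∈ Algebra.adjoin k {u, v} ∧ a = b / m) :
    ChartSep A (Algebra.adjoin k {u, v}) := by
  intro a ha
  induction ha using Algebra.adjoin_induction with
  | mem a ha => exact h a ha
  | algebraMap c => exact ⟨_, A.algebraMap_mem c, 1, one_mem _, one_ne_zero, by simp, by simp⟩
  | add a a' _ _ h h' =>
    obtain ⟨b, hb, m, hm, hm0, hmi, rfl⟩ := h
    obtain ⟨b', hb', m', hm', hm0', hmi', rfl⟩ := h'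
    exact ⟨b * m' + m * b', add_mem (mul_mem hb hm') (mul_mem hm hb'), m * m', mul_mem hm hm',
      mul_ne_zero hm0 hm0', by rw [mul_inv]; exact mul_mem hmi hmi', div_add_div _ _ hm0 hm0'⟩
  | mul a a' _ _ h h' =>
    obtain ⟨b, hb, m, hm, hm0, hmi, rfl⟩ := h
    obtain ⟨b', hb', m', hm', hm0', hmi', rfl⟩ := h'
    exact ⟨b * b', mul_mem hb hb', m * m', mul_mem hm hm',
      mul_ne_zero hm0 hm0', by rw [mul_inv]; exact mul_mem hmi hmi', div_mul_div_comm _ _ _ _⟩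

/-- The surfaces are toric: coordinates of one chart are Laurent monomials in those of another. In
each hypothesis the first equation displays a coordinate as a quotient of monomials, and the second
shows that the inverse of the denominator is a monomial of the new chart. -/
theorem ChartSep.of_monomials {u v u' v' : FunField k}
    (h : ∃ i j i₂ j₂ i₃ j₃ : ℕ, u' * (u ^ i₂ * v ^ j₂) = u ^ i * v ^ j ∧
      (u ^ i₂ * v ^ j₂) * (u' ^ i₃ * v' ^ j₃) = 1)
    (h' : ∃ i j i₂ j₂ i₃ j₃ : ℕ, v' * (u ^ i₂ * v ^ j₂) = u ^ i * v ^ j ∧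
      (u ^ i₂ * v ^ j₂) * (u' ^ i₃ * v' ^ j₃) = 1) :
    ChartSep (Algebra.adjoin k {u, v}) (Algebra.adjoin k {u', v'}) := by
  have hmono : ∀ (u v : FunField k) (i j : ℕ), u ^ i * v ^ j ∈ Algebra.adjoin k {u, v} :=
    fun u v i j => mul_mem (pow_mem (fst_mem_algebra u v) i) (pow_mem (snd_mem_algebra u v) j)
  refine ChartSep.of_generators ?_
  have key : ∀ w : FunField k, (∃ i j i₂ j₂ i₃ j₃ : ℕ, w * (u ^ i₂ * v ^ j₂) = u ^ i * v ^ j ∧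
      (u ^ i₂ * v ^ j₂) * (u' ^ i₃ * v' ^ j₃) = 1) → ∃ b ∈ Algebra.adjoin k {u, v},
      ∃ m ∈ Algebra.adjoin k {u, v}, m ≠ 0 ∧ m⁻¹ ∈ Algebra.adjoin k {u', v'} ∧ w = b / m := by
    rintro w ⟨i, j, i₂, j₂, i₃, j₃, h1, h2⟩
    have hm0 := left_ne_zero_of_mul_eq_one h2
    exact ⟨_, hmono u v i j, _, hmono u v i₂ j₂, hm0,
      by rw [inv_eq_of_mul_eq_one_right h2]; exact hmono u' v' i₃ j₃, by
      rw [eq_div_iff hm0, h1]⟩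
  rintro _ (rfl | rfl)
  · exact key _ h
  · exact key _ h'

theorem Surface.chartSep (S : Surface) {A A' : Subalgebra k (FunField k)}
    (hA : A ∈ S.charts k) (hA' : A' ∈ S.charts k) : ChartSep A A' := by
  have hx := x_ne_zero (k := k)
  have hy := y_ne_zero (k := k)
  cases S with
  | plane =>
    rcases hA with rfl | rfl | rfl <;> rcases hA' with rfl | rfl | rfl
    · exact ChartSep.refl _
    · exact .of_monomials ⟨0, 0, 1, 0, 1, 0, by field_simp, by field_simp⟩
        ⟨0, 1, 1, 0, 1, 0, by field_simp, by field_simp⟩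
    · exact .of_monomials ⟨0, 0, 0, 1, 1, 0, by field_simp, by field_simp⟩
        ⟨1, 0, 0, 1, 1, 0, by field_simp, by field_simp⟩
    · exact .of_monomials ⟨0, 0, 1, 0, 1, 0, by field_simp, by field_simp⟩
        ⟨0, 1, 1, 0, 1, 0, by field_simp, by field_simp⟩
    · exact ChartSep.refl _
    · exact .of_monomials ⟨1, 0, 0, 1, 0, 1, by field_simp, by field_simp⟩
        ⟨0, 0, 0, 1, 0, 1, by field_simp, by field_simp⟩
    · exact .of_monomials ⟨0, 1, 1, 0, 0, 1, by field_simp, by field_simp⟩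
        ⟨0, 0, 1, 0, 0, 1, by field_simp, by field_simp⟩
    · exact .of_monomials ⟨1, 0, 0, 1, 0, 1, by field_simp, by field_simp⟩
        ⟨0, 0, 0, 1, 0, 1, by field_simp, by field_simp⟩
    · exact ChartSep.refl _
  | hirzebruch a =>
    rcases hA with rfl | rfl | rfl | rfl <;> rcases hA' with rfl | rfl | rfl | rfl
    · exact ChartSep.refl _
    · exact .of_monomials ⟨1, 0, 0, 0, 0, 0, by simp, by simp⟩
        ⟨0, 0, 0, 1, 0, 1, by field_simp, by field_simp⟩
    · exact .of_monomials ⟨0, 0, 1, 0, 1, 0, by field_simp, by field_simp⟩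
        ⟨a, 1, 0, 0, 0, 0, by simp, by simp⟩
    · exact .of_monomials ⟨0, 0, 1, 0, 1, 0, by field_simp, by field_simp⟩
        ⟨0, 0, a, 1, 0, 1, by field_simp, by field_simp⟩
    · exact .of_monomials ⟨1, 0, 0, 0, 0, 0, by simp, by simp⟩
        ⟨0, 0, 0, 1, 0, 1, by field_simp, by field_simp⟩
    · exact ChartSep.refl _
    · exact .of_monomials ⟨0, 0, 1, 0, 1, 0, by field_simp, by field_simp⟩
        ⟨a, 0, 0, 1, a, 1, by simp only [inv_pow]; field_simp, by simp only [inv_pow]; field_simp⟩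
    · exact .of_monomials ⟨0, 0, 1, 0, 1, 0, by field_simp, by field_simp⟩
        ⟨0, 1, a, 0, a, 0, by simp only [inv_pow]; field_simp, by simp only [inv_pow]; field_simp⟩
    · exact .of_monomials ⟨0, 0, 1, 0, 1, 0, by field_simp, by field_simp⟩
        ⟨a, 1, 0, 0, 0, 0, by simp only [inv_pow]; field_simp, by simp⟩
    · exact .of_monomials ⟨0, 0, 1, 0, 1, 0, by field_simp, by field_simp⟩
        ⟨0, 0, a, 1, 0, 1, by simp only [inv_pow]; field_simp, by simp only [inv_pow]; field_simp⟩
    · exact ChartSep.refl _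
    · exact .of_monomials ⟨1, 0, 0, 0, 0, 0, by simp, by simp⟩
        ⟨0, 0, 0, 1, 0, 1, by field_simp, by field_simp⟩
    · exact .of_monomials ⟨0, 0, 1, 0, 1, 0, by field_simp, by field_simp⟩
        ⟨a, 0, 0, 1, a, 1, by simp only [inv_pow]; field_simp, by simp only [inv_pow]; field_simp⟩
    · exact .of_monomials ⟨0, 0, 1, 0, 1, 0, by field_simp, by field_simp⟩
        ⟨0, 1, a, 0, a, 0, by simp only [inv_pow]; field_simp, by simp only [inv_pow]; field_simp⟩
    · exact .of_monomials ⟨1, 0, 0, 0, 0, 0, by simp, by simp⟩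
        ⟨0, 0, 0, 1, 0, 1, by field_simp, by field_simp⟩
    · exact ChartSep.refl _

theorem adjoin_toSubring_le {u v : FunField k} {R : Subring (FunField k)}
    (hk : ∀ c, algebraMap k (FunField k) c ∈ R) (hu : u ∈ R) (hv : v ∈ R) :
    (Algebra.adjoin k {u, v}).toSubring ≤ R := by
  intro z hz
  have : Algebra.adjoin k {u, v} ≤ { R with algebraMap_mem' := hk } :=
    Algebra.adjoin_le (by rintro _ (rfl | rfl) <;> assumption)
  exact this hz

/-- Every valuation ring over `k` contains the coordinate ring of one of the charts. -/
theorem Surface.exists_chart_le (S : Surface) (V : ValuationSubring (FunField k))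
    (hk : ∀ c, algebraMap k (FunField k) c ∈ V) :
    ∃ A ∈ S.charts k, A.toSubring ≤ V.toSubring := by
  have le {u v : FunField k} (hu : u ∈ V) (hv : v ∈ V) :
      (Algebra.adjoin k {u, v}).toSubring ≤ V.toSubring := adjoin_toSubring_le hk hu hv
  have hx := x_ne_zero (k := k)
  have hy := y_ne_zero (k := k)
  cases S with
  | plane =>
    have hxy := V.mem_or_inv_mem (y k / x k)
    rw [inv_div] at hxy
    by_cases h1 : x k ∈ V ∧ y k ∈ V
    · exact ⟨_, Or.inl rfl, le h1.1 h1.2⟩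
    rcases hxy with h | h
    · refine ⟨_, Or.inr (Or.inl rfl), le ((V.mem_or_inv_mem _).resolve_left fun hxV => ?_) h⟩
      exact h1 ⟨hxV, by simpa [hx] using mul_mem h hxV⟩
    · refine ⟨_, Or.inr (Or.inr rfl), le ((V.mem_or_inv_mem _).resolve_left fun hyV => ?_) h⟩
      exact h1 ⟨by simpa [hy] using mul_mem h hyV, hyV⟩
  | hirzebruch a =>
    rcases V.mem_or_inv_mem (x k) with h1 | h1
    · rcases V.mem_or_inv_mem (y k) with h2 | h2
      · exact ⟨_, Or.inl rfl, le h1 h2⟩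
      · exact ⟨_, Or.inr (Or.inl rfl), le h1 h2⟩
    · rcases V.mem_or_inv_mem (x k ^ a * y k) with h2 | h2
      · exact ⟨_, Or.inr (Or.inr (Or.inl rfl)), le h1 h2⟩
      · exact ⟨_, Or.inr (Or.inr (Or.inr rfl)), le h1 h2⟩

/-- The denominators become units in `A'`, hence in `V`, and therefore lie outside the prime `P`
under the centre of `V`. -/
theorem ChartSep.le_ofPrime {A A' : Subalgebra k (FunField k)} (h : ChartSep A A')
    {V : LocalSubring (FunField k)} {P : Ideal A.toSubring} [P.IsPrime]
    (hP : LocalSubring.ofPrime A.toSubring P ≤ V) (hA' : A'.toSubring ≤ V.toSubring) :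
    A'.toSubring ≤ (LocalSubring.ofPrime A.toSubring P).toSubring := by
  intro a ha
  obtain ⟨b, hb, m, hm, hm0, hmi, rfl⟩ := h a ha
  exact mem_ofPrime.2 ⟨⟨b, hb⟩, ⟨m, hm⟩, ((ofPrime_le_iff.1 hP).2 ⟨m, hm⟩).2
    ⟨hm0, hA' hmi⟩, rfl⟩

/-- The centre of a local ring is unique. -/
theorem Surface.point_unique (S : Surface) {R R' V : LocalSubring (FunField k)}
    (hR : R ∈ S.points k) (hR' : R' ∈ S.points k) (h : R ≤ V) (h' : R' ≤ V) : R = R' := by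
  obtain ⟨A, hA, P, hP, rfl⟩ := hR
  obtain ⟨A', hA', P', hP', rfl⟩ := hR'
  exact ofPrime_eq_ofPrime h h'
    ((S.chartSep hA hA').le_ofPrime h (ofPrime_le_iff.1 h').1)
    ((S.chartSep hA' hA).le_ofPrime h' (ofPrime_le_iff.1 h).1)

/-! ### Prime divisors in charts -/

/-- The curve `p = 0` in the coordinates given by `σ`. -/
def chartCurve (σ : FunField k ≃ₐ[k] FunField k) (p : MvPolynomial (Fin 2) k)
    (hp : Irreducible p) : DivisorialValuation k := (ofIrreducible p hp).comap σ.symm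

theorem ord_chartCurve (σ : FunField k ≃ₐ[k] FunField k) (p : MvPolynomial (Fin 2) k)
    (hp : Irreducible p) (z : FunField k) :
    (chartCurve σ p hp).ord (σ z) = (ofIrreducible p hp).ord z := by
  rw [chartCurve, DivisorialValuation.ord_comap, AlgEquiv.symm_apply_apply]

theorem coordChart_le_chartCurve (σ : FunField k ≃ₐ[k] FunField k) (p : MvPolynomial (Fin 2) k)
    (hp : Irreducible p) :
    (coordChart σ).toSubring ≤ (chartCurve σ p hp).ring.toLocalSubring.toSubring := by
  intro z hz
  obtain ⟨q, rfl⟩ := mem_coordChart.1 hz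
  change σ.symm _ ∈ (ofIrreducible p hp).ring
  rw [AlgEquiv.symm_apply_apply]
  exact polyEmb_mem_ofIrreducible p hp q

theorem Surface.isPrimeDivisor_chartCurve (S : Surface) {σ : FunField k ≃ₐ[k] FunField k}
    (hσ : coordChart σ ∈ S.charts k) (p : MvPolynomial (Fin 2) k) (hp : Irreducible p) :
    S.IsPrimeDivisor (chartCurve σ p hp) := by
  refine ⟨_, hσ, centreIdeal _ _ (coordChart_le_chartCurve σ p hp), inferInstance, ?_⟩
  refine LocalSubring.toSubring_injective (le_antisymm ?_ (ofPrime_centreIdeal_le _ _ _).1)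
  intro z hz
  obtain ⟨a, b, hb, h⟩ : ∃ a b, ¬ p ∣ b ∧ σ.symm z = polyEmb k a / polyEmb k b := hz
  refine mem_ofPrime.2 ⟨⟨σ (polyEmb k a), mem_coordChart.2 ⟨a, rfl⟩⟩,
    ⟨σ (polyEmb k b), mem_coordChart.2 ⟨b, rfl⟩⟩, notMem_centreIdeal.2 ⟨?_, ?_⟩, ?_⟩
  · simpa using show b ≠ 0 by rintro rfl; exact hb (dvd_zero p)
  · change σ.symm (σ (polyEmb k b))⁻¹ ∈ (ofIrreducible p hp).ring
    rw [map_inv₀, AlgEquiv.symm_apply_apply]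
    exact ⟨1, b, hb, by simp⟩
  · rw [← map_div₀, ← h, AlgEquiv.apply_symm_apply]

/-- The prime divisors of a surface that meet a chart are the curves of the chart. -/
theorem Surface.IsPrimeDivisor.exists_eq_chartCurve {S : Surface} {E : DivisorialValuation k}
    (hE : S.IsPrimeDivisor E) {σ : FunField k ≃ₐ[k] FunField k} (hσ : coordChart σ ∈ S.charts k)
    (hle : (coordChart σ).toSubring ≤ E.ring.toSubring) :
    ∃ p hp, E = chartCurve σ p hp := by
  replace hle : (coordChart σ).toSubring ≤ E.ring.toLocalSubring.toSubring := hle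
  have hR : E.ring.toLocalSubring =
      LocalSubring.ofPrime (coordChart σ).toSubring (centreIdeal _ E.ring.toLocalSubring hle) :=
    S.point_unique hE ⟨_, hσ, _, inferInstance, rfl⟩ le_rfl (ofPrime_centreIdeal_le _ _ _)
  -- By uniqueness of centres the ring of `E` is itself a localization of this chart, so its
  -- elements are fractions whose denominators have order zero along `E`.
  have hmem : ∀ z, z ∈ E.ring → ∃ a b : MvPolynomial (Fin 2) k, b ≠ 0 ∧
      E.ord (σ (polyEmb k b)) = 0 ∧ z = σ (polyEmb k a / polyEmb k b) := by
    intro z hz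
    have hz' : z ∈ E.ring.toLocalSubring.toSubring := hz
    rw [hR] at hz'
    obtain ⟨⟨a, ha⟩, ⟨b, hb⟩, hbP, rfl⟩ := mem_ofPrime.1 hz'
    obtain ⟨a, rfl⟩ := mem_coordChart.1 ha
    obtain ⟨b, rfl⟩ := mem_coordChart.1 hb
    obtain ⟨h0, hinv⟩ := notMem_centreIdeal.1 hbP
    have h1 := E.ord_nonneg (hle hb)
    have h2 := E.ord_nonneg hinv
    rw [DivisorialValuation.ord_inv] at h2
    refine ⟨a, b, by rintro rfl; simp at h0, le_antisymm ?_ h1, by simp⟩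
    simpa using h2
  have hnn : ∀ q, 0 ≤ E.ord (σ (polyEmb k q)) := fun q =>
    E.ord_nonneg (hle (mem_coordChart.2 ⟨q, rfl⟩))
  -- some irreducible polynomial vanishes along `E`
  obtain ⟨p, hp, hpos⟩ : ∃ p, Irreducible p ∧ 0 < E.ord (σ (polyEmb k p)) := by
    by_contra! hc
    -- Otherwise multiplicativity gives every nonzero polynomial, and then every nonzero function,
    -- order zero, which leaves no uniformizer.
    have hzero : ∀ q : MvPolynomial (Fin 2) k, q ≠ 0 → E.ord (σ (polyEmb k q)) = 0 := by
      intro q hq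
      induction q using UniqueFactorizationMonoid.induction_on_prime with
      | h₁ => exact absurd rfl hq
      | h₂ u hu =>
        obtain ⟨v, hv⟩ := hu.exists_right_inv
        have hv0 : v ≠ 0 := right_ne_zero_of_mul_eq_one hv
        have h := E.ord_one
        rw [← map_one σ, ← map_one (polyEmb k), ← hv, map_mul, map_mul, E.ord_mul
          (by simpa using hq) (by simpa using hv0)] at h
        have := hnn u
        have := hnn v
        lia
      | h₃ q p hq0 hp ih =>
        rw [map_mul, map_mul, E.ord_mul (by simpa using hp.ne_zero) (by simpa using hq0), ih hq0]
        have := hnn p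
        have := hc p hp.irreducible
        lia
    obtain ⟨t, ht0, ht⟩ := E.exists_ord_eq_one
    obtain ⟨a, b, -, h, hab⟩ := exists_reduced (σ.symm t)
    have ha : a ≠ 0 := by
      rintro rfl
      exact ht0 (by simpa using hab)
    have : t = σ (polyEmb k a) / σ (polyEmb k b) := by
      rw [← map_div₀, ← hab, AlgEquiv.apply_symm_apply]
    rw [this, E.ord_div (by simpa using ha) (by simpa using h), hzero a ha, hzero b h] at ht
    lia
  -- For discrete valuation rings one inclusion is enough: a denominator of order zero along `E`
  -- cannot be divisible by `p`.
  refine ⟨p, hp, DivisorialValuation.eq_of_ring_le fun z hz => ?_⟩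
  obtain ⟨a, b, hb0, hb, rfl⟩ := hmem z hz
  change σ.symm _ ∈ (ofIrreducible p hp).ring
  rw [AlgEquiv.symm_apply_apply]
  refine ⟨a, b, ?_, rfl⟩
  rintro ⟨c, rfl⟩
  rw [map_mul, map_mul, E.ord_mul (by simpa using hp.ne_zero)
    (by simpa using right_ne_zero_of_mul hb0)] at hb
  have := hnn c
  lia

theorem Surface.IsPrimeDivisor.exists_chart {S : Surface} {E : DivisorialValuation k}
    (hE : S.IsPrimeDivisor E) : ∃ (σ : FunField k ≃ₐ[k] FunField k), coordChart σ ∈ S.charts k ∧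
      (coordChart σ).toSubring ≤ E.ring.toSubring ∧ ∃ p hp, E = chartCurve σ p hp := by
  obtain ⟨A, hA, hle⟩ := S.exists_chart_le E.ring E.algebraMap_mem
  obtain ⟨σ, rfl⟩ := S.exists_eq_coordChart hA
  exact ⟨σ, hA, hle, hE.exists_eq_chartCurve hA hle⟩

/-- The prime divisor on which a function of positive order on two curves of a chart agree. -/
theorem eq_chartCurve_of_pos {σ : FunField k ≃ₐ[k] FunField k} {p q : MvPolynomial (Fin 2) k}
    (hp : Irreducible p) (hq : Irreducible q)
    (h : 0 < (chartCurve σ p hp).ord (σ (polyEmb k q))) :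
    chartCurve σ p hp = chartCurve σ q hq := by
  rw [ord_chartCurve, ord_ofIrreducible_pos_iff hp hq.ne_zero] at h
  have hassoc : Associated p q := hp.associated_of_dvd hq h
  refine DivisorialValuation.eq_of_ring_le fun z hz => ?_
  obtain ⟨a, b, hb, hab⟩ : ∃ a b, ¬ p ∣ b ∧ σ.symm z = polyEmb k a / polyEmb k b := hz
  exact ⟨a, b, fun h' => hb (hassoc.dvd.trans h'), hab⟩

end PlanePairs

end

noncomputable section

namespace PlanePairs

open KaehlerDifferential

variable {k : Type*} [Field k]

/-! ### The Jacobian determinant -/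

theorem alternating_pair {R M N : Type*} [CommRing R] [AddCommGroup M] [AddCommGroup N]
    [Module R M] [Module R N] (f : M [⋀^Fin 2]→ₗ[R] N) (a b c d : R) (u v : M) :
    f ![a • u + b • v, c • u + d • v] = (a * d - b * c) • f ![u, v] := by
  have hl : ∀ (a b : R) (u v w : M), f ![a • u + b • v, w] = a • f ![u, w] + b • f ![v, w] := by
    intro a b u v w
    have h1 := f.toMultilinearMap.cons_add ![w] (a • u) (b • v)
    have h2 := f.toMultilinearMap.cons_smul ![w] a u
    have h3 := f.toMultilinearMap.cons_smul ![w] b v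
    calc f ![a • u + b • v, w] = f ![a • u, w] + f ![b • v, w] := h1
      _ = _ := by rw [show f ![a • u, w] = a • f ![u, w] from h2,
        show f ![b • v, w] = b • f ![v, w] from h3]
  have hswap : ∀ u v : M, f ![u, v] = - f ![v, u] := by
    intro u v
    have := f.map_swap ![v, u] (show (0 : Fin 2) ≠ 1 by simp)
    rw [← this]
    congr 1
    ext i; fin_cases i <;> simp
  have hself : ∀ u : M, f ![u, u] = 0 := fun u =>
    f.map_eq_zero_of_eq ![u, u] (i := 0) (j := 1) (by simp) (by simp)
  rw [hl, hswap u, hswap v, hl, hl, hself, hself, hswap v u]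
  module

/-- The differentials `dx`, `dy` form a basis of the differentials of the function field. -/
def differentialBasis (k : Type*) [Field k] :
    Module.Basis (Fin 2) (FunField k) (Ω[FunField k⁄k]) :=
  -- A localization is formally étale, so the differentials are the base change of the free module
  -- of differentials of the polynomial ring.
  haveI : Algebra.FormallyEtale (MvPolynomial (Fin 2) k) (FunField k) :=
    Algebra.FormallyEtale.of_isLocalization (nonZeroDivisors (MvPolynomial (Fin 2) k))
  ((mvPolynomialBasis k (Fin 2)).baseChange (FunField k)).map
    (tensorKaehlerEquivOfFormallyEtale k (MvPolynomial (Fin 2) k) (FunField k))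

theorem differentialBasis_apply (i : Fin 2) :
    differentialBasis k i = D k (FunField k) (polyEmb k (MvPolynomial.X i)) := by
  simp [differentialBasis]

/-- The partial derivatives of the function field. -/
def pd (i : Fin 2) : Derivation k (FunField k) (FunField k) :=
  ((differentialBasis k).coord i).compDer (D k (FunField k))

theorem pd_X (i j : Fin 2) :
    pd (k := k) i (polyEmb k (MvPolynomial.X j)) = if i = j then 1 else 0 := by
  change (differentialBasis k).coord i (D k (FunField k) (polyEmb k (MvPolynomial.X j))) = _
  rw [← differentialBasis_apply]
  simp [Finsupp.single_apply, eq_comm]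

theorem pd_x (i : Fin 2) : pd i (x k) = if i = 0 then 1 else 0 := pd_X i 0

theorem pd_y (i : Fin 2) : pd i (y k) = if i = 1 then 1 else 0 := pd_X i 1

theorem D_eq (p : FunField k) :
    D k (FunField k) p = pd 0 p • D k (FunField k) (x k) + pd 1 p • D k (FunField k) (y k) := by
  have := (differentialBasis k).sum_repr (D k (FunField k) p)
  rw [Fin.sum_univ_two, differentialBasis_apply, differentialBasis_apply] at this
  exact this.symm

/-- The Jacobian determinant of two functions with respect to `x` and `y`. -/
def jac (p q : FunField k) : FunField k := pd 0 p * pd 1 q - pd 1 p * pd 0 q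

theorem wedge_eq (p q : FunField k) : wedge p q = jac p q • wedge (x k) (y k) := by
  unfold wedge
  rw [D_eq p, D_eq q, alternating_pair]
  rfl

/-- The determinant with respect to the basis `dx`, `dy` takes the value `1` on this form.
Consequently two-forms may be replaced by their coefficients, which are Jacobians. -/
theorem wedge_x_y_ne_zero : wedge (x k) (y k) ≠ 0 := by
  intro h
  have h1 := exteriorPower.alternatingMapLinearEquiv_apply_ιMulti
    (differentialBasis k).det ![D k (FunField k) (x k), D k (FunField k) (y k)]
  rw [show exteriorPower.ιMulti (FunField k) 2
    ![D k (FunField k) (x k), D k (FunField k) (y k)] = 0 from h, map_zero] at h1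
  have h2 : ![D k (FunField k) (x k), D k (FunField k) (y k)] = differentialBasis k := by
    ext i; fin_cases i
    · exact (differentialBasis_apply 0).symm
    · exact (differentialBasis_apply 1).symm
  rw [h2, Module.Basis.det_self] at h1
  exact one_ne_zero h1.symm

theorem wedge_eq_iff {p q J : FunField k} : wedge p q = J • wedge (x k) (y k) ↔ J = jac p q := by
  rw [wedge_eq]
  constructor
  · intro h
    exact (smul_left_injective _ wedge_x_y_ne_zero h).symm
  · rintro rfl; rfl

theorem derivation_eq (δ : Derivation k (FunField k) (FunField k)) (p : FunField k) :
    δ p = pd 0 p * δ (x k) + pd 1 p * δ (y k) := by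
  have h := congrArg δ.liftKaehlerDifferential (D_eq p)
  simpa using h

/-- Conjugation of a derivation by an automorphism. -/
def conjDerivation (φ : FunField k ≃ₐ[k] FunField k) (δ : Derivation k (FunField k) (FunField k)) :
    Derivation k (FunField k) (FunField k) :=
  Derivation.mk' ((φ.symm : FunField k →ₐ[k] FunField k).toLinearMap ∘ₗ
    (δ : FunField k →ₗ[k] FunField k) ∘ₗ (φ : FunField k →ₐ[k] FunField k).toLinearMap) (by
      intro a b
      simp)

theorem conjDerivation_apply (φ : FunField k ≃ₐ[k] FunField k)
    (δ : Derivation k (FunField k) (FunField k)) (p : FunField k) :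
    conjDerivation φ δ p = φ.symm (δ (φ p)) := rfl

/-- This is the chain rule. The composite of `δ` with `φ` is not a derivation for the usual module
structure, but its conjugate is, and `derivation_eq` applies to the latter. -/
theorem derivation_aut (φ : FunField k ≃ₐ[k] FunField k)
    (δ : Derivation k (FunField k) (FunField k)) (p : FunField k) :
    δ (φ p) = φ (pd 0 p) * δ (φ (x k)) + φ (pd 1 p) * δ (φ (y k)) := by
  have h := derivation_eq (conjDerivation φ δ) p
  simp only [conjDerivation_apply] at h
  simpa using congrArg φ h

/-- The Jacobian determinant of an automorphism. -/
def autJac (φ : FunField k ≃ₐ[k] FunField k) : FunField k := jac (φ (x k)) (φ (y k))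

/-- The pull-back of `dx ∧ dy` is `autJac φ • dx ∧ dy`; this factor governs how canonical divisors
and sections transform. -/
theorem jac_aut (φ : FunField k ≃ₐ[k] FunField k) (p q : FunField k) :
    jac (φ p) (φ q) = φ (jac p q) * autJac φ := by
  simp only [jac, autJac, derivation_aut φ _ p, derivation_aut φ _ q, map_sub, map_mul]
  ring

theorem jac_x_y : jac (x k) (y k) = 1 := by simp [jac, pd_x, pd_y]

theorem autJac_ne_zero (φ : FunField k ≃ₐ[k] FunField k) : autJac φ ≠ 0 := by
  intro h
  have := jac_aut φ (φ.symm (x k)) (φ.symm (y k))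
  rw [h, mul_zero, AlgEquiv.apply_symm_apply, AlgEquiv.apply_symm_apply, jac_x_y] at this
  exact one_ne_zero this

/-! ### The order of a two-form -/

/-- The orders of the two-forms regular along `E`, relative to `dx ∧ dy`. -/
def jacOrders (E : DivisorialValuation k) : Set ℤ :=
  {n | ∃ p ∈ E.ring, ∃ q ∈ E.ring, jac p q ≠ 0 ∧ n = E.ord (jac p q)}

theorem canonicalDivisor_eq (E : DivisorialValuation k) :
    canonicalDivisor E = -sInf (jacOrders E) := by
  unfold canonicalDivisor jacOrders
  congr 2
  ext n
  simp only [Set.mem_ofPred_eq, wedge_eq_iff]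
  constructor
  · rintro ⟨p, hp, q, hq, J, hJ, rfl, h⟩
    exact ⟨p, hp, q, hq, hJ, h⟩
  · rintro ⟨p, hp, q, hq, hJ, h⟩
    exact ⟨p, hp, q, hq, _, hJ, rfl, h⟩

/-- One of `x`, `1 / x` and one of `y`, `1 / y` is regular along `E`, and the differential of an
inverse is a nonzero multiple of the original differential. -/
theorem jacOrders_nonempty (E : DivisorialValuation k) : (jacOrders E).Nonempty := by
  obtain ⟨t, ht0, ht⟩ := E.exists_ord_eq_one
  have key : ∀ z : FunField k, z ≠ 0 → ∃ n : ℕ, z * t ^ n ∈ E.ring := by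
    intro z hz
    refine ⟨(-E.ord z).toNat, ?_⟩
    rw [E.mem_ring_iff (mul_ne_zero hz (pow_ne_zero _ ht0)), E.ord_mul hz (pow_ne_zero _ ht0),
      DivisorialValuation.ord_pow, ht]
    lia
  have hinv : ∀ z : FunField k, z ∈ E.ring ∨ z⁻¹ ∈ E.ring := E.ring.mem_or_inv_mem
  have hx : ∃ p ∈ E.ring, ∃ c : FunField k, c ≠ 0 ∧ ∀ δ : Derivation k (FunField k) (FunField k),
      δ p = c * δ (x k) := by
    rcases hinv (x k) with h | h
    · exact ⟨_, h, 1, one_ne_zero, by simp⟩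
    · refine ⟨_, h, -((x k)⁻¹ ^ 2), neg_ne_zero.2 (pow_ne_zero _ (inv_ne_zero x_ne_zero)), ?_⟩
      intro δ
      rw [Derivation.leibniz_inv, smul_eq_mul]
  have hy : ∃ p ∈ E.ring, ∃ c : FunField k, c ≠ 0 ∧ ∀ δ : Derivation k (FunField k) (FunField k),
      δ p = c * δ (y k) := by
    rcases hinv (y k) with h | h
    · exact ⟨_, h, 1, one_ne_zero, by simp⟩
    · refine ⟨_, h, -((y k)⁻¹ ^ 2), neg_ne_zero.2 (pow_ne_zero _ (inv_ne_zero y_ne_zero)), ?_⟩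
      intro δ
      rw [Derivation.leibniz_inv, smul_eq_mul]
  obtain ⟨p, hp, c, hc, hpc⟩ := hx
  obtain ⟨q, hq, d, hd, hqd⟩ := hy
  refine ⟨_, p, hp, q, hq, ?_, rfl⟩
  simp [jac, hpc, hqd, pd_x, pd_y, hc, hd]

theorem jacOrders_comap (E : DivisorialValuation k) (φ : FunField k ≃ₐ[k] FunField k) (n : ℤ) :
    n ∈ jacOrders (E.comap φ) ↔ n + E.ord (autJac φ) ∈ jacOrders E := by
  constructor
  · rintro ⟨p, hp, q, hq, hJ, rfl⟩
    refine ⟨φ p, hp, φ q, hq, ?_, ?_⟩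
    · rw [jac_aut]
      exact mul_ne_zero (by simpa using hJ) (autJac_ne_zero φ)
    · rw [jac_aut, E.ord_mul (by simpa using hJ) (autJac_ne_zero φ),
        DivisorialValuation.ord_comap]
  · rintro ⟨p, hp, q, hq, hJ, h⟩
    have hpq := jac_aut φ (φ.symm p) (φ.symm q)
    rw [AlgEquiv.apply_symm_apply, AlgEquiv.apply_symm_apply] at hpq
    have hJ' : jac (φ.symm p) (φ.symm q) ≠ 0 := by
      intro h0
      rw [h0] at hpq; simp [hpq] at hJ
    refine ⟨φ.symm p, ?_, φ.symm q, ?_, hJ', ?_⟩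
    · rw [DivisorialValuation.mem_comap_ring]; simpa using hp
    · rw [DivisorialValuation.mem_comap_ring]; simpa using hq
    · rw [hpq, E.ord_mul (by simpa using hJ') (autJac_ne_zero φ)] at h
      rw [DivisorialValuation.ord_comap]
      lia

theorem bddBelow_jacOrders_comap {E : DivisorialValuation k} (φ : FunField k ≃ₐ[k] FunField k)
    (h : BddBelow (jacOrders E)) : BddBelow (jacOrders (E.comap φ)) := by
  obtain ⟨b, hb⟩ := h
  refine ⟨b - E.ord (autJac φ), fun n hn => ?_⟩
  have := hb ((jacOrders_comap E φ n).1 hn)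
  lia

/-- The whole set of orders is shifted by the order of the Jacobian. The lower bound is essential,
because `sInf` of an unbounded set of integers is a meaningless default value. -/
theorem canonicalDivisor_comap {E : DivisorialValuation k} (φ : FunField k ≃ₐ[k] FunField k)
    (h : BddBelow (jacOrders E)) :
    canonicalDivisor (E.comap φ) = canonicalDivisor E + E.ord (autJac φ) := by
  rw [canonicalDivisor_eq, canonicalDivisor_eq]
  have h1 : IsLeast (jacOrders E) (sInf (jacOrders E)) :=
    ⟨Int.csInf_mem (jacOrders_nonempty E) h, fun n hn => csInf_le h hn⟩
  have h2 : IsLeast (jacOrders (E.comap φ)) (sInf (jacOrders E) - E.ord (autJac φ)) := by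
    refine ⟨?_, fun n hn => ?_⟩
    · rw [jacOrders_comap, sub_add_cancel]; exact h1.1
    · have := h1.2 ((jacOrders_comap E φ n).1 hn)
      lia
  rw [h2.csInf_eq]
  ring

/-- Partial derivatives of polynomials are polynomials, and the quotient rule only introduces
denominators that are already invertible. Hence all Jacobians of regular functions are regular, and
`dx ∧ dy` generates the two-forms along a curve of the standard chart. -/
theorem pd_mem_ofIrreducible (p : MvPolynomial (Fin 2) k) (hp : Irreducible p) (i : Fin 2)
    {z : FunField k} (hz : z ∈ (ofIrreducible p hp).ring) :
    pd i z ∈ (ofIrreducible p hp).ring := by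
  have hpoly : ∀ q : MvPolynomial (Fin 2) k, pd i (polyEmb k q) ∈ (ofIrreducible p hp).ring := by
    intro q
    induction q using MvPolynomial.induction_on with
    | C c =>
      have : polyEmb k (MvPolynomial.C c) = algebraMap k (FunField k) c :=
        (IsScalarTower.algebraMap_apply k (MvPolynomial (Fin 2) k) (FunField k) c).symm
      rw [this, Derivation.map_algebraMap]
      exact zero_mem _
    | add f g hf hg => rw [map_add, map_add]; exact add_mem hf hg
    | mul_X f j hf =>
      rw [map_mul, Derivation.leibniz, pd_X, smul_eq_mul, smul_eq_mul]
      refine add_mem (mul_mem (polyEmb_mem_ofIrreducible p hp f) ?_)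
        (mul_mem (polyEmb_mem_ofIrreducible p hp _) hf)
      split_ifs
      · exact one_mem _
      · exact zero_mem _
  obtain ⟨a, b, hb, rfl⟩ := hz
  have hbi : (polyEmb k b)⁻¹ ∈ (ofIrreducible p hp).ring := ⟨1, b, hb, by simp⟩
  rw [Derivation.leibniz_div, smul_eq_mul, smul_eq_mul, smul_eq_mul]
  exact mul_mem (pow_mem hbi 2) (sub_mem (mul_mem (polyEmb_mem_ofIrreducible p hp _) (hpoly a))
    (mul_mem (polyEmb_mem_ofIrreducible p hp _) (hpoly b)))

theorem isLeast_jacOrders_ofIrreducible (p : MvPolynomial (Fin 2) k) (hp : Irreducible p) :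
    IsLeast (jacOrders (ofIrreducible p hp)) 0 := by
  constructor
  · refine ⟨x k, polyEmb_mem_ofIrreducible p hp _, y k, polyEmb_mem_ofIrreducible p hp _, ?_⟩
    simp [jac_x_y]
  · rintro n ⟨f, hf, g, hg, -, rfl⟩
    exact DivisorialValuation.ord_nonneg _ (sub_mem
      (mul_mem (pd_mem_ofIrreducible p hp 0 hf) (pd_mem_ofIrreducible p hp 1 hg))
      (mul_mem (pd_mem_ofIrreducible p hp 1 hf) (pd_mem_ofIrreducible p hp 0 hg)))

theorem bddBelow_jacOrders_chartCurve (σ : FunField k ≃ₐ[k] FunField k)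
    (p : MvPolynomial (Fin 2) k) (hp : Irreducible p) :
    BddBelow (jacOrders (chartCurve σ p hp)) :=
  bddBelow_jacOrders_comap _ (isLeast_jacOrders_ofIrreducible p hp).bddBelow

/-- In the coordinates `σ x`, `σ y` the generating form is `autJac σ • dx ∧ dy`, which has order
zero along the curve. -/
theorem canonicalDivisor_chartCurve (σ : FunField k ≃ₐ[k] FunField k)
    (p : MvPolynomial (Fin 2) k) (hp : Irreducible p) :
    canonicalDivisor (chartCurve σ p hp) = -(chartCurve σ p hp).ord (autJac σ) := by
  have h := canonicalDivisor_comap σ (bddBelow_jacOrders_chartCurve σ p hp)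
  rw [chartCurve, DivisorialValuation.comap_symm_comap, ← chartCurve, canonicalDivisor_eq,
    (isLeast_jacOrders_ofIrreducible p hp).csInf_eq] at h
  lia

theorem Surface.IsPrimeDivisor.bddBelow_jacOrders {S : Surface} {E : DivisorialValuation k}
    (hE : S.IsPrimeDivisor E) : BddBelow (jacOrders E) := by
  obtain ⟨σ, -, -, p, hp, rfl⟩ := hE.exists_chart
  exact bddBelow_jacOrders_chartCurve σ p hp

/-! ### Sections of log canonical divisors and birational maps -/

theorem curveDivisor_self (C : DivisorialValuation k) : curveDivisor C C = 1 := by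
  simp [curveDivisor]

theorem curveDivisor_of_ne {C E : DivisorialValuation k} (h : E ≠ C) : curveDivisor C E = 0 := by
  simp [curveDivisor, h]

theorem curveDivisor_comap (C E : DivisorialValuation k) (φ : FunField k ≃ₐ[k] FunField k) :
    curveDivisor (C.comap φ) (E.comap φ) = curveDivisor C E := by
  by_cases h : E = C
  · subst h; rw [curveDivisor_self, curveDivisor_self]
  · rw [curveDivisor_of_ne h, curveDivisor_of_ne fun h' =>
      h (DivisorialValuation.comap_injective φ h')]

/-- In a chart of the surface, every curve has an equation. -/
theorem Surface.exists_chart_equation (S : Surface) {C : DivisorialValuation k}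
    (hC : S.IsPrimeDivisor C) {σ : FunField k ≃ₐ[k] FunField k} (hσ : coordChart σ ∈ S.charts k) :
    ∃ h : FunField k, h ≠ 0 ∧ ∀ E, S.IsPrimeDivisor E →
      (coordChart σ).toSubring ≤ E.ring.toSubring → E.ord h = curveDivisor C E := by
  by_cases hle : (coordChart σ).toSubring ≤ C.ring.toSubring
  · obtain ⟨p, hp, rfl⟩ := hC.exists_eq_chartCurve hσ hle
    refine ⟨σ (polyEmb k p), by simpa using hp.ne_zero, fun E hE hEle => ?_⟩
    obtain ⟨q, hq, rfl⟩ := hE.exists_eq_chartCurve hσ hEle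
    by_cases h : chartCurve σ q hq = chartCurve σ p hp
    · rw [h, curveDivisor_self, ord_chartCurve, ord_ofIrreducible_self]
    · rw [curveDivisor_of_ne h]
      refine le_antisymm (not_lt.1 fun hpos => h (eq_chartCurve_of_pos hq hp hpos)) ?_
      rw [ord_chartCurve]
      exact DivisorialValuation.ord_nonneg _ (polyEmb_mem_ofIrreducible q hq p)
  · refine ⟨1, one_ne_zero, fun E _ hEle => ?_⟩
    rw [DivisorialValuation.ord_one, curveDivisor_of_ne]
    rintro rfl
    exact hle hEle

/-- A rational function without poles on the curves of a chart has no poles along any divisor with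
centre on the chart. -/
theorem ord_nonneg_of_chart {σ : FunField k ≃ₐ[k] FunField k} {E : DivisorialValuation k}
    (hle : (coordChart σ).toSubring ≤ E.ring.toSubring) {H : FunField k}
    (h : ∀ p hp, 0 ≤ (chartCurve σ p hp).ord H) : 0 ≤ E.ord H := by
  let f : MvPolynomial (Fin 2) k →+* E.ring :=
    ((σ : FunField k →+* FunField k).comp (polyEmb k)).codRestrict E.ring.toSubring
      fun q => hle (mem_coordChart.2 ⟨q, rfl⟩)
  have hf : ∀ q, ((f q : E.ring) : FunField k) = σ (polyEmb k q) := fun q => rfl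
  -- The prime here is the centre of `E` on the chart, a curve or a smaller point. In a factorial
  -- ring, absence of poles along curves implies regularity at every point.
  obtain ⟨a, b, hb, hab⟩ := exists_div_of_ord_nonneg
    ((IsLocalRing.maximalIdeal E.ring).comap f) (z := σ.symm H) (fun p hp _ => by
      have := h p hp
      rwa [← σ.apply_symm_apply H, ord_chartCurve] at this)
  rw [Ideal.mem_comap, IsLocalRing.mem_maximalIdeal, mem_nonunits_iff, not_not] at hb
  have hb' := (isUnit_subring_iff (R := E.ring.toSubring) (f b)).1 hb
  have hH : H = (f a : FunField k) * (f b : FunField k)⁻¹ := by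
    rw [hf, hf, ← div_eq_mul_inv, ← map_div₀, ← hab, AlgEquiv.apply_symm_apply]
  rw [hH]
  exact E.ord_nonneg (mul_mem (f a).2 hb'.2)

/-- `G` is a nonzero section of `n K + r C` on `S`. -/
def Surface.IsLogSection (S : Surface) (C : DivisorialValuation k) (n r : ℕ) (G : FunField k) :
    Prop :=
  G ≠ 0 ∧ ∀ E, S.IsPrimeDivisor E →
    0 ≤ E.ord G + n * canonicalDivisor E + r * curveDivisor C E

theorem Surface.canonicalDivisor_eq_of_chart (S : Surface) {E : DivisorialValuation k}
    (hE : S.IsPrimeDivisor E) {σ : FunField k ≃ₐ[k] FunField k} (hσ : coordChart σ ∈ S.charts k)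
    (hle : (coordChart σ).toSubring ≤ E.ring.toSubring) :
    canonicalDivisor E = -E.ord (autJac σ) := by
  obtain ⟨p, hp, rfl⟩ := hE.exists_eq_chartCurve hσ hle
  exact canonicalDivisor_chartCurve σ p hp

/-- The order of a section of `n K + r C` along an exceptional divisor is bounded below by the
discrepancy. -/
theorem Surface.IsLogSection.exists_discrepancy {S : Surface} {C : DivisorialValuation k}
    (hC : S.IsPrimeDivisor C) {c : ℚ} {n r : ℕ} (hc : c * n = r) {G : FunField k}
    (hG : S.IsLogSection C n r G) (E : DivisorialValuation k) :
    ∃ R a, S.IsDiscrepancy C c E R a ∧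
      n * a ≤ (E.ord G : ℚ) + n * (canonicalDivisor E : ℚ) := by
  obtain ⟨A, hA, hle⟩ := S.exists_chart_le E.ring E.algebraMap_mem
  obtain ⟨σ, rfl⟩ := S.exists_eq_coordChart hA
  replace hle : (coordChart σ).toSubring ≤ E.ring.toLocalSubring.toSubring := hle
  obtain ⟨h, h0, hh⟩ := S.exists_chart_equation hC hA
  have hj := inv_ne_zero (autJac_ne_zero σ)
  set R := LocalSubring.ofPrime (coordChart σ).toSubring
    (centreIdeal _ E.ring.toLocalSubring hle) with hR
  have hpass : ∀ F : DivisorialValuation k, Passes F R →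
      (coordChart σ).toSubring ≤ F.ring.toSubring := fun F hF =>
    (LocalSubring.le_ofPrime _ _).trans hF
  refine ⟨R, _, ⟨⟨⟨_, hA, _, inferInstance, rfl⟩, ofPrime_centreIdeal_le _ _ _⟩,
    (autJac σ)⁻¹, h, ⟨hj, fun F hF hFR => ?_⟩, ⟨h0, fun F hF hFR => hh F hF (hpass F hFR)⟩,
    rfl⟩, ?_⟩
  · rw [DivisorialValuation.ord_inv, S.canonicalDivisor_eq_of_chart hF hA (hpass F hFR)]
  have hord : ∀ F : DivisorialValuation k, F.ord (G * (autJac σ)⁻¹ ^ n * h ^ r) =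
      F.ord G + n * F.ord (autJac σ)⁻¹ + r * F.ord h := by
    intro F
    rw [F.ord_mul (mul_ne_zero hG.1 (pow_ne_zero _ hj)) (pow_ne_zero _ h0),
      F.ord_mul hG.1 (pow_ne_zero _ hj), F.ord_pow, F.ord_pow]
  -- Multiplying `G` by local equations of `nK` and `rC` gives a function without poles on the
  -- chart, hence regular at the centre of `E`. Its order along `E` is `ord G + nK` at `E`, minus
  -- `n` times the discrepancy.
  have key : 0 ≤ E.ord (G * (autJac σ)⁻¹ ^ n * h ^ r) := by
    refine ord_nonneg_of_chart hle fun p hp => ?_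
    have hF := S.isPrimeDivisor_chartCurve hA p hp
    have hFle := coordChart_le_chartCurve σ p hp
    rw [hord, hh _ hF hFle, DivisorialValuation.ord_inv, ← S.canonicalDivisor_eq_of_chart hF hA hFle]
    exact hG.2 _ hF
  rw [hord] at key
  have key' : (0 : ℚ) ≤ E.ord G + n * E.ord (autJac σ)⁻¹ + r * E.ord h := by exact_mod_cast key
  rw [← hc] at key'
  linarith

/-- For divisors on `S` this is the definition of a section, and for exceptional ones the
discrepancy bounds the order. Since `E` is arbitrary, the bound no longer depends on the chosen
birational model. -/
theorem Surface.IsLogSection.le_ord {S : Surface} {C : DivisorialValuation k}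
    (hC : S.IsPrimeDivisor C) {c : ℚ} {n r : ℕ} (hc : c * n = r)
    (hcan : S.IsCanonicalPair C c) {G : FunField k}
    (hG : S.IsLogSection C n r G) (E : DivisorialValuation k) :
    0 ≤ E.ord G + n * canonicalDivisor E + r * curveDivisor C E := by
  by_cases hE : S.IsPrimeDivisor E
  · exact hG.2 E hE
  obtain ⟨R, a, ha, hle⟩ := hG.exists_discrepancy hC hc E
  have h0 := hcan.2 E hE R a ha
  have hEC : E ≠ C := by rintro rfl; exact hE hC
  rw [curveDivisor_of_ne hEC, mul_zero, add_zero]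
  have : (0 : ℚ) ≤ E.ord G + n * canonicalDivisor E := (by positivity : (0 : ℚ) ≤ n * a).trans hle
  exact_mod_cast this

/-- The strict version detects contracted curves: under terminality a section must vanish along
every exceptional divisor. -/
theorem Surface.IsLogSection.lt_ord {S : Surface} {C : DivisorialValuation k}
    (hC : S.IsPrimeDivisor C) {c : ℚ} {n r : ℕ} (hn : 0 < n) (hc : c * n = r)
    (hter : S.IsTerminalPair C c) {G : FunField k}
    (hG : S.IsLogSection C n r G) {E : DivisorialValuation k} (hE : ¬ S.IsPrimeDivisor E) :
    0 < E.ord G + n * canonicalDivisor E + r * curveDivisor C E := by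
  obtain ⟨R, a, ha, hle⟩ := hG.exists_discrepancy hC hc E
  have h0 := hter.2 E hE R a ha
  have hEC : E ≠ C := by rintro rfl; exact hE hC
  rw [curveDivisor_of_ne hEC, mul_zero, add_zero]
  have hn' : (0 : ℚ) < n := by exact_mod_cast hn
  have : (0 : ℚ) < E.ord G + n * canonicalDivisor E := (by positivity : (0 : ℚ) < n * a).trans_le hle
  exact_mod_cast this

theorem Surface.IsTerminalPair.isCanonicalPair {S : Surface} {C : DivisorialValuation k} {c : ℚ}
    (h : S.IsTerminalPair C c) : S.IsCanonicalPair C c :=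
  ⟨h.1, fun E hE R a ha => (h.2 E hE R a ha).le⟩

/-! ### Pull-back of sections along birational maps of pairs. -/

/-- The pull-back of an `n`-fold two-form. -/
def pullForm (φ : FunField k ≃ₐ[k] FunField k) (n : ℕ) (G : FunField k) : FunField k :=
  φ G * autJac φ ^ n

theorem pullForm_ne_zero {φ : FunField k ≃ₐ[k] FunField k} {n : ℕ} {G : FunField k}
    (hG : G ≠ 0) : pullForm φ n G ≠ 0 :=
  mul_ne_zero (by simpa using hG) (pow_ne_zero _ (autJac_ne_zero φ))

/-- The factor `autJac φ ^ n` compensates for the change of the canonical divisor, so the order of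
the log form along `E` equals its order along the image of `E`. -/
theorem ord_pullForm {S : Surface} {C C' E : DivisorialValuation k}
    {φ : FunField k ≃ₐ[k] FunField k} (hφ : IsPairMap C C' φ) (hE : S.IsPrimeDivisor E)
    {n r : ℕ} {G : FunField k} (hG : G ≠ 0) :
    E.ord (pullForm φ n G) + n * canonicalDivisor E + r * curveDivisor C E =
      (E.comap φ).ord G + n * canonicalDivisor (E.comap φ) + r * curveDivisor C' (E.comap φ) := by
  rw [isPairMap_iff] at hφ
  subst hφ
  rw [curveDivisor_comap, canonicalDivisor_comap φ hE.bddBelow_jacOrders, pullForm,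
    E.ord_mul (by simpa using hG) (pow_ne_zero _ (autJac_ne_zero φ)), E.ord_pow,
    DivisorialValuation.ord_comap]
  ring

/-- Sections of `n K + r C'` on a canonical pair pull back to sections of `n K + r C`. -/
theorem Surface.IsLogSection.pull {S S' : Surface} {C C' : DivisorialValuation k}
    {φ : FunField k ≃ₐ[k] FunField k} (hφ : IsPairMap C C' φ) (hC' : S'.IsPrimeDivisor C')
    {c : ℚ} {n r : ℕ} (hc : c * n = r) (hcan : S'.IsCanonicalPair C' c) {G : FunField k}
    (hG : S'.IsLogSection C' n r G) : S.IsLogSection C n r (pullForm φ n G) := by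
  refine ⟨pullForm_ne_zero hG.1, fun E hE => ?_⟩
  rw [ord_pullForm hφ hE hG.1]
  exact hG.le_ord hC' hc hcan _

theorem IsPairMap.symm {C C' : DivisorialValuation k} {φ : FunField k ≃ₐ[k] FunField k}
    (h : IsPairMap C C' φ) : IsPairMap C' C φ.symm := by
  rw [isPairMap_iff] at *
  rw [← h, DivisorialValuation.comap_comap_symm]

theorem IsPairMap.trans {C C' C'' : DivisorialValuation k} {φ ψ : FunField k ≃ₐ[k] FunField k}
    (h : IsPairMap C C' φ) (h' : IsPairMap C' C'' ψ) : IsPairMap C C'' (ψ.trans φ) := by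
  rw [isPairMap_iff] at *
  rw [← h', ← h, DivisorialValuation.comap_comap]

/-! ### Curves of the standard chart -/

theorem irreducible_X (i : Fin 2) : Irreducible (MvPolynomial.X i : MvPolynomial (Fin 2) k) :=
  MvPolynomial.X_prime.irreducible

theorem Surface.standard_mem_charts (S : Surface) :
    coordChart (AlgEquiv.refl : FunField k ≃ₐ[k] FunField k) ∈ S.charts k := by
  rw [coordChart_refl]
  cases S <;> exact Or.inl rfl

theorem ord_chartCurve_refl (p : MvPolynomial (Fin 2) k) (hp : Irreducible p) (z : FunField k) :
    (chartCurve AlgEquiv.refl p hp).ord z = (ofIrreducible p hp).ord z :=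
  ord_chartCurve AlgEquiv.refl p hp z

/-- The divisor has a centre on the standard chart. -/
def MeetsStandard (E : DivisorialValuation k) : Prop :=
  (Algebra.adjoin k {x k, y k}).toSubring ≤ E.ring.toSubring

theorem meetsStandard_iff {E : DivisorialValuation k} :
    MeetsStandard E ↔ 0 ≤ E.ord (x k) ∧ 0 ≤ E.ord (y k) := by
  rw [← E.mem_ring_iff x_ne_zero, ← E.mem_ring_iff y_ne_zero]
  exact ⟨fun h => ⟨h (fst_mem_algebra _ _), h (snd_mem_algebra _ _)⟩,
    fun h => adjoin_toSubring_le E.algebraMap_mem h.1 h.2⟩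

theorem MeetsStandard.ord_polyEmb {E : DivisorialValuation k} (h : MeetsStandard E)
    (q : MvPolynomial (Fin 2) k) : 0 ≤ E.ord (polyEmb k q) :=
  E.ord_nonneg (h (mem_standardChart.2 ⟨q, rfl⟩))

theorem meetsStandard_chartCurve (p : MvPolynomial (Fin 2) k) (hp : Irreducible p) :
    MeetsStandard (chartCurve AlgEquiv.refl p hp) := by
  have := coordChart_le_chartCurve AlgEquiv.refl p hp
  rwa [coordChart_refl] at this

theorem Surface.isPrimeDivisor_standard (S : Surface) (p : MvPolynomial (Fin 2) k)
    (hp : Irreducible p) : S.IsPrimeDivisor (chartCurve AlgEquiv.refl p hp) :=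
  S.isPrimeDivisor_chartCurve S.standard_mem_charts p hp

theorem Surface.IsPrimeDivisor.exists_eq_standard {S : Surface} {E : DivisorialValuation k}
    (hE : S.IsPrimeDivisor E) (h : MeetsStandard E) :
    ∃ p hp, E = chartCurve AlgEquiv.refl p hp :=
  hE.exists_eq_chartCurve S.standard_mem_charts (by rw [coordChart_refl]; exact h)

theorem Surface.IsPrimeDivisor.canonicalDivisor_eq_zero {S : Surface} {E : DivisorialValuation k}
    (hE : S.IsPrimeDivisor E) (h : MeetsStandard E) : canonicalDivisor E = 0 := by
  rw [S.canonicalDivisor_eq_of_chart hE S.standard_mem_charts (by rw [coordChart_refl]; exact h)]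
  simp [autJac, jac_x_y]

/-- A coordinate vanishes to order exactly one along its axis and nowhere else on the chart, so the
zero-or-one divisor is the true divisor of the coordinate there. -/
theorem Surface.IsPrimeDivisor.chartDivisor_eq {S : Surface} {E : DivisorialValuation k}
    (hE : S.IsPrimeDivisor E) (h : MeetsStandard E) (i : Fin 2) :
    chartDivisor (Algebra.adjoin k {x k, y k}) (polyEmb k (MvPolynomial.X i)) E =
      E.ord (polyEmb k (MvPolynomial.X i)) := by
  obtain ⟨p, hp, rfl⟩ := hE.exists_eq_standard h
  have h0 := h.ord_polyEmb (MvPolynomial.X i)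
  by_cases hpos : 0 < (chartCurve AlgEquiv.refl p hp).ord (polyEmb k (MvPolynomial.X i))
  · have := eq_chartCurve_of_pos (σ := AlgEquiv.refl) hp (irreducible_X i) hpos
    rw [this, ord_chartCurve_refl, ord_ofIrreducible_self, chartDivisor, if_pos]
    refine ⟨this ▸ h, ?_⟩
    rw [ord_chartCurve_refl, ord_ofIrreducible_self]
    exact one_pos
  · rw [chartDivisor, if_neg fun h' => hpos h'.2]
    lia

theorem Surface.IsPrimeDivisor.sectionDivisor_eq {S : Surface} {E : DivisorialValuation k}
    (hE : S.IsPrimeDivisor E) (h : MeetsStandard E) : sectionDivisor k E = E.ord (y k) :=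
  hE.chartDivisor_eq h 1

theorem Surface.IsPrimeDivisor.fibreDivisor_eq {S : Surface} {E : DivisorialValuation k}
    (hE : S.IsPrimeDivisor E) (h : MeetsStandard E) : fibreDivisor k E = E.ord (x k) :=
  hE.chartDivisor_eq h 0

theorem sectionDivisor_eq_zero {E : DivisorialValuation k} (h : ¬ MeetsStandard E) :
    sectionDivisor k E = 0 := by
  rw [sectionDivisor, chartDivisor, if_neg fun h' => h h'.1]

theorem fibreDivisor_eq_zero {E : DivisorialValuation k} (h : ¬ MeetsStandard E) :
    fibreDivisor k E = 0 := by
  rw [fibreDivisor, chartDivisor, if_neg fun h' => h h'.1]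

/-- All the surfaces contain the same standard chart. Sections thus become polynomials, subject to
conditions only along the curves at infinity. -/
theorem Surface.exists_poly (S : Surface) {z : FunField k}
    (h : ∀ E, S.IsPrimeDivisor E → MeetsStandard E → 0 ≤ E.ord z) : ∃ q, z = polyEmb k q :=
  exists_poly_of_ord_nonneg fun p hp => by
    rw [← ord_chartCurve_refl]
    exact h _ (S.isPrimeDivisor_standard p hp) (meetsStandard_chartCurve p hp)

/-! ### The curves outside the standard chart -/

theorem ord_X_of_ne {i j : Fin 2} (h : i ≠ j) :
    (ofIrreducible (MvPolynomial.X i) (irreducible_X i)).ord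
      (polyEmb k (MvPolynomial.X j)) = 0 := by
  refine ord_ofIrreducible_of_not_dvd _ fun hd => ?_
  exact h (MvPolynomial.X_dvd_X.1 hd)

/-- The coordinates `1 / x`, `y / x` on the plane. -/
def planeAut (k : Type*) [Field k] : FunField k ≃ₐ[k] FunField k := exists_aut_plane_x.choose

theorem planeAut_x : planeAut k (x k) = (x k)⁻¹ := exists_aut_plane_x.choose_spec.1

theorem planeAut_y : planeAut k (y k) = y k / x k := exists_aut_plane_x.choose_spec.2

/-- The line at infinity of the plane. -/
def lineCurve (k : Type*) [Field k] : DivisorialValuation k :=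
  chartCurve (planeAut k) (MvPolynomial.X 0) (irreducible_X 0)

/-- The coordinates `x`, `1 / y`. -/
def sectionAut (k : Type*) [Field k] : FunField k ≃ₐ[k] FunField k := exists_aut_x_inv_y.choose

theorem sectionAut_x : sectionAut k (x k) = x k := exists_aut_x_inv_y.choose_spec.1

theorem sectionAut_y : sectionAut k (y k) = (y k)⁻¹ := exists_aut_x_inv_y.choose_spec.2

/-- The section at infinity of a Hirzebruch surface. -/
def sectionCurve (k : Type*) [Field k] : DivisorialValuation k :=
  chartCurve (sectionAut k) (MvPolynomial.X 1) (irreducible_X 1)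

/-- The coordinates `1 / x`, `x ^ a * y`. -/
def fibreAut (k : Type*) [Field k] (a : ℕ) : FunField k ≃ₐ[k] FunField k :=
  (exists_aut_inv_x a).choose

theorem fibreAut_x (a : ℕ) : fibreAut k a (x k) = (x k)⁻¹ := (exists_aut_inv_x a).choose_spec.1

theorem fibreAut_y (a : ℕ) : fibreAut k a (y k) = x k ^ a * y k :=
  (exists_aut_inv_x a).choose_spec.2

/-- The fibre at infinity of a Hirzebruch surface. -/
def fibreCurve (k : Type*) [Field k] (a : ℕ) : DivisorialValuation k :=
  chartCurve (fibreAut k a) (MvPolynomial.X 0) (irreducible_X 0)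

theorem lineCurve_ord_x : (lineCurve k).ord (x k) = -1 := by
  have h := ord_chartCurve (planeAut k) _ (irreducible_X 0) (x k)
  rw [planeAut_x, DivisorialValuation.ord_inv, x, ord_ofIrreducible_self] at h
  change -(lineCurve k).ord (x k) = 1 at h
  lia

theorem lineCurve_ord_y : (lineCurve k).ord (y k) = -1 := by
  have h := ord_chartCurve (planeAut k) _ (irreducible_X 0) (y k)
  rw [planeAut_y, DivisorialValuation.ord_div _ y_ne_zero x_ne_zero, y,
    ord_X_of_ne (by simp)] at h
  change (lineCurve k).ord (y k) - (lineCurve k).ord (x k) = 0 at h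
  rw [lineCurve_ord_x] at h
  lia

theorem sectionCurve_ord_x : (sectionCurve k).ord (x k) = 0 := by
  have h := ord_chartCurve (sectionAut k) _ (irreducible_X 1) (x k)
  rwa [sectionAut_x, x, ord_X_of_ne (by simp)] at h

theorem sectionCurve_ord_y : (sectionCurve k).ord (y k) = -1 := by
  have h := ord_chartCurve (sectionAut k) _ (irreducible_X 1) (y k)
  rw [sectionAut_y, DivisorialValuation.ord_inv, y, ord_ofIrreducible_self] at h
  change -(sectionCurve k).ord (y k) = 1 at h
  lia

theorem fibreCurve_ord_x (a : ℕ) : (fibreCurve k a).ord (x k) = -1 := by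
  have h := ord_chartCurve (fibreAut k a) _ (irreducible_X 0) (x k)
  rw [fibreAut_x, DivisorialValuation.ord_inv, x, ord_ofIrreducible_self] at h
  change -(fibreCurve k a).ord (x k) = 1 at h
  lia

/-- The fibre coordinate near this fibre is `x ^ a * y`, which is a unit along it. This is where the
twist of the bundle enters the computations. -/
theorem fibreCurve_ord_y (a : ℕ) : (fibreCurve k a).ord (y k) = a := by
  have h := ord_chartCurve (fibreAut k a) _ (irreducible_X 0) (y k)
  rw [fibreAut_y, DivisorialValuation.ord_mul _ (pow_ne_zero _ x_ne_zero) y_ne_zero,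
    DivisorialValuation.ord_pow, y, ord_X_of_ne (by simp)] at h
  change a * (fibreCurve k a).ord (x k) + (fibreCurve k a).ord (y k) = 0 at h
  rw [fibreCurve_ord_x] at h
  lia

theorem not_meetsStandard_lineCurve : ¬ MeetsStandard (lineCurve k) := by
  rw [meetsStandard_iff, lineCurve_ord_x]; lia

theorem not_meetsStandard_sectionCurve : ¬ MeetsStandard (sectionCurve k) := by
  rw [meetsStandard_iff, sectionCurve_ord_y]; lia

theorem not_meetsStandard_fibreCurve (a : ℕ) : ¬ MeetsStandard (fibreCurve k a) := by
  rw [meetsStandard_iff, fibreCurve_ord_x]; lia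

theorem canonicalDivisor_lineCurve : canonicalDivisor (lineCurve k) = -3 := by
  rw [lineCurve, canonicalDivisor_chartCurve, ← lineCurve]
  have : autJac (planeAut k) = -((x k)⁻¹ ^ 3) := by
    simp only [autJac, planeAut_x, planeAut_y, jac, Derivation.leibniz_inv, Derivation.leibniz_div,
      pd_x, pd_y, smul_eq_mul]
    have := x_ne_zero (k := k)
    simp
    field_simp
  rw [this, DivisorialValuation.ord_neg, DivisorialValuation.ord_pow,
    DivisorialValuation.ord_inv, lineCurve_ord_x]
  norm_num

theorem canonicalDivisor_sectionCurve : canonicalDivisor (sectionCurve k) = -2 := by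
  rw [sectionCurve, canonicalDivisor_chartCurve, ← sectionCurve]
  have : autJac (sectionAut k) = -((y k)⁻¹ ^ 2) := by
    simp [autJac, sectionAut_x, sectionAut_y, jac, Derivation.leibniz_inv, pd_x, pd_y]
  rw [this, DivisorialValuation.ord_neg, DivisorialValuation.ord_pow,
    DivisorialValuation.ord_inv, sectionCurve_ord_y]
  norm_num

/-- The Jacobian of `1 / x` and `x ^ a * y` is `-x ^ (a - 2)`, and `x` has a simple pole along this
fibre. -/
theorem canonicalDivisor_fibreCurve (a : ℕ) : canonicalDivisor (fibreCurve k a) = a - 2 := by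
  rw [fibreCurve, canonicalDivisor_chartCurve, ← fibreCurve]
  have : autJac (fibreAut k a) = -((x k)⁻¹ ^ 2 * x k ^ a) := by
    simp [autJac, fibreAut_x, fibreAut_y, jac, Derivation.leibniz_inv, Derivation.leibniz,
      Derivation.leibniz_pow, pd_x, pd_y]
  rw [this, DivisorialValuation.ord_neg, DivisorialValuation.ord_mul _ (pow_ne_zero _ (inv_ne_zero x_ne_zero))
      (pow_ne_zero _ x_ne_zero), DivisorialValuation.ord_pow, DivisorialValuation.ord_pow,
    DivisorialValuation.ord_inv, fibreCurve_ord_x]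
  push_cast; ring

theorem coordChart_planeAut : coordChart (planeAut k) = Algebra.adjoin k {(x k)⁻¹, y k / x k} := by
  rw [coordChart_eq, planeAut_x, planeAut_y]

theorem isPrimeDivisor_lineCurve : Surface.plane.IsPrimeDivisor (lineCurve k) :=
  Surface.plane.isPrimeDivisor_chartCurve (by
    rw [coordChart_planeAut]; exact Or.inr (Or.inl rfl)) _ _

theorem isPrimeDivisor_sectionCurve (a : ℕ) :
    (Surface.hirzebruch a).IsPrimeDivisor (sectionCurve k) :=
  (Surface.hirzebruch a).isPrimeDivisor_chartCurve (by
    rw [coordChart_eq, sectionAut_x, sectionAut_y]; exact Or.inr (Or.inl rfl)) _ _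

theorem isPrimeDivisor_fibreCurve (a : ℕ) :
    (Surface.hirzebruch a).IsPrimeDivisor (fibreCurve k a) :=
  (Surface.hirzebruch a).isPrimeDivisor_chartCurve (by
    rw [coordChart_eq, fibreAut_x, fibreAut_y]; exact Or.inr (Or.inr (Or.inl rfl))) _ _

/-- In a chart, a prime divisor along which a coordinate vanishes is the coordinate axis. -/
theorem Surface.IsPrimeDivisor.eq_axis {S : Surface} {E : DivisorialValuation k}
    (hE : S.IsPrimeDivisor E) {σ : FunField k ≃ₐ[k] FunField k} (hσ : coordChart σ ∈ S.charts k)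
    (h0 : 0 ≤ E.ord (σ (x k))) (h1 : 0 ≤ E.ord (σ (y k))) (i : Fin 2)
    (hpos : 0 < E.ord (σ (polyEmb k (MvPolynomial.X i)))) :
    E = chartCurve σ (MvPolynomial.X i) (irreducible_X i) := by
  have hx : σ (x k) ≠ 0 := by simpa using x_ne_zero
  have hy : σ (y k) ≠ 0 := by simpa using y_ne_zero
  obtain ⟨p, hp, rfl⟩ := hE.exists_eq_chartCurve hσ (by
    rw [coordChart_eq]
    exact adjoin_toSubring_le E.algebraMap_mem ((E.mem_ring_iff hx).2 h0)
      ((E.mem_ring_iff hy).2 h1))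
  exact eq_chartCurve_of_pos hp _ hpos

theorem plane_isPrimeDivisor_cases {E : DivisorialValuation k}
    (hE : Surface.plane.IsPrimeDivisor E) : MeetsStandard E ∨ E = lineCurve k := by
  have hx := x_ne_zero (k := k)
  have hy := y_ne_zero (k := k)
  obtain ⟨A, hA, hle⟩ := Surface.plane.exists_chart_le E.ring E.algebraMap_mem
  have two : 0 ≤ E.ord (x k)⁻¹ → 0 ≤ E.ord (y k / x k) → MeetsStandard E ∨ E = lineCurve k := by
    intro h1 h2
    by_cases hpos : 0 < E.ord (x k)⁻¹
    · refine Or.inr (hE.eq_axis (σ := planeAut k) ?_ ?_ ?_ 0 ?_)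
      · rw [coordChart_planeAut]; exact Or.inr (Or.inl rfl)
      · rwa [planeAut_x]
      · rwa [planeAut_y]
      · change 0 < E.ord (planeAut k (x k)); rwa [planeAut_x]
    · left
      rw [DivisorialValuation.ord_inv] at h1 hpos
      rw [E.ord_div hy hx] at h2
      rw [meetsStandard_iff]
      lia
  rcases hA with rfl | rfl | rfl
  · exact Or.inl hle
  · exact two (E.ord_nonneg (hle (fst_mem_algebra _ _))) (E.ord_nonneg (hle (snd_mem_algebra _ _)))
  · have h1 := E.ord_nonneg (hle (fst_mem_algebra _ _))
    have h2 := E.ord_nonneg (hle (snd_mem_algebra _ _))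
    obtain ⟨σ, hσx, hσy⟩ := exists_aut_plane_y (k := k)
    -- If `1 / y` vanishes along `E`, then `E` is a coordinate axis on which `x / y` is a unit, so
    -- `E` already meets the second chart.
    by_cases hpos : 0 < E.ord (y k)⁻¹
    · have hax := hE.eq_axis (σ := σ) (by
        rw [coordChart_eq, hσx, hσy]; exact Or.inr (Or.inr rfl)) (by rwa [hσx]) (by rwa [hσy]) 0
        (by change 0 < E.ord (σ (x k)); rwa [hσx])
      have h3 : E.ord (σ (y k)) = 0 := by
        rw [hax, ord_chartCurve, y, ord_X_of_ne (by simp)]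
      rw [hσy, E.ord_div hx hy] at h3
      rw [DivisorialValuation.ord_inv] at hpos
      refine two ?_ ?_
      · rw [DivisorialValuation.ord_inv]; lia
      · rw [E.ord_div hy hx]; lia
    · left
      rw [DivisorialValuation.ord_inv] at h1 hpos
      rw [E.ord_div hx hy] at h2
      rw [meetsStandard_iff]
      lia

theorem hirzebruch_isPrimeDivisor_cases {a : ℕ} {E : DivisorialValuation k}
    (hE : (Surface.hirzebruch a).IsPrimeDivisor E) :
    MeetsStandard E ∨ E = sectionCurve k ∨ E = fibreCurve k a := by
  have hx := x_ne_zero (k := k)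
  have hy := y_ne_zero (k := k)
  obtain ⟨A, hA, hle⟩ := (Surface.hirzebruch a).exists_chart_le E.ring E.algebraMap_mem
  have ordxy : E.ord (x k ^ a * y k) = a * E.ord (x k) + E.ord (y k) := by
    rw [E.ord_mul (pow_ne_zero _ hx) hy, E.ord_pow]
  have two : 0 ≤ E.ord (x k) → 0 ≤ E.ord (y k)⁻¹ →
      MeetsStandard E ∨ E = sectionCurve k ∨ E = fibreCurve k a := by
    intro h1 h2
    by_cases hpos : 0 < E.ord (y k)⁻¹
    · refine Or.inr (Or.inl (hE.eq_axis (σ := sectionAut k) ?_ ?_ ?_ 1 ?_))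
      · rw [coordChart_eq, sectionAut_x, sectionAut_y]; exact Or.inr (Or.inl rfl)
      · rwa [sectionAut_x]
      · rwa [sectionAut_y]
      · change 0 < E.ord (sectionAut k (y k)); rwa [sectionAut_y]
    · left
      rw [DivisorialValuation.ord_inv] at h2 hpos
      rw [meetsStandard_iff]
      lia
  have three : 0 ≤ E.ord (x k)⁻¹ → 0 ≤ E.ord (x k ^ a * y k) →
      MeetsStandard E ∨ E = sectionCurve k ∨ E = fibreCurve k a := by
    intro h1 h2
    by_cases hpos : 0 < E.ord (x k)⁻¹
    · refine Or.inr (Or.inr (hE.eq_axis (σ := fibreAut k a) ?_ ?_ ?_ 0 ?_))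
      · rw [coordChart_eq, fibreAut_x, fibreAut_y]; exact Or.inr (Or.inr (Or.inl rfl))
      · rwa [fibreAut_x]
      · rwa [fibreAut_y]
      · change 0 < E.ord (fibreAut k a (x k)); rwa [fibreAut_x]
    · left
      rw [DivisorialValuation.ord_inv] at h1 hpos
      have h0 : E.ord (x k) = 0 := by lia
      rw [ordxy, h0] at h2
      rw [meetsStandard_iff]
      lia
  rcases hA with rfl | rfl | rfl | rfl
  · exact Or.inl hle
  · exact two (E.ord_nonneg (hle (fst_mem_algebra _ _))) (E.ord_nonneg (hle (snd_mem_algebra _ _)))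
  · exact three (E.ord_nonneg (hle (fst_mem_algebra _ _)))
      (E.ord_nonneg (hle (snd_mem_algebra _ _)))
  · have h1 := E.ord_nonneg (hle (fst_mem_algebra _ _))
    have h2 := E.ord_nonneg (hle (snd_mem_algebra _ _))
    obtain ⟨σ, hσx, hσy⟩ := exists_aut_inv_inv (k := k) a
    -- If `1 / x` vanishes along `E`, the other coordinate is a unit there and `E` meets the third
    -- chart. If not, `x` is a unit along `E` and the second chart serves.
    by_cases hpos : 0 < E.ord (x k)⁻¹
    · have hax := hE.eq_axis (σ := σ) (by
        rw [coordChart_eq, hσx, hσy]; exact Or.inr (Or.inr (Or.inr rfl)))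
        (by rwa [hσx]) (by rwa [hσy]) 0 (by change 0 < E.ord (σ (x k)); rwa [hσx])
      have h3 : E.ord (σ (y k)) = 0 := by
        rw [hax, ord_chartCurve, y, ord_X_of_ne (by simp)]
      rw [hσy, DivisorialValuation.ord_inv] at h3
      exact three h1 (by lia)
    · rw [DivisorialValuation.ord_inv] at h1 h2 hpos
      have h0 : E.ord (x k) = 0 := by lia
      rw [ordxy, h0] at h2
      refine two h0.ge ?_
      rw [DivisorialValuation.ord_inv]
      lia

theorem Surface.IsPrimeDivisor.lineDivisor_eq_zero {E : DivisorialValuation k}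
    (h : MeetsStandard E) : lineDivisor k E = 0 := by
  rw [lineDivisor, chartDivisor, if_neg]
  rintro ⟨-, h1⟩
  rw [DivisorialValuation.ord_inv] at h1
  rw [meetsStandard_iff] at h
  lia

theorem lineDivisor_lineCurve : lineDivisor k (lineCurve k) = 1 := by
  rw [lineDivisor, chartDivisor, if_pos]
  refine ⟨?_, ?_⟩
  · rw [← coordChart_planeAut]
    exact coordChart_le_chartCurve _ _ _
  · rw [DivisorialValuation.ord_inv, lineCurve_ord_x]; lia

/-! ### Log canonical classes -/

/-- The form `dx ∧ dy` has neither zeros nor poles on the standard chart and a triple pole along the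
line at infinity, so `K` is `-3` times that line. -/
theorem plane_logDivisor {C : DivisorialValuation k} {d : ℤ}
    (h : Surface.plane.LinEquiv (curveDivisor C) fun E => d * lineDivisor k E) (n r : ℕ) :
    ∃ H : FunField k, H ≠ 0 ∧ ∀ E, Surface.plane.IsPrimeDivisor E →
      n * canonicalDivisor E + r * curveDivisor C E = (r * d - 3 * n) * lineDivisor k E + E.ord H := by
  obtain ⟨g, hg, h⟩ := h
  refine ⟨g ^ r, pow_ne_zero _ hg, fun E hE => ?_⟩
  have hE' := h E hE
  dsimp only at hE'
  rw [hE', E.ord_pow]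
  rcases plane_isPrimeDivisor_cases hE with hs | rfl
  · rw [hE.canonicalDivisor_eq_zero hs, Surface.IsPrimeDivisor.lineDivisor_eq_zero hs]
    ring
  · rw [canonicalDivisor_lineCurve, lineDivisor_lineCurve]
    ring

theorem hirzebruch_logDivisor {a : ℕ} {C : DivisorialValuation k} {α β : ℤ}
    (h : (Surface.hirzebruch a).HasClass C α β) (n r : ℕ) :
    ∃ H : FunField k, H ≠ 0 ∧ ∀ E, (Surface.hirzebruch a).IsPrimeDivisor E →
      n * canonicalDivisor E + r * curveDivisor C E = (r * α - 2 * n) * sectionDivisor k E +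
        (r * β - (a + 2) * n) * fibreDivisor k E + E.ord H := by
  obtain ⟨g, hg, h⟩ := h
  have hx := x_ne_zero (k := k)
  have hy := y_ne_zero (k := k)
  -- The divisor of this function is `K + 2C₀ + (a + 2)f`: along the section and the fibre at
  -- infinity its orders are `-2` and `2a - (a + 2) = a - 2`.
  have hm : y k ^ 2 * x k ^ (a + 2) ≠ 0 := mul_ne_zero (pow_ne_zero _ hy) (pow_ne_zero _ hx)
  refine ⟨g ^ r * (y k ^ 2 * x k ^ (a + 2)) ^ n, mul_ne_zero (pow_ne_zero _ hg)
    (pow_ne_zero _ hm), fun E hE => ?_⟩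
  have hE' := h E hE
  dsimp only at hE'
  rw [hE', E.ord_mul (pow_ne_zero _ hg) (pow_ne_zero _ hm), E.ord_pow, E.ord_pow,
    E.ord_mul (pow_ne_zero _ hy) (pow_ne_zero _ hx), E.ord_pow, E.ord_pow]
  rcases hirzebruch_isPrimeDivisor_cases hE with hs | rfl | rfl
  · rw [hE.canonicalDivisor_eq_zero hs, hE.sectionDivisor_eq hs, hE.fibreDivisor_eq hs]
    push_cast; ring
  · rw [canonicalDivisor_sectionCurve, sectionDivisor_eq_zero not_meetsStandard_sectionCurve,
      fibreDivisor_eq_zero not_meetsStandard_sectionCurve, sectionCurve_ord_x, sectionCurve_ord_y]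
    push_cast; ring
  · rw [canonicalDivisor_fibreCurve, sectionDivisor_eq_zero (not_meetsStandard_fibreCurve a),
      fibreDivisor_eq_zero (not_meetsStandard_fibreCurve a), fibreCurve_ord_x, fibreCurve_ord_y]
    push_cast; ring

end PlanePairs

end

noncomputable section

namespace PlanePairs

open Polynomial

variable {k : Type*} [Field k]

/-! ### Polynomials along the curves at infinity -/

/-- The coefficients are units along `E` and `z` has a simple pole, so distinct powers of `z` have
distinct orders and the leading term wins. At the section at infinity `s = x`, `z = y`; at the line
at infinity `s = y / x`, `z = x`. -/
theorem DivisorialValuation.ord_eval₂ (E : DivisorialValuation k) {s z : FunField k}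
    (hs : ∀ c : k[X], c ≠ 0 → aeval s c ≠ 0 ∧ E.ord (aeval s c) = 0) (hz0 : z ≠ 0)
    (hz : E.ord z = -1) {P : k[X][X]} (hP : P ≠ 0) :
    E.ord (P.eval₂ (aeval s : k[X] →ₐ[k] FunField k).toRingHom z) = -P.natDegree := by
  rw [Polynomial.eval₂_eq_sum_range]
  have hord : ∀ i, P.coeff i ≠ 0 → aeval s (P.coeff i) * z ^ i ≠ 0 ∧
      E.ord (aeval s (P.coeff i) * z ^ i) = -i := by
    intro i hi
    have h := hs _ hi
    refine ⟨mul_ne_zero h.1 (pow_ne_zero _ hz0), ?_⟩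
    rw [E.ord_mul h.1 (pow_ne_zero _ hz0), h.2, E.ord_pow, hz]
    ring
  refine (E.ord_sum_eq (fun i => aeval s (P.coeff i) * z ^ i) P.natDegree (hord _ ?_).1
    (hord _ ?_).2 fun i _ => ?_).2
  · simpa using hP
  · simpa using hP
  · by_cases hi : P.coeff i = 0
    · left; simp [hi]
    · right; exact (hord i hi).2.ge

theorem aeval_X_ne_zero {i : Fin 2} {c : k[X]} (hc : c ≠ 0) :
    aeval (MvPolynomial.X i : MvPolynomial (Fin 2) k) c ≠ 0 := fun h0 =>
  hc ((transcendental_iff.1 ((MvPolynomial.algebraicIndependent_X (Fin 2) k).transcendental i)) c h0)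

theorem polyEmb_aeval_X (i : Fin 2) (c : k[X]) :
    polyEmb k (aeval (MvPolynomial.X i) c) = aeval (polyEmb k (MvPolynomial.X i)) c :=
  (Polynomial.aeval_algebraMap_apply (FunField k) (MvPolynomial.X i) c).symm

theorem aeval_x_ne_zero {c : k[X]} (hc : c ≠ 0) : aeval (x k) c ≠ 0 := by
  rw [x, ← polyEmb_aeval_X]
  exact polyEmb_ne_zero (aeval_X_ne_zero hc)

/-- Polynomials in one coordinate have order zero along the axis on which it is a coordinate. -/
theorem ord_axis_aeval {i j : Fin 2} (hij : i ≠ j) {c : k[X]} (hc : c ≠ 0) :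
    (ofIrreducible (MvPolynomial.X i) (irreducible_X i)).ord
      (aeval (polyEmb k (MvPolynomial.X j)) c) = 0 := by
  rw [← polyEmb_aeval_X]
  refine ord_ofIrreducible_of_not_dvd _ ?_
  rintro ⟨q, hq⟩
  -- Restriction to the axis kills the multiple of its equation and returns `c` itself.
  have h := congrArg (MvPolynomial.aeval (fun l => if l = i then (0 : k[X]) else X)) hq
  rw [map_mul, MvPolynomial.aeval_X, if_pos rfl, zero_mul, ← Polynomial.aeval_algHom_apply,
    MvPolynomial.aeval_X, if_neg hij.symm, aeval_X_left_apply] at h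
  exact hc h

theorem sectionCurve_ord_aeval_x {c : k[X]} (hc : c ≠ 0) :
    (sectionCurve k).ord (aeval (x k) c) = 0 := by
  have h := ord_chartCurve (sectionAut k) _ (irreducible_X 1) (aeval (x k) c)
  have h' : sectionAut k (aeval (x k) c) = aeval (sectionAut k (x k)) c :=
    (Polynomial.aeval_algHom_apply (sectionAut k) (x k) c).symm
  rw [h', sectionAut_x, x, ord_axis_aeval (by simp) hc] at h
  exact h

theorem lineCurve_ord_aeval {c : k[X]} (hc : c ≠ 0) :
    aeval (y k / x k) c ≠ 0 ∧ (lineCurve k).ord (aeval (y k / x k) c) = 0 := by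
  have h := ord_chartCurve (planeAut k) _ (irreducible_X 0) (aeval (y k) c)
  have h' : planeAut k (aeval (y k) c) = aeval (planeAut k (y k)) c :=
    (Polynomial.aeval_algHom_apply (planeAut k) (y k) c).symm
  have h0 : planeAut k (aeval (y k) c) ≠ 0 := by
    rw [Ne, EmbeddingLike.map_eq_zero_iff, y, ← polyEmb_aeval_X]
    exact polyEmb_ne_zero (aeval_X_ne_zero hc)
  rw [h', planeAut_y] at h h0
  rw [y, ord_axis_aeval (by simp) hc] at h
  exact ⟨h0, h⟩

/-- A polynomial as a polynomial in `y` over `k[x]`. -/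
def fibrePoly : MvPolynomial (Fin 2) k →ₐ[k] k[X][X] := MvPolynomial.aeval ![C X, X]

theorem eval₂_fibrePoly (q : MvPolynomial (Fin 2) k) :
    (fibrePoly q).eval₂ (aeval (x k) : k[X] →ₐ[k] FunField k).toRingHom (y k) = polyEmb k q := by
  induction q using MvPolynomial.induction_on with
  | C c =>
    have : polyEmb k (MvPolynomial.C c) = algebraMap k (FunField k) c :=
      (IsScalarTower.algebraMap_apply k (MvPolynomial (Fin 2) k) (FunField k) c).symm
    rw [this, fibrePoly, MvPolynomial.aeval_C,
      IsScalarTower.algebraMap_apply k k[X] k[X][X]]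
    simp
  | add p q hp hq => rw [map_add, eval₂_add, hp, hq, map_add]
  | mul_X p i hp =>
    rw [map_mul, eval₂_mul, hp, map_mul]
    congr 1
    fin_cases i <;> simp [fibrePoly, x, y]

theorem sectionCurve_ord_polyEmb {q : MvPolynomial (Fin 2) k} (hq : q ≠ 0) :
    (sectionCurve k).ord (polyEmb k q) = -(fibrePoly q).natDegree := by
  rw [← eval₂_fibrePoly]
  refine (sectionCurve k).ord_eval₂ (fun c hc => ⟨aeval_x_ne_zero hc, sectionCurve_ord_aeval_x hc⟩)
    y_ne_zero sectionCurve_ord_y fun h0 => polyEmb_ne_zero hq ?_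
  rw [← eval₂_fibrePoly, h0, eval₂_zero]

theorem exists_aeval_x_of_ord {q : MvPolynomial (Fin 2) k}
    (h : 0 ≤ (sectionCurve k).ord (polyEmb k q)) : ∃ c : k[X], polyEmb k q = aeval (x k) c := by
  rcases eq_or_ne q 0 with rfl | hq
  · exact ⟨0, by simp⟩
  rw [sectionCurve_ord_polyEmb hq] at h
  have hdeg : (fibrePoly q).natDegree = 0 := by lia
  refine ⟨(fibrePoly q).coeff 0, ?_⟩
  rw [← eval₂_fibrePoly]
  conv_lhs => rw [eq_C_of_natDegree_eq_zero hdeg, eval₂_C]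
  rfl

theorem fibreCurve_ord_aeval_x (a : ℕ) {c : k[X]} (hc : c ≠ 0) :
    (fibreCurve k a).ord (aeval (x k) c) = -c.natDegree := by
  rw [aeval_eq_sum_range]
  have hord : ∀ i, c.coeff i ≠ 0 → c.coeff i • x k ^ i ≠ 0 ∧
      (fibreCurve k a).ord (c.coeff i • x k ^ i) = -i := by
    intro i hi
    have h0 : algebraMap k (FunField k) (c.coeff i) ≠ 0 := by simpa using hi
    rw [Algebra.smul_def]
    refine ⟨mul_ne_zero h0 (pow_ne_zero _ x_ne_zero), ?_⟩
    rw [DivisorialValuation.ord_mul _ h0 (pow_ne_zero _ x_ne_zero),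
      DivisorialValuation.ord_algebraMap, DivisorialValuation.ord_pow, fibreCurve_ord_x]
    ring
  refine ((fibreCurve k a).ord_sum_eq (fun i => c.coeff i • x k ^ i) c.natDegree (hord _ ?_).1
    (hord _ ?_).2 fun i _ => ?_).2
  · simpa using hc
  · simpa using hc
  · by_cases hi : c.coeff i = 0
    · left; simp [hi]
    · right; exact (hord i hi).2.ge

/-- A polynomial as a polynomial in `x` over `k[y / x]`. -/
def conePoly : MvPolynomial (Fin 2) k →ₐ[k] k[X][X] := MvPolynomial.aeval ![X, C X * X]

theorem eval₂_conePoly (q : MvPolynomial (Fin 2) k) :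
    (conePoly q).eval₂ (aeval (y k / x k) : k[X] →ₐ[k] FunField k).toRingHom (x k) =
      polyEmb k q := by
  have hx := x_ne_zero (k := k)
  induction q using MvPolynomial.induction_on with
  | C c =>
    have : polyEmb k (MvPolynomial.C c) = algebraMap k (FunField k) c :=
      (IsScalarTower.algebraMap_apply k (MvPolynomial (Fin 2) k) (FunField k) c).symm
    rw [this, conePoly, MvPolynomial.aeval_C,
      IsScalarTower.algebraMap_apply k k[X] k[X][X]]
    simp
  | add p q hp hq => rw [map_add, eval₂_add, hp, hq, map_add]
  | mul_X p i hp =>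
    rw [map_mul, eval₂_mul, hp, map_mul]
    congr 1
    fin_cases i
    · simp [conePoly, x]
    · simp [conePoly, eval₂_mul, hx, y]

/-- Writing `y = (y / x) * x` turns a monomial with exponents `i`, `j` into `(y / x) ^ j * x ^ (i +
j)`. The outer exponent is the total degree, and no two monomials collide. -/
theorem conePoly_coeff (q : MvPolynomial (Fin 2) k) (m : Fin 2 →₀ ℕ) :
    ((conePoly q).coeff (m 0 + m 1)).coeff (m 1) = q.coeff m := by
  induction q using MvPolynomial.induction_on' with
  | monomial s c =>
    have h : conePoly (MvPolynomial.monomial s c) = C (C c * X ^ s 1) * X ^ (s 0 + s 1) := by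
      rw [conePoly, MvPolynomial.aeval_monomial, Finsupp.prod_fintype _ _ (by simp),
        Fin.prod_univ_two, IsScalarTower.algebraMap_apply k k[X] k[X][X]]
      simp [mul_pow, pow_add]
      ring
    rw [h, coeff_C_mul, coeff_X_pow, MvPolynomial.coeff_monomial]
    by_cases hs : s = m
    · subst hs; simp
    · rw [if_neg hs]
      by_cases h1 : m 0 + m 1 = s 0 + s 1
      · rw [if_pos h1, mul_one, coeff_C_mul, coeff_X_pow, if_neg, mul_zero]
        intro h2
        apply hs
        ext i; fin_cases i
        · simp; lia
        · simp; lia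
      · simp [h1]
  | add p q hp hq => simp [hp, hq]

theorem lineCurve_ord_polyEmb {q : MvPolynomial (Fin 2) k} (hq : q ≠ 0) :
    (lineCurve k).ord (polyEmb k q) = -(conePoly q).natDegree := by
  rw [← eval₂_conePoly]
  refine (lineCurve k).ord_eval₂ (fun c hc => lineCurve_ord_aeval hc)
    x_ne_zero lineCurve_ord_x fun h0 => polyEmb_ne_zero hq ?_
  rw [← eval₂_conePoly, h0, eval₂_zero]

theorem coeff_eq_zero_of_lineCurve_ord {q : MvPolynomial (Fin 2) k} {n : ℕ}
    (h : -(n : ℤ) ≤ (lineCurve k).ord (polyEmb k q)) {m : Fin 2 →₀ ℕ} (hm : n < m 0 + m 1) :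
    q.coeff m = 0 := by
  rcases eq_or_ne q 0 with rfl | hq
  · simp
  rw [lineCurve_ord_polyEmb hq] at h
  have h0 : (conePoly q).coeff (m 0 + m 1) = 0 := coeff_eq_zero_of_natDegree_lt (by lia)
  rw [← conePoly_coeff, h0, coeff_zero]

theorem exists_const_of_lineCurve_ord {q : MvPolynomial (Fin 2) k}
    (h : 0 ≤ (lineCurve k).ord (polyEmb k q)) :
    ∃ c : k, polyEmb k q = algebraMap k (FunField k) c := by
  refine ⟨q.coeff 0, ?_⟩
  rw [IsScalarTower.algebraMap_apply k (MvPolynomial (Fin 2) k) (FunField k)]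
  congr 1
  ext m
  rw [MvPolynomial.algebraMap_eq, MvPolynomial.coeff_C]
  split_ifs with hm
  · rw [hm]
  · refine coeff_eq_zero_of_lineCurve_ord (n := 0) (by simpa using h) ?_
    by_contra! h0
    apply hm
    ext i; fin_cases i
    · simp; lia
    · simp; lia

theorem mem_span_of_lineCurve_ord {q : MvPolynomial (Fin 2) k}
    (h : -1 ≤ (lineCurve k).ord (polyEmb k q)) :
    polyEmb k q ∈ Submodule.span k {1, x k, y k} := by
  rw [q.as_sum, map_sum]
  refine Submodule.sum_mem _ fun m hm => ?_
  have hm1 : m 0 + m 1 ≤ 1 := by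
    by_contra! hlt
    exact MvPolynomial.mem_support_iff.1 hm
      (coeff_eq_zero_of_lineCurve_ord (n := 1) (by simpa using h) hlt)
  have hmono : polyEmb k (MvPolynomial.monomial m (q.coeff m)) =
      q.coeff m • (x k ^ m 0 * y k ^ m 1) := by
    rw [MvPolynomial.monomial_eq, map_mul, Finsupp.prod_fintype _ _ (by simp), Fin.prod_univ_two,
      map_mul, map_pow, map_pow, Algebra.smul_def,
      IsScalarTower.algebraMap_apply k (MvPolynomial (Fin 2) k) (FunField k)]
    rfl
  rw [hmono]
  refine Submodule.smul_mem _ _ (Submodule.subset_span ?_)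
  have : (m 0 = 0 ∧ m 1 = 0) ∨ (m 0 = 1 ∧ m 1 = 0) ∨ (m 0 = 0 ∧ m 1 = 1) := by lia
  rcases this with ⟨h0, h1⟩ | ⟨h0, h1⟩ | ⟨h0, h1⟩ <;> simp [h0, h1]

/-! ### Sections on the plane and on Hirzebruch surfaces -/

theorem plane_isConst {z : FunField k}
    (h : ∀ E, Surface.plane.IsPrimeDivisor E → 0 ≤ E.ord z) :
    ∃ c : k, z = algebraMap k (FunField k) c := by
  obtain ⟨q, rfl⟩ := Surface.plane.exists_poly fun E hE _ => h E hE
  exact exists_const_of_lineCurve_ord (h _ isPrimeDivisor_lineCurve)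

/-- A divisor of negative degree has no sections: a section would be a nonzero polynomial vanishing
along the line at infinity. -/
theorem plane_not_isLogSection {C : DivisorialValuation k} {d : ℤ}
    (hd : Surface.plane.LinEquiv (curveDivisor C) fun E => d * lineDivisor k E) {n r : ℕ}
    (hneg : r * d < 3 * n) (G : FunField k) : ¬ Surface.plane.IsLogSection C n r G := by
  rintro ⟨hG0, hG⟩
  obtain ⟨H, hH0, hH⟩ := plane_logDivisor hd n r
  have key : ∀ E, Surface.plane.IsPrimeDivisor E →
      (3 * n - r * d) * lineDivisor k E ≤ E.ord (G * H) := by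
    intro E hE
    have h1 := hG E hE
    have h2 := hH E hE
    rw [E.ord_mul hG0 hH0]
    linarith
  obtain ⟨q, hq⟩ := Surface.plane.exists_poly (z := G * H) fun E hE hs => by
    have := key E hE
    rwa [Surface.IsPrimeDivisor.lineDivisor_eq_zero hs, mul_zero] at this
  have h3 := key _ isPrimeDivisor_lineCurve
  have hq0 : q ≠ 0 := by
    rintro rfl
    exact mul_ne_zero hG0 hH0 (by simpa using hq)
  rw [hq, lineDivisor_lineCurve, lineCurve_ord_polyEmb hq0] at h3
  lia

/-- The degree `rα - 2n` on the fibres is negative. A section would vanish along `C₀`, so after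
clearing poles along `x = 0` it would be `y` times a polynomial and yet have no pole at `y = ∞`. -/
theorem hirzebruch_not_isLogSection {a : ℕ} {C : DivisorialValuation k} {α β : ℤ}
    (hC : (Surface.hirzebruch a).HasClass C α β) {n r : ℕ}
    (hneg : r * α < 2 * n) (G : FunField k) : ¬ (Surface.hirzebruch a).IsLogSection C n r G := by
  rintro ⟨hG0, hG⟩
  obtain ⟨H, hH0, hH⟩ := hirzebruch_logDivisor hC n r
  set e : ℤ := r * β - (a + 2) * n
  -- Only `e ≤ N` matters; for negative `e` there are no poles to clear and `N = 0` works.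
  set N : ℕ := e.toNat
  have hx := x_ne_zero (k := k)
  have hy := y_ne_zero (k := k)
  have hz0 : G * H * x k ^ N / y k ≠ 0 :=
    div_ne_zero (mul_ne_zero (mul_ne_zero hG0 hH0) (pow_ne_zero _ hx)) hy
  have hord : ∀ E : DivisorialValuation k, E.ord (G * H * x k ^ N / y k) =
      E.ord G + E.ord H + N * E.ord (x k) - E.ord (y k) := by
    intro E
    rw [E.ord_div (mul_ne_zero (mul_ne_zero hG0 hH0) (pow_ne_zero _ hx)) hy,
      E.ord_mul (mul_ne_zero hG0 hH0) (pow_ne_zero _ hx), E.ord_mul hG0 hH0, E.ord_pow]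
  have key : ∀ E, (Surface.hirzebruch a).IsPrimeDivisor E →
      0 ≤ E.ord G + E.ord H + (r * α - 2 * n) * sectionDivisor k E + e * fibreDivisor k E := by
    intro E hE
    have h1 := hG E hE
    have h2 := hH E hE
    linarith
  obtain ⟨q, hq⟩ := (Surface.hirzebruch a).exists_poly (z := G * H * x k ^ N / y k)
    fun E hE hs => by
      have h1 := key E hE
      rw [hE.sectionDivisor_eq hs, hE.fibreDivisor_eq hs] at h1
      have hxy := meetsStandard_iff.1 hs
      rw [hord]
      have hN : e ≤ N := Int.self_le_toNat e
      nlinarith [mul_nonneg (sub_nonneg.2 hN) hxy.1,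
        mul_nonneg (show 0 ≤ 2 * (n : ℤ) - r * α - 1 by lia) hxy.2]
  have hq0 : q ≠ 0 := by
    rintro rfl
    exact hz0 (by simpa using hq)
  have h3 := key _ (isPrimeDivisor_sectionCurve a)
  rw [sectionDivisor_eq_zero not_meetsStandard_sectionCurve,
    fibreDivisor_eq_zero not_meetsStandard_sectionCurve] at h3
  have h4 := hord (sectionCurve k)
  rw [hq, sectionCurve_ord_polyEmb hq0, sectionCurve_ord_x, sectionCurve_ord_y] at h4
  lia

/-- The sections of a multiple of the fibre are functions on the base. -/
theorem hirzebruch_fibre_section {a : ℕ} {e : ℕ} {z : FunField k} (hz : z ≠ 0)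
    (h : ∀ E, (Surface.hirzebruch a).IsPrimeDivisor E → 0 ≤ E.ord z + e * fibreDivisor k E) :
    ∃ c : k[X], x k ^ e * z = aeval (x k) c := by
  have hx := x_ne_zero (k := k)
  obtain ⟨q, hq⟩ := (Surface.hirzebruch a).exists_poly (z := x k ^ e * z) fun E hE hs => by
    have h1 := h E hE
    rw [hE.fibreDivisor_eq hs] at h1
    rw [E.ord_mul (pow_ne_zero _ hx) hz, E.ord_pow]
    linarith
  rw [hq]
  refine exists_aeval_x_of_ord ?_
  have h2 := h _ (isPrimeDivisor_sectionCurve a)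
  rw [fibreDivisor_eq_zero not_meetsStandard_sectionCurve] at h2
  rw [← hq, DivisorialValuation.ord_mul _ (pow_ne_zero _ hx) hz, DivisorialValuation.ord_pow,
    sectionCurve_ord_x]
  linarith

theorem hirzebruch_isConst {a : ℕ} {z : FunField k}
    (h : ∀ E, (Surface.hirzebruch a).IsPrimeDivisor E → 0 ≤ E.ord z) :
    ∃ c : k, z = algebraMap k (FunField k) c := by
  rcases eq_or_ne z 0 with rfl | hz
  · exact ⟨0, by simp⟩
  obtain ⟨c, hc⟩ := hirzebruch_fibre_section (a := a) (e := 0) hz (by simpa using h)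
  rw [pow_zero, one_mul] at hc
  have hc0 : c ≠ 0 := by rintro rfl; exact hz (by simpa using hc)
  have h1 := h _ (isPrimeDivisor_fibreCurve a)
  rw [hc, fibreCurve_ord_aeval_x a hc0] at h1
  refine ⟨c.coeff 0, ?_⟩
  rw [hc]
  conv_lhs => rw [eq_C_of_natDegree_eq_zero (show c.natDegree = 0 by lia), aeval_C]

/-- The classes of the section and of the fibre are independent. -/
theorem hirzebruch_class_independent {a : ℕ} {i j : ℤ} {g : FunField k} (hg : g ≠ 0)
    (h : ∀ E, (Surface.hirzebruch a).IsPrimeDivisor E →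
      i * sectionDivisor k E + j * fibreDivisor k E + E.ord g = 0) : i = 0 ∧ j = 0 := by
  have hx := x_ne_zero (k := k)
  have hy := y_ne_zero (k := k)
  have hz0 : g * y k ^ i * x k ^ j ≠ 0 :=
    mul_ne_zero (mul_ne_zero hg (zpow_ne_zero _ hy)) (zpow_ne_zero _ hx)
  have hord : ∀ E : DivisorialValuation k, E.ord (g * y k ^ i * x k ^ j) =
      E.ord g + i * E.ord (y k) + j * E.ord (x k) := by
    intro E
    rw [E.ord_mul (mul_ne_zero hg (zpow_ne_zero _ hy)) (zpow_ne_zero _ hx),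
      E.ord_mul hg (zpow_ne_zero _ hy), E.ord_zpow, E.ord_zpow]
  have hzero : ∀ E, (Surface.hirzebruch a).IsPrimeDivisor E → MeetsStandard E →
      E.ord (g * y k ^ i * x k ^ j) = 0 := by
    intro E hE hs
    have h1 := h E hE
    rw [hE.sectionDivisor_eq hs, hE.fibreDivisor_eq hs] at h1
    rw [hord]
    linarith
  obtain ⟨q, hq⟩ := (Surface.hirzebruch a).exists_poly fun E hE hs => (hzero E hE hs).ge
  obtain ⟨q', hq'⟩ := (Surface.hirzebruch a).exists_poly (z := (g * y k ^ i * x k ^ j)⁻¹)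
    fun E hE hs => by rw [DivisorialValuation.ord_inv, hzero E hE hs, neg_zero]
  -- The function has no zeros or poles on the standard chart, hence is constant. Its orders along
  -- the section and the fibre at infinity then force `i = 0` and `j = 0` in turn.
  have hunit : IsUnit q := by
    refine IsUnit.of_mul_eq_one q' (IsFractionRing.injective _ (FunField k) ?_)
    rw [map_mul, map_one, ← hq, ← hq', mul_inv_cancel₀ hz0]
  obtain ⟨c, hc⟩ : ∃ c : k, q = MvPolynomial.C c := by
    rw [MvPolynomial.isUnit_iff_eq_C_of_isReduced] at hunit
    obtain ⟨c, -, hc⟩ := hunit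
    exact ⟨c, hc⟩
  have hconst : ∀ E : DivisorialValuation k, E.ord (g * y k ^ i * x k ^ j) = 0 := by
    intro E
    rw [hq, hc]
    have : polyEmb k (MvPolynomial.C c) = algebraMap k (FunField k) c :=
      (IsScalarTower.algebraMap_apply k (MvPolynomial (Fin 2) k) (FunField k) c).symm
    rw [this, E.ord_algebraMap]
  have h1 := h _ (isPrimeDivisor_sectionCurve a)
  have h2 := hconst (sectionCurve k)
  have h3 := h _ (isPrimeDivisor_fibreCurve a)
  have h4 := hconst (fibreCurve k a)
  rw [hord, sectionCurve_ord_x, sectionCurve_ord_y] at h2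
  rw [hord, fibreCurve_ord_x, fibreCurve_ord_y] at h4
  rw [sectionDivisor_eq_zero not_meetsStandard_sectionCurve,
    fibreDivisor_eq_zero not_meetsStandard_sectionCurve] at h1
  rw [sectionDivisor_eq_zero (not_meetsStandard_fibreCurve a),
    fibreDivisor_eq_zero (not_meetsStandard_fibreCurve a)] at h3
  have hi : i = 0 := by lia
  subst hi
  refine ⟨rfl, by lia⟩

theorem hasClass_unique {a : ℕ} {C : DivisorialValuation k} {α β α' β' : ℤ}
    (h : (Surface.hirzebruch a).HasClass C α β) (h' : (Surface.hirzebruch a).HasClass C α' β') :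
    α = α' ∧ β = β' := by
  obtain ⟨g, hg, hE⟩ := h
  obtain ⟨g', hg', hE'⟩ := h'
  have := hirzebruch_class_independent (a := a) (i := α - α') (j := β - β') (div_ne_zero hg hg')
    fun E hP => by
      have h1 := hE E hP
      have h2 := hE' E hP
      dsimp only at h1 h2
      rw [E.ord_div hg hg']
      linarith
  lia

/-! ### Nefness on Hirzebruch surfaces -/

/-- The only prime containing `I` is the maximal ideal, so the quotient is Artinian. Finiteness
matters because the intersection number is defined through `toNat`, which sends an infinite length
to zero. -/
theorem length_quotient_ne_top {R : Type*} [CommRing R] [IsNoetherianRing R] [IsLocalRing R]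
    {I : Ideal R} {s t : R} (hm : IsLocalRing.maximalIdeal R ≤ Ideal.span {s, t}) {M : ℕ}
    (hs : s ^ M ∈ I) (ht : t ∈ I) : Module.length R (R ⧸ I) ≠ ⊤ := by
  rw [Module.length_eq_of_surjective (R := R ⧸ I) (S := R) (M := R ⧸ I)
    Ideal.Quotient.mk_surjective]
  have hdim : Ring.KrullDimLE 0 (R ⧸ I) := Ring.krullDimLE_zero_iff.2 fun J hJ => by
    have hJc : (J.comap (Ideal.Quotient.mk I)).IsPrime := Ideal.comap_isPrime _ _
    have hIJ : I ≤ J.comap (Ideal.Quotient.mk I) := fun z hz => by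
      rw [Ideal.mem_comap, Ideal.Quotient.eq_zero_iff_mem.2 hz]
      exact J.zero_mem
    have hle : IsLocalRing.maximalIdeal R ≤ J.comap (Ideal.Quotient.mk I) := by
      refine hm.trans (Ideal.span_le.2 ?_)
      rintro _ (rfl | rfl)
      · exact hJc.mem_of_pow_mem M (hIJ hs)
      · exact hIJ ht
    have hmax : (J.comap (Ideal.Quotient.mk I)).IsMaximal := by
      rw [← (IsLocalRing.maximalIdeal.isMaximal R).eq_of_le hJc.ne_top hle]
      exact IsLocalRing.maximalIdeal.isMaximal R
    rw [← Ideal.map_comap_of_surjective _ Ideal.Quotient.mk_surjective J]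
    exact (Ideal.map_eq_top_or_isMaximal_of_surjective _ Ideal.Quotient.mk_surjective
      hmax).resolve_left (by
        rw [Ideal.map_comap_of_surjective _ Ideal.Quotient.mk_surjective J]
        exact hJ.ne_top)
  have : IsArtinianRing (R ⧸ I) := isArtinianRing_iff_krullDimLE_zero.2 hdim
  exact Module.length_ne_top

/-! ### The local ring at the origin of the standard chart. -/

theorem exists_decomposition (q : MvPolynomial (Fin 2) k) :
    ∃ a b, q = MvPolynomial.C (MvPolynomial.constantCoeff q) + MvPolynomial.X 0 * a +
      MvPolynomial.X 1 * b := by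
  induction q using MvPolynomial.induction_on with
  | C c => exact ⟨0, 0, by simp⟩
  | add p q hp hq =>
    obtain ⟨a, b, h⟩ := hp
    obtain ⟨a', b', h'⟩ := hq
    refine ⟨a + a', b + b', ?_⟩
    rw [map_add, map_add]
    linear_combination h + h'
  | mul_X p i _ =>
    fin_cases i
    · exact ⟨p, 0, by simp [mul_comm]⟩
    · exact ⟨0, p, by simp [mul_comm]⟩

/-- The coordinate ring of the standard chart. -/
abbrev standardRing (k : Type*) [Field k] : Subring (FunField k) :=
  (Algebra.adjoin k {x k, y k}).toSubring

/-- The polynomial ring is the coordinate ring of the standard chart. -/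
def standardEquiv (k : Type*) [Field k] : MvPolynomial (Fin 2) k ≃+* standardRing k :=
  RingEquiv.ofBijective ((polyEmb k).codRestrict (standardRing k)
    fun q => mem_standardChart.2 ⟨q, rfl⟩) ⟨fun p q h =>
      IsFractionRing.injective _ (FunField k) (congrArg Subtype.val h), fun z => by
        obtain ⟨q, hq⟩ := mem_standardChart.1 z.2
        exact ⟨q, Subtype.ext hq.symm⟩⟩

theorem standardEquiv_coe (q : MvPolynomial (Fin 2) k) :
    (standardEquiv k q : FunField k) = polyEmb k q := rfl

/-- The maximal ideal of the origin of the standard chart. -/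
def originIdeal (k : Type*) [Field k] : Ideal (standardRing k) :=
  (RingHom.ker (MvPolynomial.constantCoeff : MvPolynomial (Fin 2) k →+* k)).comap
    (standardEquiv k).symm

instance : (originIdeal k).IsPrime :=
  haveI := RingHom.ker_isPrime (MvPolynomial.constantCoeff : MvPolynomial (Fin 2) k →+* k)
  Ideal.comap_isPrime _ _

theorem standardEquiv_mem_originIdeal {q : MvPolynomial (Fin 2) k} :
    standardEquiv k q ∈ originIdeal k ↔ MvPolynomial.constantCoeff q = 0 := by
  rw [originIdeal, Ideal.mem_comap, RingHom.mem_ker]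
  simp

theorem eq_originIdeal {P : Ideal (standardRing k)} (hP : P.IsPrime)
    (hx : standardEquiv k (MvPolynomial.X 0) ∈ P) (hy : standardEquiv k (MvPolynomial.X 1) ∈ P) :
    P = originIdeal k := by
  ext z
  obtain ⟨q, rfl⟩ := (standardEquiv k).surjective z
  rw [standardEquiv_mem_originIdeal]
  obtain ⟨a, b, hab⟩ := exists_decomposition q
  have hmem : standardEquiv k q ∈ P ↔
      standardEquiv k (MvPolynomial.C (MvPolynomial.constantCoeff q)) ∈ P := by
    conv_lhs => rw [hab, map_add, map_add, map_mul, map_mul, add_assoc]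
    exact Ideal.add_mem_iff_left _ (add_mem (P.mul_mem_right _ hx) (P.mul_mem_right _ hy))
  rw [hmem]
  constructor
  · intro h
    by_contra h0
    exact hP.ne_top (Ideal.eq_top_of_isUnit_mem _ h
      (((IsUnit.mk0 _ h0).map MvPolynomial.C).map (standardEquiv k)))
  · intro h
    rw [h, map_zero, map_zero]
    exact P.zero_mem

/-- The local ring at the origin of the standard chart. -/
def originPoint (k : Type*) [Field k] : LocalSubring (FunField k) :=
  LocalSubring.ofPrime (standardRing k) (originIdeal k)

theorem passes_originPoint {p : MvPolynomial (Fin 2) k} (hp : Irreducible p)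
    (h0 : MvPolynomial.constantCoeff p = 0) :
    Passes (chartCurve AlgEquiv.refl p hp) (originPoint k) := by
  intro z hz
  obtain ⟨a, b, hb, rfl⟩ := mem_ofPrime.1 hz
  obtain ⟨a, rfl⟩ := (standardEquiv k).surjective a
  obtain ⟨b, rfl⟩ := (standardEquiv k).surjective b
  rw [standardEquiv_mem_originIdeal] at hb
  refine ⟨a, b, ?_, rfl⟩
  rintro ⟨c, rfl⟩
  exact hb (by rw [map_mul, h0, zero_mul])

theorem mem_originPoint (q : MvPolynomial (Fin 2) k) :
    polyEmb k q ∈ (originPoint k).toSubring :=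
  LocalSubring.le_ofPrime _ _ (mem_standardChart.2 ⟨q, rfl⟩)

instance : IsNoetherianRing (originPoint k).toSubring := by
  have h : IsNoetherianRing (standardRing k) :=
    isNoetherianRing_of_ringEquiv _ (standardEquiv k)
  exact IsLocalization.isNoetherianRing (originIdeal k).primeCompl
    (LocalSubring.ofPrime (standardRing k) (originIdeal k)).toSubring h

theorem maximalIdeal_originPoint_le :
    IsLocalRing.maximalIdeal (originPoint k).toSubring ≤
      Ideal.span {⟨x k, mem_originPoint _⟩, ⟨y k, mem_originPoint _⟩} := by
  intro z hz
  rw [IsLocalRing.mem_maximalIdeal, mem_nonunits_iff, isUnit_subring_iff] at hz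
  obtain ⟨a, b, hb, hab⟩ := mem_ofPrime.1 z.2
  obtain ⟨a, rfl⟩ := (standardEquiv k).surjective a
  have hbi : (b : FunField k)⁻¹ ∈ (originPoint k).toSubring :=
    mem_ofPrime.2 ⟨1, b, hb, by simp⟩
  have ha : standardEquiv k a ∈ originIdeal k := by
    by_contra ha
    have ha0 : (standardEquiv k a : FunField k) ≠ 0 := fun h => ha (by
      rw [show standardEquiv k a = 0 from Subtype.ext h]; exact Ideal.zero_mem _)
    have hb0 : (b : FunField k) ≠ 0 := fun h => hb (by
      rw [show b = 0 from Subtype.ext h]; exact Ideal.zero_mem _)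
    refine hz ⟨by rw [hab]; exact div_ne_zero ha0 hb0, ?_⟩
    rw [hab, inv_div]
    exact mem_ofPrime.2 ⟨b, _, ha, rfl⟩
  rw [standardEquiv_mem_originIdeal] at ha
  obtain ⟨c, d, hcd⟩ := exists_decomposition a
  rw [ha, map_zero, zero_add] at hcd
  rw [Ideal.mem_span_pair]
  refine ⟨⟨polyEmb k c, mem_originPoint c⟩ * ⟨_, hbi⟩,
    ⟨polyEmb k d, mem_originPoint d⟩ * ⟨_, hbi⟩, Subtype.ext ?_⟩
  change polyEmb k c * (b : FunField k)⁻¹ * x k + polyEmb k d * (b : FunField k)⁻¹ * y k = z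
  rw [hab, standardEquiv_coe, hcd, map_add, map_mul, map_mul, x, y]
  ring

/-! ### Intersection of the fibre with the section. -/

/-- The section `y = 0`. -/
def zeroSection (k : Type*) [Field k] : DivisorialValuation k :=
  chartCurve AlgEquiv.refl (MvPolynomial.X 1) (irreducible_X 1)

/-- The fibre `x = 0`. -/
def zeroFibre (k : Type*) [Field k] : DivisorialValuation k :=
  chartCurve AlgEquiv.refl (MvPolynomial.X 0) (irreducible_X 0)

theorem zeroSection_ord_x : (zeroSection k).ord (x k) = 0 := by
  rw [zeroSection, ord_chartCurve_refl, x, ord_X_of_ne (by simp)]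

theorem zeroSection_ord_y : (zeroSection k).ord (y k) = 1 := by
  rw [zeroSection, ord_chartCurve_refl, y, ord_ofIrreducible_self]

theorem zeroFibre_ord_x : (zeroFibre k).ord (x k) = 1 := by
  rw [zeroFibre, ord_chartCurve_refl, x, ord_ofIrreducible_self]

theorem zeroFibre_ne_zeroSection : zeroFibre k ≠ zeroSection k := fun h => by
  have := zeroFibre_ord_x (k := k)
  rw [h, zeroSection_ord_x] at this
  lia

theorem Surface.IsPrimeDivisor.curveDivisor_zeroFibre {S : Surface} {E : DivisorialValuation k}
    (hE : S.IsPrimeDivisor E) : curveDivisor (zeroFibre k) E = fibreDivisor k E := by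
  by_cases hs : MeetsStandard E
  · rw [hE.fibreDivisor_eq hs]
    obtain ⟨p, hp, rfl⟩ := hE.exists_eq_standard hs
    by_cases h : chartCurve AlgEquiv.refl p hp = zeroFibre k
    · rw [h, curveDivisor_self, zeroFibre_ord_x]
    · rw [curveDivisor_of_ne h]
      have h0 := (meetsStandard_iff.1 hs).1
      refine (le_antisymm (not_lt.1 fun hpos => h ?_) h0).symm
      exact eq_chartCurve_of_pos (σ := AlgEquiv.refl) hp (irreducible_X 0) hpos
  · rw [fibreDivisor_eq_zero hs, curveDivisor_of_ne]
    rintro rfl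
    exact hs (meetsStandard_chartCurve _ _)

theorem Surface.IsPrimeDivisor.curveDivisor_zeroSection {S : Surface} {E : DivisorialValuation k}
    (hE : S.IsPrimeDivisor E) : curveDivisor (zeroSection k) E = sectionDivisor k E := by
  by_cases hs : MeetsStandard E
  · rw [hE.sectionDivisor_eq hs]
    obtain ⟨p, hp, rfl⟩ := hE.exists_eq_standard hs
    by_cases h : chartCurve AlgEquiv.refl p hp = zeroSection k
    · rw [h, curveDivisor_self, zeroSection_ord_y]
    · rw [curveDivisor_of_ne h]
      have h0 := (meetsStandard_iff.1 hs).2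
      refine (le_antisymm (not_lt.1 fun hpos => h ?_) h0).symm
      exact eq_chartCurve_of_pos (σ := AlgEquiv.refl) hp (irreducible_X 1) hpos
  · rw [sectionDivisor_eq_zero hs, curveDivisor_of_ne]
    rintro rfl
    exact hs (meetsStandard_chartCurve _ _)

/-- On each of the other three charts `1 / x` or `1 / y` is regular, which excludes one of the two
curves. On the standard chart both coordinates must belong to the prime. -/
theorem eq_originPoint {a : ℕ} {R : LocalSubring (FunField k)}
    (hR : R ∈ (Surface.hirzebruch a).points k) (h1 : Passes (zeroSection k) R)
    (h2 : Passes (zeroFibre k) R) : R = originPoint k := by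
  obtain ⟨A, hA, P, hP, rfl⟩ := hR
  have hAP := LocalSubring.le_ofPrime A.toSubring P
  have hxi : ¬ (x k)⁻¹ ∈ (zeroFibre k).ring := by
    rw [DivisorialValuation.mem_ring_iff _ (inv_ne_zero x_ne_zero), DivisorialValuation.ord_inv,
      zeroFibre_ord_x]
    lia
  have hyi : ¬ (y k)⁻¹ ∈ (zeroSection k).ring := by
    rw [DivisorialValuation.mem_ring_iff _ (inv_ne_zero y_ne_zero), DivisorialValuation.ord_inv,
      zeroSection_ord_y]
    lia
  rcases hA with rfl | rfl | rfl | rfl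
  · have hPo : P = originIdeal k := by
      refine eq_originIdeal hP ?_ ?_
      · by_contra h
        exact hxi (h2 (mem_ofPrime.2 ⟨1, _, h, by
          rw [standardEquiv_coe, OneMemClass.coe_one, one_div]; rfl⟩))
      · by_contra h
        exact hyi (h1 (mem_ofPrime.2 ⟨1, _, h, by
          rw [standardEquiv_coe, OneMemClass.coe_one, one_div]; rfl⟩))
    subst hPo
    rfl
  · exact absurd (h1 (hAP (snd_mem_algebra _ _))) hyi
  · exact absurd (h2 (hAP (fst_mem_algebra _ _))) hxi
  · exact absurd (h2 (hAP (fst_mem_algebra _ _))) hxi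

theorem idealAt_le_maximalIdeal {S : Surface} {D : DivisorialValuation k → ℤ}
    {E : DivisorialValuation k} {R : LocalSubring (FunField k)} (hE : S.IsPrimeDivisor E)
    (hER : Passes E R) (hD : 0 < D E) :
    S.idealAt D R ≤ IsLocalRing.maximalIdeal R.toSubring := by
  refine Ideal.span_le.2 ?_
  rintro r (rfl | hr)
  · exact Ideal.zero_mem _
  · rw [SetLike.mem_coe, IsLocalRing.mem_maximalIdeal, mem_nonunits_iff, isUnit_subring_iff]
    rintro ⟨-, hinv⟩
    have h1 := hr E hE hER
    have h2 := E.ord_nonneg (hER hinv)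
    rw [DivisorialValuation.ord_inv] at h2
    lia

theorem properIntersection_zero (S : Surface) (Γ : DivisorialValuation k) :
    S.properIntersection 0 Γ = 0 := by
  unfold Surface.properIntersection
  refine finsum_mem_eq_zero_of_forall_eq_zero fun R _ => ?_
  have h : S.idealAt (fun E => ((0 : DivisorialValuation k →₀ ℕ) E : ℤ)) R = ⊤ :=
    (Ideal.eq_top_iff_one _).2 (Ideal.subset_span (Or.inr fun E _ _ => by simp))
  have : Subsingleton (R.toSubring ⧸ (S.idealAt
      (fun E => ((0 : DivisorialValuation k →₀ ℕ) E : ℤ)) R ⊔ S.idealAt (curveDivisor Γ) R)) := by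
    rw [Ideal.Quotient.subsingleton_iff, h, top_sup_eq]
  rw [Module.length_eq_zero]
  rfl

/-- A positive multiple of the fibre has a positive intersection number with the section. -/
theorem properIntersection_fibre_pos (a : ℕ) {M : ℕ} (hM : 0 < M) :
    0 < (Surface.hirzebruch a).properIntersection (Finsupp.single (zeroFibre k) M)
      (zeroSection k) := by
  classical
  set S := Surface.hirzebruch a
  set B := Finsupp.single (zeroFibre k) M with hB
  have hF : S.IsPrimeDivisor (zeroFibre k) := S.isPrimeDivisor_standard _ _
  have hS : S.IsPrimeDivisor (zeroSection k) := S.isPrimeDivisor_standard _ _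
  have hBF : B (zeroFibre k) = M := by simp [hB]
  have hpF : Passes (zeroFibre k) (originPoint k) := passes_originPoint _ (by simp)
  have hpS : Passes (zeroSection k) (originPoint k) := passes_originPoint _ (by simp)
  have hO : originPoint k ∈ S.points k := ⟨_, Or.inl rfl, originIdeal k, inferInstance, rfl⟩
  unfold Surface.properIntersection
  rw [finsum_eq_single _ (originPoint k)]
  · rw [finsum_eq_if, if_pos ⟨hO, hpS⟩]
    set I := S.idealAt (fun E => (B E : ℤ)) (originPoint k) ⊔
      S.idealAt (curveDivisor (zeroSection k)) (originPoint k) with hI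
    have hfin : Module.length (originPoint k).toSubring ((originPoint k).toSubring ⧸ I) ≠ ⊤ := by
      -- The ideal contains `x ^ M` from the multiple fibre and `y` from the section.
      refine length_quotient_ne_top maximalIdeal_originPoint_le (M := M) ?_ ?_
      · refine Ideal.mem_sup_left (Ideal.subset_span (Or.inr fun E hE _ => ?_))
        change (B E : ℤ) ≤ E.ord (x k ^ M)
        rw [E.ord_pow]
        by_cases hEF : E = zeroFibre k
        · rw [hEF, hBF, zeroFibre_ord_x, mul_one]
        · rename_i hpass
          have : B E = 0 := by simp [hB, Ne.symm hEF]
          rw [this]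
          have hx : 0 ≤ E.ord (x k) := E.ord_nonneg (hpass (mem_originPoint _))
          positivity
      · refine Ideal.mem_sup_right (Ideal.subset_span (Or.inr fun E hE hpass => ?_))
        change curveDivisor (zeroSection k) E ≤ E.ord (y k)
        by_cases hEF : E = zeroSection k
        · rw [hEF, curveDivisor_self, zeroSection_ord_y]
        · rw [curveDivisor_of_ne hEF]
          exact E.ord_nonneg (hpass (mem_originPoint _))
    have hne : I ≠ ⊤ := by
      intro h
      have hle : I ≤ IsLocalRing.maximalIdeal (originPoint k).toSubring :=
        sup_le (idealAt_le_maximalIdeal hF hpF (by rw [hBF]; exact_mod_cast hM))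
          (idealAt_le_maximalIdeal hS hpS (by rw [curveDivisor_self]; exact one_pos))
      rw [h, top_le_iff] at hle
      exact (IsLocalRing.maximalIdeal.isMaximal _).ne_top hle
    have : Nontrivial ((originPoint k).toSubring ⧸ I) := Ideal.Quotient.nontrivial_iff.2 hne
    have hpos := Module.length_pos (R := (originPoint k).toSubring)
      (M := (originPoint k).toSubring ⧸ I)
    refine Nat.pos_of_ne_zero fun h0 => ?_
    rcases ENat.toNat_eq_zero.1 h0 with h | h
    · exact hpos.ne' h
    · exact hfin h
  · intro R hR
    rw [finsum_eq_if]
    split_ifs with hRS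
    · have hnp : ¬ Passes (zeroFibre k) R := fun h => hR (eq_originPoint hRS.1 hRS.2 h)
      have h : S.idealAt (fun E => (B E : ℤ)) R = ⊤ :=
        (Ideal.eq_top_iff_one _).2 (Ideal.subset_span (Or.inr fun E _ hpass => by
          have hEF : E ≠ zeroFibre k := by rintro rfl; exact hnp hpass
          simp [hB, Ne.symm hEF]))
      have : Subsingleton (R.toSubring ⧸ (S.idealAt (fun E => (B E : ℤ)) R ⊔
          S.idealAt (curveDivisor (zeroSection k)) R)) := by
        rw [Ideal.Quotient.subsingleton_iff, h, top_sup_eq]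
      rw [Module.length_eq_zero]
      rfl
    · rfl

/-- The divisor `αK + 2C` is equivalent to `(2β - (a + 2)α)f`. Were the coefficient negative, the
divisor would have negative intersection with `C₀`, because `f` meets `C₀`. -/
theorem class_nonneg_of_isNef {a : ℕ} {C : DivisorialValuation k} {α β : ℤ} (hα : 0 < α)
    (hC : (Surface.hirzebruch a).HasClass C α β)
    (hnef : (Surface.hirzebruch a).IsNef (logDivisor C (2 / α))) : 0 ≤ 2 * β - (a + 2) * α := by
  classical
  by_contra! hneg
  set N : ℕ := α.toNat with hN
  have hNα : (N : ℤ) = α := by lia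
  have hNα' : (N : ℚ) = α := by exact_mod_cast hNα
  set M : ℕ := ((a + 2) * α - 2 * β).toNat with hM
  have hMα : (M : ℤ) = (a + 2) * α - 2 * β := by lia
  obtain ⟨H, hH0, hH⟩ := hirzebruch_logDivisor hC N 2
  have h := hnef N (fun E => N * canonicalDivisor E + (2 : ℕ) * curveDivisor C E) (by lia)
    (fun E _ => by
      have hα0 : (α : ℚ) ≠ 0 := by exact_mod_cast hα.ne'
      simp only [logDivisor, hNα']
      push_cast
      rw [hNα']
      field_simp)
    (zeroSection k) (Surface.isPrimeDivisor_standard _ _ _) _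
    -- The divisor is presented as the difference of zero and `M` copies of the fibre `x = 0`,
    -- neither of which contains `C₀`.
    ⟨0, Finsupp.single (zeroFibre k) M, by simp, by
      simp [zeroFibre_ne_zeroSection],
      ⟨H, hH0, fun E hE => ?_⟩, rfl⟩
  · rw [properIntersection_zero] at h
    have := properIntersection_fibre_pos (k := k) a (M := M) (by lia)
    lia
  · have hfib : ((Finsupp.single (zeroFibre k) M E : ℕ) : ℤ) = M * fibreDivisor k E := by
      rw [← hE.curveDivisor_zeroFibre]
      by_cases hEF : E = zeroFibre k
      · rw [hEF, curveDivisor_self]; simp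
      · rw [curveDivisor_of_ne hEF]; simp [Ne.symm hEF]
    have := hH E hE
    dsimp only
    rw [this, hfib, hMα, hNα]
    simp
    ring

/-! ### Projective changes of coordinates -/

/-- `R` is a localization of `A` at a prime ideal. -/
def IsLocAt {K : Type*} [Field K] (A : Subring K) (R : LocalSubring K) : Prop :=
  A ≤ R.toSubring ∧ ∀ z ∈ R.toSubring, ∃ a ∈ A, ∃ b ∈ A, b ≠ 0 ∧ b⁻¹ ∈ R.toSubring ∧ z = a / b

theorem isLocAt_iff {K : Type*} [Field K] {A : Subring K} {R : LocalSubring K} :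
    (∃ (P : Ideal A) (_ : P.IsPrime), R = LocalSubring.ofPrime A P) ↔ IsLocAt A R := by
  constructor
  · rintro ⟨P, hP, rfl⟩
    refine ⟨LocalSubring.le_ofPrime A P, fun z hz => ?_⟩
    obtain ⟨a, b, hb, rfl⟩ := mem_ofPrime.1 hz
    exact ⟨a, a.2, b, b.2, fun h0 => hb (by
      rw [show b = 0 from Subtype.ext h0]; exact P.zero_mem), mem_ofPrime.2 ⟨1, b, hb, by simp⟩, rfl⟩
  · rintro ⟨hle, h⟩
    refine ⟨centreIdeal A R hle, inferInstance, LocalSubring.toSubring_injective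
      (le_antisymm (fun z hz => ?_) (ofPrime_centreIdeal_le A R hle).1)⟩
    obtain ⟨a, ha, b, hb, hb0, hbi, rfl⟩ := h z hz
    exact mem_ofPrime.2 ⟨⟨a, ha⟩, ⟨b, hb⟩, notMem_centreIdeal.2 ⟨hb0, hbi⟩, rfl⟩

theorem Surface.mem_points_iff {S : Surface} {R : LocalSubring (FunField k)} :
    R ∈ S.points k ↔ ∃ A ∈ S.charts k, IsLocAt A.toSubring R := by
  constructor
  · rintro ⟨A, hA, h⟩
    exact ⟨A, hA, isLocAt_iff.1 h⟩
  · rintro ⟨A, hA, h⟩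
    exact ⟨A, hA, isLocAt_iff.2 h⟩

theorem mem_map_aut {R : LocalSubring (FunField k)} {φ : FunField k ≃ₐ[k] FunField k}
    {z : FunField k} :
    z ∈ (R.map (φ : FunField k →+* FunField k)).toSubring ↔ φ.symm z ∈ R.toSubring := by
  constructor
  · rintro ⟨w, hw, rfl⟩
    have : φ.symm ((φ : FunField k →+* FunField k) w) = w := φ.symm_apply_apply w
    rw [this]; exact hw
  · intro h
    exact ⟨_, h, φ.apply_symm_apply z⟩

/-- The affine chart `l i ≠ 0` for the homogeneous coordinates `l`. -/
def projChart (l : Fin 3 → FunField k) (i : Fin 3) : Subalgebra k (FunField k) :=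
  Algebra.adjoin k (Set.range fun j => l j / l i)

/-- The points of the projective plane with homogeneous coordinates `l`. -/
def projPoints (l : Fin 3 → FunField k) : Set (LocalSubring (FunField k)) :=
  {R | ∃ i, l i ≠ 0 ∧ IsLocAt (projChart l i).toSubring R}

theorem div_mem_projChart (l : Fin 3 → FunField k) (i j : Fin 3) : l j / l i ∈ projChart l i :=
  Algebra.subset_adjoin ⟨j, rfl⟩

theorem span_div_mem_projChart {l : Fin 3 → FunField k} (i : Fin 3) {z : FunField k}
    (hz : z ∈ Submodule.span k (Set.range l)) : z / l i ∈ projChart l i := by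
  induction hz using Submodule.span_induction with
  | mem z hz =>
    obtain ⟨j, rfl⟩ := hz
    exact div_mem_projChart l i j
  | zero => rw [zero_div]; exact zero_mem _
  | add z w _ _ hz hw => rw [add_div]; exact add_mem hz hw
  | smul c z _ hz => rw [smul_div_assoc]; exact Subalgebra.smul_mem _ hz c

/-- At a point where `l i` is a local generator, all `m j / l i` are regular. They cannot all be
non-units, since `1 = l i / l i` is a linear combination of them, so some chart of `m` contains the
point. -/
theorem projPoints_subset {l m : Fin 3 → FunField k}
    (h : Submodule.span k (Set.range l) = Submodule.span k (Set.range m)) :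
    projPoints l ⊆ projPoints m := by
  rintro R ⟨i, hi, hle, hR⟩
  have hm : ∀ j, m j / l i ∈ R.toSubring := fun j =>
    hle (span_div_mem_projChart i (h ▸ Submodule.subset_span ⟨j, rfl⟩))
  -- one of the new coordinates does not vanish at the point
  obtain ⟨j, hj0, hj⟩ : ∃ j, m j ≠ 0 ∧ l i / m j ∈ R.toSubring := by
    by_contra! hc
    have hnon : ∀ j, (⟨m j / l i, hm j⟩ : R.toSubring) ∈ IsLocalRing.maximalIdeal R.toSubring := by
      intro j
      rw [IsLocalRing.mem_maximalIdeal, mem_nonunits_iff, isUnit_subring_iff]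
      rintro ⟨h0, hinv⟩
      have hj0 : m j ≠ 0 := fun h => h0 (by change m j / l i = 0; rw [h, zero_div])
      exact hc j hj0 (by rwa [inv_div] at hinv)
    have hkR : ∀ c : k, algebraMap k (FunField k) c ∈ R.toSubring := fun c =>
      hle ((projChart l i).algebraMap_mem c)
    have key : ∀ z ∈ Submodule.span k (Set.range m), ∃ hz : z / l i ∈ R.toSubring,
        (⟨z / l i, hz⟩ : R.toSubring) ∈ IsLocalRing.maximalIdeal R.toSubring := by
      intro z hz
      induction hz using Submodule.span_induction with
      | mem z hz =>
        obtain ⟨j, rfl⟩ := hz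
        exact ⟨_, hnon j⟩
      | zero =>
        refine ⟨by rw [zero_div]; exact zero_mem _, ?_⟩
        convert Ideal.zero_mem _
        simp
      | add z w _ _ hz hw =>
        obtain ⟨hz, hz'⟩ := hz
        obtain ⟨hw, hw'⟩ := hw
        refine ⟨by rw [add_div]; exact add_mem hz hw, ?_⟩
        convert Ideal.add_mem _ hz' hw'
        simp [add_div]
      | smul c z _ hz =>
        obtain ⟨hz, hz'⟩ := hz
        refine ⟨by rw [smul_div_assoc, Algebra.smul_def]; exact mul_mem (hkR c) hz, ?_⟩
        convert Ideal.mul_mem_left _ ⟨_, hkR c⟩ hz'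
        simp [Algebra.smul_def, mul_div_assoc]
    obtain ⟨h1, h2⟩ := key (l i) (h ▸ Submodule.subset_span ⟨i, rfl⟩)
    refine (IsLocalRing.maximalIdeal.isMaximal R.toSubring).ne_top
      ((Ideal.eq_top_iff_one _).2 ?_)
    convert h2
    simp [hi]
  -- Functions on the old chart are fractions over the new one, with denominators built from `l i /
  -- m j`, which is invertible at the point.
  have hfrac : ∀ a ∈ projChart l i, ∃ b ∈ projChart m j, ∃ c ∈ projChart m j,
      c ≠ 0 ∧ c⁻¹ ∈ R.toSubring ∧ a = b / c := by
    intro a ha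
    induction ha using Algebra.adjoin_induction with
    | mem a ha =>
      obtain ⟨s, rfl⟩ := ha
      have hspan : ∀ s, l s / m j ∈ projChart m j := fun s =>
        span_div_mem_projChart j (h ▸ Submodule.subset_span ⟨s, rfl⟩)
      refine ⟨_, hspan s, _, hspan i, div_ne_zero hi hj0, by rw [inv_div]; exact hm j, ?_⟩
      field_simp
    | algebraMap c => exact ⟨_, Subalgebra.algebraMap_mem _ c, 1, one_mem _, one_ne_zero,
        by rw [inv_one]; exact one_mem _, by simp⟩
    | add a a' _ _ h h' =>
      obtain ⟨b, hb, c, hc, hc0, hci, rfl⟩ := h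
      obtain ⟨b', hb', c', hc', hc0', hci', rfl⟩ := h'
      exact ⟨b * c' + c * b', add_mem (mul_mem hb hc') (mul_mem hc hb'), c * c', mul_mem hc hc',
        mul_ne_zero hc0 hc0', by rw [mul_inv]; exact mul_mem hci hci', div_add_div _ _ hc0 hc0'⟩
    | mul a a' _ _ h h' =>
      obtain ⟨b, hb, c, hc, hc0, hci, rfl⟩ := h
      obtain ⟨b', hb', c', hc', hc0', hci', rfl⟩ := h'
      exact ⟨b * b', mul_mem hb hb', c * c', mul_mem hc hc',
        mul_ne_zero hc0 hc0', by rw [mul_inv]; exact mul_mem hci hci', div_mul_div_comm _ _ _ _⟩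
  refine ⟨j, hj0, ?_, fun z hz => ?_⟩
  · have hk : ∀ c, algebraMap k (FunField k) c ∈ R.toSubring := fun c =>
      hle ((projChart l i).algebraMap_mem c)
    have : projChart m j ≤ { R.toSubring with algebraMap_mem' := hk } := by
      refine Algebra.adjoin_le ?_
      rintro _ ⟨s, rfl⟩
      have := mul_mem (hm s) hj
      rwa [div_mul_div_cancel₀ hi] at this
    exact fun z hz => this hz
  · obtain ⟨a, ha, b, hb, hb0, hbi, rfl⟩ := hR z hz
    obtain ⟨a', ha', c, hc, hc0, hci, rfl⟩ := hfrac a ha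
    obtain ⟨b', hb', d, hd, hd0, hdi, rfl⟩ := hfrac b hb
    have hb0' : b' ≠ 0 := fun h => hb0 (by rw [h, zero_div])
    refine ⟨a' * d, mul_mem ha' hd, c * b', mul_mem hc hb', mul_ne_zero hc0 hb0', ?_,
      div_div_div_eq _ _ _ _⟩
    have h1 := mul_mem (mul_mem hbi hdi) hci
    convert h1 using 1
    field_simp

theorem projPoints_congr {l m : Fin 3 → FunField k}
    (h : Submodule.span k (Set.range l) = Submodule.span k (Set.range m)) :
    projPoints l = projPoints m :=
  Set.Subset.antisymm (projPoints_subset h) (projPoints_subset h.symm)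

theorem projPoints_mul {p : FunField k} (hp : p ≠ 0) (l : Fin 3 → FunField k) :
    projPoints (fun i => p * l i) = projPoints l := by
  have : ∀ i, projChart (fun i => p * l i) i = projChart l i := fun i => by
    simp [projChart, mul_div_mul_left _ _ hp]
  ext R
  simp [projPoints, this, hp]

theorem map_mem_projPoints (φ : FunField k ≃ₐ[k] FunField k) {l : Fin 3 → FunField k}
    {R : LocalSubring (FunField k)} (hR : R ∈ projPoints l) :
    R.map (φ : FunField k →+* FunField k) ∈ projPoints (fun i => φ (l i)) := by
  obtain ⟨i, hi, hle, hR⟩ := hR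
  have hchart : ∀ z ∈ projChart l i, φ z ∈ projChart (fun i => φ (l i)) i := by
    intro z hz
    have : (projChart l i).map (φ : FunField k →ₐ[k] FunField k) =
        projChart (fun i => φ (l i)) i := by
      rw [projChart, AlgHom.map_adjoin, projChart, ← Set.range_comp]
      congr 2
      ext j
      simp
    rw [← this]
    exact ⟨z, hz, rfl⟩
  have hchart' : ∀ z ∈ projChart (fun i => φ (l i)) i, φ.symm z ∈ projChart l i := by
    intro z hz
    have : (projChart (fun i => φ (l i)) i).map (φ.symm : FunField k →ₐ[k] FunField k) =
        projChart l i := by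
      rw [projChart, AlgHom.map_adjoin, projChart, ← Set.range_comp]
      congr 2
      ext j
      simp
    rw [← this]
    exact ⟨z, hz, rfl⟩
  refine ⟨i, by simpa using hi, fun z hz => ?_, fun z hz => ?_⟩
  · rw [mem_map_aut]
    exact hle (hchart' z hz)
  · rw [mem_map_aut] at hz
    obtain ⟨a, ha, b, hb, hb0, hbi, h⟩ := hR _ hz
    refine ⟨φ a, hchart a ha, φ b, hchart b hb, by simpa using hb0, ?_, ?_⟩
    · rw [mem_map_aut]; simpa using hbi
    · rw [← map_div₀, ← h, AlgEquiv.apply_symm_apply]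

theorem plane_points_eq : Surface.plane.points k = projPoints ![1, x k, y k] := by
  have hx := x_ne_zero (k := k)
  have hy := y_ne_zero (k := k)
  have adj : ∀ (s : Set (FunField k)) (u v : FunField k), s ⊆ {1, u, v} → {u, v} ⊆ s →
      Algebra.adjoin k s = Algebra.adjoin k {u, v} := by
    intro s u v h1 h2
    refine le_antisymm (Algebra.adjoin_le fun z hz => ?_) (Algebra.adjoin_mono h2)
    rcases h1 hz with rfl | rfl | rfl
    · exact one_mem _
    · exact fst_mem_algebra _ _
    · exact snd_mem_algebra _ _
  have c0 : projChart ![1, x k, y k] 0 = Algebra.adjoin k {x k, y k} := by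
    refine adj _ _ _ ?_ ?_
    · rintro _ ⟨j, rfl⟩
      fin_cases j <;> simp
    · rintro _ (rfl | rfl)
      · exact ⟨1, by simp⟩
      · exact ⟨2, by simp⟩
  have c1 : projChart ![1, x k, y k] 1 = Algebra.adjoin k {(x k)⁻¹, y k / x k} := by
    refine adj _ _ _ ?_ ?_
    · rintro _ ⟨j, rfl⟩
      fin_cases j <;> simp [hx]
    · rintro _ (rfl | rfl)
      · exact ⟨0, by simp⟩
      · exact ⟨2, by simp⟩
  have c2 : projChart ![1, x k, y k] 2 = Algebra.adjoin k {(y k)⁻¹, x k / y k} := by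
    refine adj _ _ _ ?_ ?_
    · rintro _ ⟨j, rfl⟩
      fin_cases j <;> simp [hy]
    · rintro _ (rfl | rfl)
      · exact ⟨0, by simp⟩
      · exact ⟨1, by simp⟩
  ext R
  rw [Surface.mem_points_iff]
  constructor
  · rintro ⟨A, rfl | rfl | rfl, h⟩
    · exact ⟨0, by simp, by rwa [c0]⟩
    · exact ⟨1, by simpa using hx, by rwa [c1]⟩
    · exact ⟨2, by simpa using hy, by rwa [c2]⟩
  · rintro ⟨i, -, h⟩
    fin_cases i
    · exact ⟨_, Or.inl rfl, by rwa [← c0]⟩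
    · exact ⟨_, Or.inr (Or.inl rfl), by rwa [← c1]⟩
    · exact ⟨_, Or.inr (Or.inr rfl), by rwa [← c2]⟩

theorem range_vec3 (u v w : FunField k) : Set.range ![u, v, w] = {u, v, w} := by
  ext z
  simp only [Set.mem_range, Fin.exists_fin_succ, Set.mem_insert_iff, Set.mem_singleton_iff]
  simp [eq_comm]

/-- An automorphism given by a projective change of coordinates is biregular. -/
theorem isBiregular_plane {φ : FunField k ≃ₐ[k] FunField k} {p : FunField k} (hp : p ≠ 0)
    (h : Submodule.span k {p, p * φ (x k), p * φ (y k)} = Submodule.span k {1, x k, y k}) :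
    IsBiregular .plane .plane φ := by
  -- Homogeneous coordinates matter only up to the common factor `p`, and only through the linear
  -- system they span.
  have key : projPoints (fun i => φ (![1, x k, y k] i)) = projPoints ![1, x k, y k] := by
    rw [← projPoints_mul hp]
    refine projPoints_congr ?_
    rw [range_vec3, ← h, ← range_vec3]
    congr 2
    ext i
    fin_cases i <;> simp
  intro R
  rw [plane_points_eq]
  constructor
  · intro hR
    rw [← key]
    exact map_mem_projPoints φ hR
  · intro hR
    rw [← key] at hR
    have h1 := map_mem_projPoints φ.symm hR
    have h2 : (R.map (φ : FunField k →+* FunField k)).map (φ.symm : FunField k →+* FunField k) =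
        R := by
      refine LocalSubring.toSubring_injective ?_
      ext z
      rw [mem_map_aut, mem_map_aut]
      simp
    rw [h2] at h1
    simpa using h1

theorem IsBiregular.symm {S S' : Surface} {φ : FunField k ≃ₐ[k] FunField k}
    (h : IsBiregular S S' φ) : IsBiregular S' S φ.symm := by
  intro R
  rw [h]
  have h2 : (R.map (φ.symm : FunField k →+* FunField k)).map (φ : FunField k →+* FunField k) =
      R := by
    refine LocalSubring.toSubring_injective ?_
    ext z
    rw [mem_map_aut, mem_map_aut]
    simp
  rw [h2]

theorem IsBiregular.trans {S S' S'' : Surface} {φ ψ : FunField k ≃ₐ[k] FunField k}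
    (h : IsBiregular S S' φ) (h' : IsBiregular S' S'' ψ) : IsBiregular S S'' (ψ.trans φ) := by
  intro R
  rw [h', h]
  have h2 : (R.map (ψ : FunField k →+* FunField k)).map (φ : FunField k →+* FunField k) =
      R.map ((ψ.trans φ : FunField k ≃ₐ[k] FunField k) : FunField k →+* FunField k) := by
    refine LocalSubring.toSubring_injective ?_
    ext z
    rw [mem_map_aut, mem_map_aut, mem_map_aut]
    simp
  rw [h2]

theorem IsBiregular.isPrimeDivisor_iff {S S' : Surface} {φ : FunField k ≃ₐ[k] FunField k}
    (h : IsBiregular S S' φ) (E : DivisorialValuation k) :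
    S'.IsPrimeDivisor (E.comap φ) ↔ S.IsPrimeDivisor E := by
  unfold Surface.IsPrimeDivisor
  rw [h]
  have h2 : (E.comap φ).ring.toLocalSubring.map (φ : FunField k →+* FunField k) =
      E.ring.toLocalSubring := by
    refine LocalSubring.toSubring_injective ?_
    ext z
    rw [mem_map_aut]
    change φ (φ.symm z) ∈ E.ring ↔ z ∈ E.ring
    rw [AlgEquiv.apply_symm_apply]
  rw [h2]

/-! ### Curves on the plane -/

theorem curveDivisor_nonneg (C E : DivisorialValuation k) : 0 ≤ curveDivisor C E := by
  unfold curveDivisor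
  split_ifs <;> norm_num

theorem lineDivisor_eq {E : DivisorialValuation k} (hE : Surface.plane.IsPrimeDivisor E) :
    lineDivisor k E = curveDivisor (lineCurve k) E := by
  rcases plane_isPrimeDivisor_cases hE with h | rfl
  · rw [Surface.IsPrimeDivisor.lineDivisor_eq_zero h, curveDivisor_of_ne]
    rintro rfl
    exact not_meetsStandard_lineCurve h
  · rw [lineDivisor_lineCurve, curveDivisor_self]

/-- A curve on the plane is linearly equivalent to a nonnegative multiple of the line. -/
theorem plane_exists_degree {C : DivisorialValuation k} (hC : Surface.plane.IsPrimeDivisor C) :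
    ∃ d : ℤ, 0 ≤ d ∧ ∃ g : FunField k, g ≠ 0 ∧ ∀ E, Surface.plane.IsPrimeDivisor E →
      curveDivisor C E = d * curveDivisor (lineCurve k) E + E.ord g := by
  obtain ⟨g, hg, hord⟩ := Surface.plane.exists_chart_equation hC Surface.plane.standard_mem_charts
  rw [coordChart_refl] at hord
  obtain ⟨q, rfl⟩ := Surface.plane.exists_poly fun E hE hs => (curveDivisor_nonneg C E).trans
    (hord E hE hs).ge
  have hq : q ≠ 0 := by rintro rfl; simp at hg
  refine ⟨curveDivisor C (lineCurve k) - (lineCurve k).ord (polyEmb k q), ?_, polyEmb k q, hg,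
    fun E hE => ?_⟩
  · have := curveDivisor_nonneg C (lineCurve k)
    rw [lineCurve_ord_polyEmb hq]
    lia
  · rcases plane_isPrimeDivisor_cases hE with h | rfl
    · rw [hord E hE h, ← lineDivisor_eq hE, Surface.IsPrimeDivisor.lineDivisor_eq_zero h]
      ring
    · rw [curveDivisor_self]
      ring

/-- The homogeneous coordinates of the plane are the sections of the line. -/
theorem mem_span_of_ord {z : FunField k} (h : ∀ E, Surface.plane.IsPrimeDivisor E →
    -curveDivisor (lineCurve k) E ≤ E.ord z) : z ∈ Submodule.span k {1, x k, y k} := by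
  obtain ⟨q, rfl⟩ := Surface.plane.exists_poly (z := z) fun E hE hs => by
    have := h E hE
    rwa [← lineDivisor_eq hE, Surface.IsPrimeDivisor.lineDivisor_eq_zero hs, neg_zero] at this
  refine mem_span_of_lineCurve_ord ?_
  have := h _ isPrimeDivisor_lineCurve
  rwa [curveDivisor_self] at this

theorem le_ord_x_y {E : DivisorialValuation k} (hE : Surface.plane.IsPrimeDivisor E) :
    -curveDivisor (lineCurve k) E ≤ E.ord (x k) ∧ -curveDivisor (lineCurve k) E ≤ E.ord (y k) := by
  rcases plane_isPrimeDivisor_cases hE with h | rfl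
  · rw [← lineDivisor_eq hE, Surface.IsPrimeDivisor.lineDivisor_eq_zero h, neg_zero]
    exact meetsStandard_iff.1 h
  · rw [curveDivisor_self, lineCurve_ord_x, lineCurve_ord_y]
    exact ⟨le_rfl, le_rfl⟩

/-- A nonzero multiple of the line is not principal. -/
theorem plane_class_independent {m : ℤ} {g : FunField k}
    (h : ∀ E, Surface.plane.IsPrimeDivisor E → m * curveDivisor (lineCurve k) E = E.ord g) :
    m = 0 := by
  have h1 := h _ isPrimeDivisor_lineCurve
  rw [curveDivisor_self, mul_one] at h1
  rcases le_total 0 m with hm | hm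
  · obtain ⟨c, rfl⟩ := plane_isConst (z := g) fun E hE => by
      rw [← h E hE]; exact mul_nonneg hm (curveDivisor_nonneg _ _)
    rw [h1, DivisorialValuation.ord_algebraMap]
  · obtain ⟨c, hc⟩ := plane_isConst (z := g⁻¹) fun E hE => by
      rw [DivisorialValuation.ord_inv, ← h E hE]
      nlinarith [curveDivisor_nonneg (lineCurve k) E]
    rw [← inv_inv g, hc, DivisorialValuation.ord_inv, DivisorialValuation.ord_algebraMap] at h1
    lia

/-- A birational map of the plane to itself that contracts no curve in either direction
is a projective transformation. -/
theorem isBiregular_plane_of_isPrimeDivisor {φ : FunField k ≃ₐ[k] FunField k}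
    (h : ∀ E, Surface.plane.IsPrimeDivisor E ↔ Surface.plane.IsPrimeDivisor (E.comap φ)) :
    IsBiregular .plane .plane φ := by
  set L := lineCurve k
  have hL : Surface.plane.IsPrimeDivisor L := isPrimeDivisor_lineCurve
  have hLL : (L.comap φ.symm).comap φ = L := L.comap_symm_comap φ
  obtain ⟨d, hd, g, hg, hgE⟩ := plane_exists_degree (C := L.comap φ.symm)
    ((h _).2 (by rwa [hLL]))
  obtain ⟨e, he, f, hf, hfE⟩ := plane_exists_degree (C := L.comap φ) ((h _).1 hL)
  have hpull : ∀ E : DivisorialValuation k,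
      curveDivisor L (E.comap φ) = curveDivisor (L.comap φ.symm) E := fun E => by
    rw [← curveDivisor_comap (L.comap φ.symm) E φ, hLL]
  have hφf : φ f ≠ 0 := by simpa using hf
  -- Push-forward along the two directions multiplies the class of the line by `e` and `d`;
  -- composing them gives the identity on a class of infinite order.
  have hde : d * e = 1 := by
    have := plane_class_independent (k := k) (m := 1 - d * e) (g := g ^ e * φ f) fun E hE => by
      have h1 := hfE _ ((h E).1 hE)
      rw [curveDivisor_comap, hpull, hgE E hE, DivisorialValuation.ord_comap] at h1
      rw [E.ord_mul (zpow_ne_zero _ hg) hφf, E.ord_zpow]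
      linear_combination h1
    lia
  have hd1 : d = 1 := Int.eq_one_of_mul_eq_one_right hd hde
  subst hd1
  -- Since the pull-back of the line is again equivalent to the line, `z ↦ g * φ z` maps the linear
  -- forms to linear forms.
  have hgW : ∀ z, z ≠ 0 → (∀ E, Surface.plane.IsPrimeDivisor E → -curveDivisor L E ≤ E.ord z) →
      g * φ z ∈ Submodule.span k {1, x k, y k} := by
    intro z hz hzE
    refine mem_span_of_ord fun E hE => ?_
    have h1 := hgE E hE
    have h2 := hzE _ ((h E).1 hE)
    rw [hpull, DivisorialValuation.ord_comap] at h2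
    rw [E.ord_mul hg (by simpa using hz)]
    change -curveDivisor L E ≤ _
    linarith
  let T : FunField k →ₗ[k] FunField k := (LinearMap.mulLeft k g).comp φ.toLinearMap
  have hT : Function.Injective T := (mul_right_injective₀ hg).comp φ.injective
  have hmap : (Submodule.span k {1, x k, y k}).map T =
      Submodule.span k {g, g * φ (x k), g * φ (y k)} := by
    rw [Submodule.map_span]
    congr 1
    simp [Set.image_insert_eq, T]
  have : FiniteDimensional k (Submodule.span k {1, x k, y k}) :=
    FiniteDimensional.span_of_finite k (by simp)
  refine isBiregular_plane hg ?_
  rw [← hmap]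
  -- The map is injective on a finite-dimensional space, so inclusion of the image already gives
  -- equality.
  refine Submodule.eq_of_le_of_finrank_eq ?_
    (Submodule.equivMapOfInjective T hT _).symm.finrank_eq
  rw [hmap, Submodule.span_le]
  rintro _ (rfl | rfl | rfl)
  · simpa using hgW 1 one_ne_zero fun E _ => by
      rw [DivisorialValuation.ord_one]; simpa using curveDivisor_nonneg L E
  · exact hgW _ x_ne_zero fun E hE => (le_ord_x_y hE).1
  · exact hgW _ y_ne_zero fun E hE => (le_ord_x_y hE).2

/-- Every line can be moved to the line at infinity. -/
theorem exists_isBiregular_line {C : DivisorialValuation k} (hC : Surface.plane.IsPrimeDivisor C)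
    (hline : Surface.plane.LinEquiv (curveDivisor C) (lineDivisor k)) :
    ∃ φ : FunField k ≃ₐ[k] FunField k, IsPairMap C (lineCurve k) φ ∧
      IsBiregular .plane .plane φ := by
  rcases plane_isPrimeDivisor_cases hC with hs | rfl
  swap
  · refine ⟨AlgEquiv.refl, ?_, isBiregular_plane one_ne_zero (by simp)⟩
    ext g
    rfl
  obtain ⟨p, hp, hpE⟩ := hline
  have hpC := hpE C hC
  rw [curveDivisor_self, Surface.IsPrimeDivisor.lineDivisor_eq_zero hs, zero_add] at hpC
  have hpW : p ∈ Submodule.span k {1, x k, y k} := mem_span_of_ord fun E hE => by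
    have h1 := hpE E hE
    have h2 := curveDivisor_nonneg C E
    rw [lineDivisor_eq hE] at h1
    linarith
  -- a change of coordinates with first coordinate `1 / p`
  have key : ∀ v : FunField k, x k ∈ Submodule.span k {1, p, v} → y k ∈ Submodule.span k {1, p, v} →
      v ∈ Submodule.span k {1, x k, y k} →
      ∃ φ : FunField k ≃ₐ[k] FunField k, IsPairMap C (lineCurve k) φ ∧
        IsBiregular .plane .plane φ := by
    intro v hx hy hv
    have hfield : ∀ z ∈ Submodule.span k {1, p, v},
        z ∈ IntermediateField.adjoin k {p⁻¹, v / p} := by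
      intro z hz
      have h1 : p ∈ IntermediateField.adjoin k {p⁻¹, v / p} := by
        have := inv_mem (fst_mem_field (k := k) p⁻¹ (v / p))
        rwa [inv_inv] at this
      have h2 : v ∈ IntermediateField.adjoin k {p⁻¹, v / p} := by
        have := mul_mem (snd_mem_field (k := k) p⁻¹ (v / p)) h1
        rwa [div_mul_cancel₀ _ hp] at this
      have : Submodule.span k {1, p, v} ≤
          (IntermediateField.adjoin k {p⁻¹, v / p}).toSubalgebra.toSubmodule := by
        rw [Submodule.span_le]
        rintro _ (rfl | rfl | rfl)
        · exact one_mem (IntermediateField.adjoin k {p⁻¹, v / p})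
        · exact h1
        · exact h2
      exact this hz
    obtain ⟨φ, hφx, hφy⟩ := exists_coordinateAut (hfield _ hx) (hfield _ hy)
    have hbi : IsBiregular .plane .plane φ := by
      refine isBiregular_plane hp ?_
      rw [hφx, hφy, mul_inv_cancel₀ hp, mul_div_cancel₀ _ hp]
      apply le_antisymm <;> rw [Submodule.span_le]
      · rintro _ (rfl | rfl | rfl)
        · exact hpW
        · exact Submodule.subset_span (by simp)
        · exact hv
      · rw [Set.insert_comm p 1]
        rintro _ (rfl | rfl | rfl)
        · exact Submodule.subset_span (by simp)
        · exact hx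
        · exact hy
    refine ⟨φ, ?_, hbi⟩
    rw [isPairMap_iff]
    -- The image of `C` is a curve along which `x` has a pole, because `x` pulls back to `1 / p` and
    -- `p` vanishes on `C`; only the line at infinity has this property.
    refine (plane_isPrimeDivisor_cases ((hbi.isPrimeDivisor_iff C).2 hC)).resolve_left fun hm => ?_
    have := (meetsStandard_iff.1 hm).1
    rw [DivisorialValuation.ord_comap, hφx, DivisorialValuation.ord_inv, ← hpC] at this
    lia
  obtain ⟨a, b, c, habc⟩ := Submodule.mem_span_triple.1 hpW
  have h1 : ∀ v : FunField k, (1 : FunField k) ∈ Submodule.span k {1, p, v} := fun v =>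
    Submodule.subset_span (by simp)
  have h2 : ∀ v : FunField k, p ∈ Submodule.span k {1, p, v} := fun v =>
    Submodule.subset_span (by simp)
  have h3 : ∀ v : FunField k, v ∈ Submodule.span k {1, p, v} := fun v =>
    Submodule.subset_span (by simp)
  -- The third coordinate is whichever of `x`, `y` completes `1, p` to a basis of the linear forms.
  -- The form `p` is not constant, as it has order one along `C`.
  by_cases hb : b = 0
  · by_cases hc : c = 0
    · exfalso
      rw [hb, hc, zero_smul, zero_smul, add_zero, add_zero, ← Algebra.algebraMap_eq_smul_one] at habc
      rw [← habc, DivisorialValuation.ord_algebraMap] at hpC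
      lia
    · refine key (x k) (h3 _) ?_ (Submodule.subset_span (by simp))
      have : y k = c⁻¹ • (p - a • 1 - b • x k) := by
        rw [← habc, sub_sub, add_sub_cancel_left, smul_smul, inv_mul_cancel₀ hc, one_smul]
      rw [this]
      exact Submodule.smul_mem _ _ (sub_mem (sub_mem (h2 _) (Submodule.smul_mem _ _ (h1 _)))
        (Submodule.smul_mem _ _ (h3 _)))
  · refine key (y k) ?_ (h3 _) (Submodule.subset_span (by simp))
    have : x k = b⁻¹ • (p - a • 1 - c • y k) := by
      rw [← habc, add_sub_right_comm, add_sub_cancel_right, add_sub_cancel_left, smul_smul,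
        inv_mul_cancel₀ hb, one_smul]
    rw [this]
    exact Submodule.smul_mem _ _ (sub_mem (sub_mem (h2 _) (Submodule.smul_mem _ _ (h1 _)))
      (Submodule.smul_mem _ _ (h3 _)))

/-- Any two lines in the plane are projectively equivalent. -/
theorem exists_isBiregular_lines {C C' : DivisorialValuation k}
    (hC : Surface.plane.IsPrimeDivisor C)
    (hline : Surface.plane.LinEquiv (curveDivisor C) (lineDivisor k))
    (hC' : Surface.plane.IsPrimeDivisor C')
    (hline' : Surface.plane.LinEquiv (curveDivisor C') (lineDivisor k)) :
    ∃ φ : FunField k ≃ₐ[k] FunField k, IsPairMap C C' φ ∧ IsBiregular .plane .plane φ := by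
  obtain ⟨φ, h, hbi⟩ := exists_isBiregular_line hC hline
  obtain ⟨ψ, h', hbi'⟩ := exists_isBiregular_line hC' hline'
  exact ⟨_, h.trans h'.symm, hbi.trans hbi'.symm⟩

/-! ### The generic fibre of the ruling -/

/-- The field `k(x)` of rational functions on the base. -/
abbrev baseField (k : Type*) [Field k] : IntermediateField k (FunField k) :=
  IntermediateField.adjoin k {x k}

theorem x_mem_baseField : x k ∈ baseField k := IntermediateField.mem_adjoin_simple_self k _

theorem eq_top_of_mem {L : IntermediateField k (FunField k)} (hx : x k ∈ L) (hy : y k ∈ L)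
    (z : FunField k) : z ∈ L := by
  have hpoly : ∀ q, polyEmb k q ∈ L := fun q => by
    have : Algebra.adjoin k {x k, y k} ≤ L.toSubalgebra := Algebra.adjoin_le (by
      rintro _ (rfl | rfl)
      · exact hx
      · exact hy)
    exact this (mem_standardChart.2 ⟨q, rfl⟩)
  obtain ⟨p, q, -, rfl⟩ := IsFractionRing.div_surjective (A := MvPolynomial (Fin 2) k) z
  exact div_mem (hpoly p) (hpoly q)

theorem exists_eq_mul_isCoprime {F : Type*} [Field F] (f : Polynomial F) {g : Polynomial F}
    (hg : g ≠ 0) : ∃ d f' g' : Polynomial F, f = d * f' ∧ g = d * g' ∧ IsCoprime f' g' := by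
  classical
  let _ := EuclideanDomain.gcdMonoid (Polynomial F)
  have hd : gcd f g ≠ 0 := gcd_ne_zero_of_right hg
  exact ⟨gcd f g, f / gcd f g, g / gcd f g,
    (EuclideanDomain.mul_div_cancel' hd (gcd_dvd_left f g)).symm,
    (EuclideanDomain.mul_div_cancel' hd (gcd_dvd_right f g)).symm, isCoprime_div_gcd_div_gcd hg⟩

theorem aeval_mem_of_mem {A : Subalgebra k (FunField k)} {t : FunField k} (ht : t ∈ A)
    (p : Polynomial k) : Polynomial.aeval t p ∈ A :=
  Algebra.adjoin_le (Set.singleton_subset_iff.2 ht) (Polynomial.aeval_mem_adjoin_singleton k t)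

/-- A local ring of a point of the generic fibre is a valuation ring. -/
theorem mem_or_inv_mem {R : LocalSubring (FunField k)}
    (hR : (baseField k).toSubring ≤ R.toSubring) {v : FunField k}
    (hv : v ∈ R.toSubring) (hvy : v = y k ∨ v⁻¹ = y k) (z : FunField k) :
    z ∈ R.toSubring ∨ z⁻¹ ∈ R.toSubring := by
  rcases eq_or_ne z 0 with rfl | hz0
  · exact Or.inl (zero_mem _)
  have hz : z ∈ IntermediateField.adjoin (baseField k) {v} := by
    have hmem := IntermediateField.mem_adjoin_simple_self (baseField k) v
    refine eq_top_of_mem (L := (IntermediateField.adjoin (baseField k) {v}).restrictScalars k)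
      ?_ ?_ z
    · exact (IntermediateField.adjoin (baseField k) {v}).algebraMap_mem ⟨x k, x_mem_baseField⟩
    · rcases hvy with h | h
      · rw [← h]; exact hmem
      · rw [← h]; exact inv_mem hmem
  obtain ⟨f, g, rfl⟩ := (IntermediateField.mem_adjoin_simple_iff _ _).1 hz
  have hR' : ∀ p : Polynomial (baseField k), Polynomial.aeval v p ∈ R.toSubring := by
    intro p
    rw [Polynomial.aeval_eq_sum_range]
    refine sum_mem fun i _ => ?_
    rw [Algebra.smul_def]
    exact mul_mem (hR (p.coeff i).2) (pow_mem hv i)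
  have hg : g ≠ 0 := by rintro rfl; simp at hz0
  obtain ⟨d, f', g', hf', hg', u, w, huw⟩ := exists_eq_mul_isCoprime f hg
  have hdv : Polynomial.aeval v d ≠ 0 := fun h => hz0 (by
    rw [hf', map_mul, h, zero_mul, zero_div])
  have hquot : Polynomial.aeval v f / Polynomial.aeval v g =
      Polynomial.aeval v f' / Polynomial.aeval v g' := by
    conv_lhs => rw [hf', hg']
    rw [map_mul, map_mul, mul_div_mul_left _ _ hdv]
  rw [hquot]
  -- After cancelling a common factor over `k(x)`, the Bézout identity is evaluated at `v`. In a
  -- local ring one of the two summands is a unit, so the numerator or the denominator is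
  -- invertible.
  have hone : (⟨_, hR' u⟩ * ⟨_, hR' f'⟩ + ⟨_, hR' w⟩ * ⟨_, hR' g'⟩ : R.toSubring) = 1 := by
    refine Subtype.ext ?_
    have := congrArg (Polynomial.aeval v) huw
    simpa using this
  rcases IsLocalRing.isUnit_or_isUnit_of_add_one hone with h | h
  · right
    have := (isUnit_subring_iff _).1 (isUnit_of_mul_isUnit_right h)
    rw [inv_div, div_eq_mul_inv]
    exact mul_mem (hR' g') this.2
  · left
    have := (isUnit_subring_iff _).1 (isUnit_of_mul_isUnit_right h)
    rw [div_eq_mul_inv]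
    exact mul_mem (hR' f') this.2

/-- The points of the generic fibre are the valuation rings that contain `k(x)`. -/
theorem mem_points_iff_of_baseField_le {a : ℕ} {R : LocalSubring (FunField k)}
    (hR : (baseField k).toSubring ≤ R.toSubring) :
    R ∈ (Surface.hirzebruch a).points k ↔ ∀ z, z ∈ R.toSubring ∨ z⁻¹ ∈ R.toSubring := by
  have hx := x_ne_zero (k := k)
  have val : ∀ R : LocalSubring (FunField k), (baseField k).toSubring ≤ R.toSubring →
      R ∈ (Surface.hirzebruch a).points k → ∀ z, z ∈ R.toSubring ∨ z⁻¹ ∈ R.toSubring := by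
    intro R hR hmem
    have hxa : x k ^ a ∈ R.toSubring := hR (pow_mem x_mem_baseField a)
    have hxa' : (x k ^ a)⁻¹ ∈ R.toSubring := hR ((baseField k).inv_mem (pow_mem x_mem_baseField a))
    obtain ⟨A, hA, hle, -⟩ := Surface.mem_points_iff.1 hmem
    rcases hA with rfl | rfl | rfl | rfl
    · exact mem_or_inv_mem hR (hle (snd_mem_algebra _ _)) (Or.inl rfl)
    · exact mem_or_inv_mem hR (hle (snd_mem_algebra _ _)) (Or.inr (inv_inv _))
    · have := mul_mem hxa' (hle (snd_mem_algebra _ _))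
      rw [inv_mul_cancel_left₀ (pow_ne_zero _ hx)] at this
      exact mem_or_inv_mem hR this (Or.inl rfl)
    · have := mul_mem hxa (hle (snd_mem_algebra _ _))
      rw [mul_inv, mul_inv_cancel_left₀ (pow_ne_zero _ hx)] at this
      exact mem_or_inv_mem hR this (Or.inr (inv_inv _))
  refine ⟨val R hR, fun h => ?_⟩
  let V : ValuationSubring (FunField k) := { R.toSubring with mem_or_inv_mem' := h }
  obtain ⟨A, hA, hle⟩ := (Surface.hirzebruch a).exists_chart_le V fun c =>
    hR ((baseField k).algebraMap_mem c)
  replace hle : A.toSubring ≤ R.toSubring := hle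
  have hdom := ofPrime_centreIdeal_le _ R hle
  set R' := LocalSubring.ofPrime A.toSubring (centreIdeal _ R hle) with hR'
  have hmem : R' ∈ (Surface.hirzebruch a).points k := ⟨A, hA, _, inferInstance, rfl⟩
  obtain ⟨t, htA, ht⟩ : ∃ t ∈ A, t = x k ∨ t⁻¹ = x k := by
    rcases hA with rfl | rfl | rfl | rfl
    · exact ⟨_, fst_mem_algebra _ _, Or.inl rfl⟩
    · exact ⟨_, fst_mem_algebra _ _, Or.inl rfl⟩
    · exact ⟨_, fst_mem_algebra _ _, Or.inr (inv_inv _)⟩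
    · exact ⟨_, fst_mem_algebra _ _, Or.inr (inv_inv _)⟩
  have htF : IntermediateField.adjoin k {t} = baseField k := by
    refine le_antisymm (IntermediateField.adjoin_simple_le_iff.2 ?_)
      (IntermediateField.adjoin_simple_le_iff.2 ?_)
    · rcases ht with rfl | h
      · exact x_mem_baseField
      · rw [← inv_inv t, h]; exact inv_mem x_mem_baseField
    · have := IntermediateField.mem_adjoin_simple_self k t
      rcases ht with h | h
      · rw [← h]; exact this
      · rw [← h]; exact inv_mem this
  -- A nonzero polynomial in `t` is a unit of `R`, since `R` contains `k(x)`. It therefore lies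
  -- outside the centre and is inverted in `R'`.
  have hbase : (baseField k).toSubring ≤ R'.toSubring := by
    intro z hz
    replace hz : z ∈ baseField k := hz
    rw [← htF] at hz
    obtain ⟨f, g, rfl⟩ := (IntermediateField.mem_adjoin_simple_iff _ _).1 hz
    have hA' : ∀ p : Polynomial k, Polynomial.aeval t p ∈ A := fun p =>
      aeval_mem_of_mem htA p
    have hF : ∀ p : Polynomial k, Polynomial.aeval t p ∈ baseField k := fun p => by
      rw [← htF]
      exact aeval_mem_of_mem (A := (IntermediateField.adjoin k {t}).toSubalgebra)
        (IntermediateField.mem_adjoin_simple_self k t) p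
    by_cases hg : Polynomial.aeval t g = 0
    · rw [hg, div_zero]; exact zero_mem _
    · exact mem_ofPrime.2 ⟨⟨_, hA' f⟩, ⟨_, hA' g⟩, notMem_centreIdeal.2
        ⟨hg, hR ((baseField k).inv_mem (hF g))⟩, rfl⟩
  -- By the direction already proved `R'` is a valuation ring, and a valuation ring is maximal for
  -- domination.
  have heq : R = R' := by
    refine LocalSubring.toSubring_injective (le_antisymm (fun z hz => ?_) hdom.1)
    rcases val R' hbase hmem z with h' | h'
    · exact h'
    · rcases eq_or_ne z 0 with rfl | hz0
      · exact zero_mem _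
      · have := (localSubring_le_iff.1 hdom).2 _ h' (inv_ne_zero hz0) (by rwa [inv_inv])
        rwa [inv_inv] at this
  rw [heq]
  exact hmem

/-- A birational map of Hirzebruch surfaces that respects the rulings is an isomorphism on the
generic fibre. -/
theorem isIsoOnGenericFibre_of_map {a a' : ℕ} {φ : FunField k ≃ₐ[k] FunField k}
    (h : x k ∈ (baseField k).map (φ : FunField k →ₐ[k] FunField k)) (h' : φ (x k) ∈ baseField k) :
    IsIsoOnGenericFibre (.hirzebruch a) (.hirzebruch a') φ := by
  have hmap : (baseField k).map (φ : FunField k →ₐ[k] FunField k) = baseField k := by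
    refine le_antisymm ?_ (IntermediateField.adjoin_simple_le_iff.2 h)
    rw [IntermediateField.adjoin_map, Set.image_singleton]
    exact IntermediateField.adjoin_simple_le_iff.2 h'
  refine ⟨hmap, fun R hR => ?_⟩
  -- Being a valuation ring is invariant under automorphisms, so only the preservation of `k(x)` had
  -- to be known.
  rw [mem_points_iff_of_baseField_le hR, mem_points_iff_of_baseField_le]
  · constructor
    · intro hv z
      rw [mem_map_aut, mem_map_aut, map_inv₀]
      exact hv _
    · intro hv z
      have := hv (φ z)
      rwa [mem_map_aut, mem_map_aut, map_inv₀, AlgEquiv.symm_apply_apply] at this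
  · intro z hz
    replace hz : z ∈ baseField k := hz
    rw [← hmap] at hz
    obtain ⟨w, hw, rfl⟩ := hz
    rw [mem_map_aut]
    have : φ.symm ((φ : FunField k →ₐ[k] FunField k) w) = w := φ.symm_apply_apply w
    change φ.symm ((φ : FunField k →ₐ[k] FunField k) w) ∈ _
    rw [this]
    exact hR hw

/-! ### Log sections on Hirzebruch surfaces -/

theorem x_ne_algebraMap (c : k) : x k ≠ algebraMap k (FunField k) c := fun h => by
  have := fibreCurve_ord_x (k := k) 0
  rw [h, DivisorialValuation.ord_algebraMap] at this
  lia

theorem aeval_x_mem_baseField (c : Polynomial k) : Polynomial.aeval (x k) c ∈ baseField k :=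
  aeval_mem_of_mem (A := (baseField k).toSubalgebra) x_mem_baseField c

/-- The quotient of two sections of `n K + r C`, a multiple of the fibre, is a function on the
base. -/
theorem hirzebruch_div_mem_baseField {a : ℕ} {C : DivisorialValuation k} {α β : ℤ}
    (hC : (Surface.hirzebruch a).HasClass C α β) {n r : ℕ} (hr : r * α = 2 * n)
    (he : 0 ≤ r * β - (a + 2) * n) {G G' : FunField k}
    (hG : (Surface.hirzebruch a).IsLogSection C n r G)
    (hG' : (Surface.hirzebruch a).IsLogSection C n r G') : G / G' ∈ baseField k := by
  obtain ⟨H, hH0, hH⟩ := hirzebruch_logDivisor hC n r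
  obtain ⟨e, he⟩ := Int.eq_ofNat_of_zero_le he
  have key : ∀ G, (Surface.hirzebruch a).IsLogSection C n r G →
      ∃ c : Polynomial k, x k ^ e * (G * H) = Polynomial.aeval (x k) c := by
    intro G hG
    refine hirzebruch_fibre_section (a := a) (mul_ne_zero hG.1 hH0) fun E hE => ?_
    have h1 := hG.2 E hE
    have h2 := hH E hE
    rw [he, hr] at h2
    rw [E.ord_mul hG.1 hH0]
    linarith
  obtain ⟨c, hc⟩ := key G hG
  obtain ⟨c', hc'⟩ := key G' hG'
  have : G / G' = Polynomial.aeval (x k) c / Polynomial.aeval (x k) c' := by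
    rw [← hc, ← hc', mul_div_mul_left _ _ (pow_ne_zero _ x_ne_zero), mul_div_mul_right _ _ hH0]
  rw [this]
  exact div_mem (aeval_x_mem_baseField c) (aeval_x_mem_baseField c')

theorem hirzebruch_div_isConst {a : ℕ} {C : DivisorialValuation k} {α β : ℤ}
    (hC : (Surface.hirzebruch a).HasClass C α β) {n r : ℕ} (hr : r * α = 2 * n)
    (he : r * β - (a + 2) * n = 0) {G G' : FunField k}
    (hG : (Surface.hirzebruch a).IsLogSection C n r G)
    (hG' : (Surface.hirzebruch a).IsLogSection C n r G') :
    ∃ c : k, G / G' = algebraMap k (FunField k) c := by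
  obtain ⟨H, hH0, hH⟩ := hirzebruch_logDivisor hC n r
  have key : ∀ G, (Surface.hirzebruch a).IsLogSection C n r G →
      ∃ c : k, G * H = algebraMap k (FunField k) c := by
    intro G hG
    refine hirzebruch_isConst (a := a) fun E hE => ?_
    have h1 := hG.2 E hE
    have h2 := hH E hE
    rw [he, hr] at h2
    rw [E.ord_mul hG.1 hH0]
    linarith
  obtain ⟨c, hc⟩ := key G hG
  obtain ⟨c', hc'⟩ := key G' hG'
  exact ⟨c / c', by rw [map_div₀, ← hc, ← hc', mul_div_mul_right _ _ hH0]⟩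

theorem hirzebruch_exists_section {a : ℕ} {C : DivisorialValuation k} {α β : ℤ}
    (hC : (Surface.hirzebruch a).HasClass C α β) {n r : ℕ} (hr : r * α = 2 * n)
    (he : r * β - (a + 2) * n = 0) :
    ∃ G, G ≠ 0 ∧ ∀ E, (Surface.hirzebruch a).IsPrimeDivisor E →
      E.ord G + n * canonicalDivisor E + r * curveDivisor C E = 0 := by
  obtain ⟨H, hH0, hH⟩ := hirzebruch_logDivisor hC n r
  refine ⟨H⁻¹, inv_ne_zero hH0, fun E hE => ?_⟩
  have h2 := hH E hE
  rw [he, hr] at h2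
  rw [E.ord_inv]
  linarith

/-- The divisor of `x` is the difference of two fibres, so a positive multiple of `f` has two
sections with quotient `x`. This pencil recovers the ruling. -/
theorem hirzebruch_exists_pencil {a : ℕ} {C : DivisorialValuation k} {α β : ℤ}
    (hC : (Surface.hirzebruch a).HasClass C α β) {n r : ℕ} (hr : r * α = 2 * n)
    (he : 0 < r * β - (a + 2) * n) :
    ∃ G, (Surface.hirzebruch a).IsLogSection C n r G ∧
      (Surface.hirzebruch a).IsLogSection C n r ((x k)⁻¹ * G) := by
  obtain ⟨H, hH0, hH⟩ := hirzebruch_logDivisor hC n r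
  have hx := x_ne_zero (k := k)
  have hfib : ∀ E, (Surface.hirzebruch a).IsPrimeDivisor E →
      0 ≤ fibreDivisor k E ∧ 0 ≤ fibreDivisor k E - E.ord (x k) := by
    intro E hE
    by_cases hs : MeetsStandard E
    · rw [hE.fibreDivisor_eq hs, sub_self]
      exact ⟨(meetsStandard_iff.1 hs).1, le_rfl⟩
    · rw [fibreDivisor_eq_zero hs]
      rcases hirzebruch_isPrimeDivisor_cases hE with h | rfl | rfl
      · exact absurd h hs
      · rw [sectionCurve_ord_x]; simp
      · rw [fibreCurve_ord_x]; simp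
  refine ⟨H⁻¹, ⟨inv_ne_zero hH0, fun E hE => ?_⟩,
    ⟨mul_ne_zero (inv_ne_zero hx) (inv_ne_zero hH0), fun E hE => ?_⟩⟩
  all_goals
    have h2 := hH E hE
    rw [hr] at h2
    have h3 := hfib E hE
  · rw [E.ord_inv]
    nlinarith [mul_nonneg he.le h3.1]
  · rw [E.ord_mul (inv_ne_zero hx) (inv_ne_zero hH0), E.ord_inv, E.ord_inv]
    nlinarith [mul_nonneg (show 0 ≤ r * β - (a + 2) * n - 1 by lia) h3.1]

/-- If `α K + 2 C` is trivial, the Iitaka dimension is not positive. -/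
theorem logKodairaDim_le_zero {a : ℕ} {C : DivisorialValuation k} {α β : ℤ} (hα : 0 < α)
    (hC : (Surface.hirzebruch a).HasClass C α β) (he : 2 * β - (a + 2) * α = 0) :
    (Surface.hirzebruch a).logKodairaDim C (2 / (α : ℚ)) ≤ 0 := by
  obtain ⟨n, rfl⟩ := Int.eq_ofNat_of_zero_le hα.le
  obtain ⟨H, hH0, hH⟩ := hirzebruch_logDivisor hC n 2
  refine iSup_le fun m => iSup_le fun hm => iSup_le fun _ => ?_
  have hn : 0 < n := by exact_mod_cast hα
  have hnQ : (n : ℚ) ≠ 0 := by exact_mod_cast hn.ne'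
  set D : DivisorialValuation k → ℚ := fun E => m * logDivisor C (2 / ((n : ℤ) : ℚ)) E
  -- The coefficients of `D` may be fractional. Passing to the power `n = α` clears denominators and
  -- turns `g` into a section of a trivial divisor, hence a constant.
  have key : ∀ g ∈ (Surface.hirzebruch a).sections D, g ≠ 0 →
      ∃ c : k, g ^ n * H ^ m = algebraMap k (FunField k) c := by
    intro g hg hg0
    refine hirzebruch_isConst (a := a) fun E hE => ?_
    have h1 := (hg.resolve_left hg0) E hE
    have h2 := hH E hE
    have h3 : (n * canonicalDivisor E + 2 * curveDivisor C E : ℤ) = E.ord H := by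
      rw [Nat.cast_ofNat, he] at h2
      linarith
    have h4 : (n * canonicalDivisor E + 2 * curveDivisor C E : ℚ) = E.ord H := by
      exact_mod_cast h3
    have h5 : (n : ℚ) * (E.ord g + D E) = n * E.ord g + m * E.ord H := by
      rw [← h4]
      simp only [D, logDivisor, Int.cast_natCast]
      field_simp
    have h6 : (0 : ℚ) ≤ n * E.ord g + m * E.ord H := by rw [← h5]; positivity
    rw [E.ord_mul (pow_ne_zero _ hg0) (pow_ne_zero _ hH0), E.ord_pow, E.ord_pow]
    exact_mod_cast h6
  have halg : Algebra.IsAlgebraic k (IntermediateField.adjoin k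
      {r : FunField k | ∃ g ∈ (Surface.hirzebruch a).sections D,
        ∃ h ∈ (Surface.hirzebruch a).sections D, h ≠ 0 ∧ r = g / h}) := by
    refine IntermediateField.isAlgebraic_adjoin ?_
    rintro _ ⟨g, hg, h, hh, hh0, rfl⟩
    rcases eq_or_ne g 0 with rfl | hg0
    · rw [zero_div]; exact isIntegral_zero
    obtain ⟨c, hc⟩ := key g hg hg0
    obtain ⟨c', hc'⟩ := key h hh hh0
    -- The `n`-th power of a quotient of sections is constant, so the quotient is algebraic over `k`
    -- and contributes nothing to the transcendence degree.
    refine IsIntegral.of_pow hn ?_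
    have : (g / h) ^ n = algebraMap k (FunField k) (c / c') := by
      rw [map_div₀, ← hc, ← hc', mul_div_mul_right _ _ (pow_ne_zero _ hH0), div_pow]
    rw [this]
    exact isIntegral_algebraMap
  change ((Cardinal.toENat (Algebra.trdeg k (IntermediateField.adjoin k
      {r : FunField k | ∃ g ∈ (Surface.hirzebruch a).sections D,
        ∃ h ∈ (Surface.hirzebruch a).sections D, h ≠ 0 ∧ r = g / h})) : ℕ∞) : WithBot ℕ∞) ≤ 0
  rw [trdeg_eq_zero]
  simp

/-! ### Thresholds of models -/

/-- `c` is the threshold of the pair `(S, C)`: the pair `(S, c C)` is canonical, `K + c C` is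
effective, and `K + c' C` is not effective for `c' < c`. -/
structure Surface.HasThreshold (S : Surface) (C : DivisorialValuation k) (c : ℚ) : Prop where
  isPrimeDivisor : S.IsPrimeDivisor C
  pos : 0 < c
  isCanonicalPair : S.IsCanonicalPair C c
  exists_section : ∀ n r : ℕ, c * n = r → ∃ G, S.IsLogSection C n r G
  not_isLogSection : ∀ n r : ℕ, r < c * n → ∀ G, ¬ S.IsLogSection C n r G

/-- If `c' < c`, a section of a multiple of `K + c'C'` that clears the denominator of `c'` pulls
back to `S`, where the smaller coefficient allows no sections. -/
theorem Surface.HasThreshold.le {S S' : Surface} {C C' : DivisorialValuation k} {c c' : ℚ}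
    (h : S.HasThreshold C c) (h' : S'.HasThreshold C' c') {φ : FunField k ≃ₐ[k] FunField k}
    (hφ : IsPairMap C C' φ) : c ≤ c' := by
  by_contra! hlt
  have hc' : c' * c'.den = (c'.num.toNat : ℕ) := by
    rw [Rat.mul_den_eq_num, ← Int.cast_natCast, Int.toNat_of_nonneg (Rat.num_nonneg.2 h'.pos.le)]
  obtain ⟨G, hG⟩ := h'.exists_section _ _ hc'
  refine h.not_isLogSection _ _ ?_ _ (hG.pull hφ h'.isPrimeDivisor hc' h'.isCanonicalPair)
  rw [← hc']
  have : (0 : ℚ) < c'.den := by exact_mod_cast c'.den_pos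
  gcongr

theorem Surface.HasThreshold.eq {S S' : Surface} {C C' : DivisorialValuation k} {c c' : ℚ}
    (h : S.HasThreshold C c) (h' : S'.HasThreshold C' c') {φ : FunField k ≃ₐ[k] FunField k}
    (hφ : IsPairMap C C' φ) : c = c' :=
  le_antisymm (h.le h' hφ) (h'.le h hφ.symm)

/-- A pair with a threshold is not birational to the plane with a line. -/
theorem Surface.HasThreshold.not_line {S' : Surface} {C C' : DivisorialValuation k} {c : ℚ}
    (hline : Surface.plane.LinEquiv (curveDivisor C) (lineDivisor k))
    (h' : S'.HasThreshold C' c) (φ : FunField k ≃ₐ[k] FunField k) : ¬ IsPairMap C C' φ := by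
  intro hφ
  have hc' : c * c.den = (c.num.toNat : ℕ) := by
    rw [Rat.mul_den_eq_num, ← Int.cast_natCast, Int.toNat_of_nonneg (Rat.num_nonneg.2 h'.pos.le)]
  obtain ⟨G, hG⟩ := h'.exists_section _ _ hc'
  refine plane_not_isLogSection (d := 1) (by simpa using hline) ?_ _
    (hG.pull hφ h'.isPrimeDivisor hc' h'.isCanonicalPair)
  have hpos : (0 : ℚ) < c.den := by exact_mod_cast c.den_pos
  -- Since `c ≤ 1`, the pulled-back divisor has degree `r - 3n < 0` on the plane with a line.
  have : ((c.num.toNat : ℕ) : ℚ) < 3 * c.den := by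
    rw [← hc']
    nlinarith [h'.isCanonicalPair.1]
  rw [mul_one]
  exact_mod_cast this

/-- The plane with a curve of degree `d` such that `(ℙ², (3/d) C)` is terminal. -/
structure IsPlaneModel (C : DivisorialValuation k) (d : ℕ) : Prop where
  isPrimeDivisor : Surface.plane.IsPrimeDivisor C
  pos : 0 < d
  linEquiv : Surface.plane.LinEquiv (curveDivisor C) (fun E => d * lineDivisor k E)
  isTerminalPair : Surface.plane.IsTerminalPair C (3 / d)

/-- A Hirzebruch surface with a curve `C ∼ α C₀ + β f` such that `K + (2/α) C` is a nonnegative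
multiple of `f` and `(S, (2/α) C)` is canonical. -/
structure IsRuledModel (a : ℕ) (C : DivisorialValuation k) (α β : ℤ) : Prop where
  isPrimeDivisor : (Surface.hirzebruch a).IsPrimeDivisor C
  pos : 0 < α
  hasClass : (Surface.hirzebruch a).HasClass C α β
  nonneg : 0 ≤ 2 * β - (a + 2) * α
  isCanonicalPair : (Surface.hirzebruch a).IsCanonicalPair C (2 / α)

theorem plane_exists_section {C : DivisorialValuation k} {d : ℤ}
    (hd : Surface.plane.LinEquiv (curveDivisor C) fun E => d * lineDivisor k E) {n r : ℕ}
    (hr : r * d = 3 * n) :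
    ∃ G, G ≠ 0 ∧ ∀ E, Surface.plane.IsPrimeDivisor E →
      E.ord G + n * canonicalDivisor E + r * curveDivisor C E = 0 := by
  obtain ⟨H, hH0, hH⟩ := plane_logDivisor hd n r
  refine ⟨H⁻¹, inv_ne_zero hH0, fun E hE => ?_⟩
  have h2 := hH E hE
  rw [hr] at h2
  rw [E.ord_inv]
  linarith

theorem IsPlaneModel.hasThreshold {C : DivisorialValuation k} {d : ℕ} (h : IsPlaneModel C d) :
    Surface.plane.HasThreshold C (3 / d) := by
  have hd : (0 : ℚ) < d := by exact_mod_cast h.pos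
  refine ⟨h.isPrimeDivisor, by positivity, h.isTerminalPair.isCanonicalPair, fun n r hr => ?_,
    fun n r hr => ?_⟩
  · field_simp at hr
    obtain ⟨G, hG0, hG⟩ := plane_exists_section (d := d) h.linEquiv (n := n) (r := r)
      (by rw [mul_comm (r : ℤ)]; exact_mod_cast hr.symm)
    exact ⟨G, hG0, fun E hE => (hG E hE).ge⟩
  · refine plane_not_isLogSection (d := d) h.linEquiv ?_
    field_simp at hr
    exact_mod_cast hr

theorem IsRuledModel.hasThreshold {a : ℕ} {C : DivisorialValuation k} {α β : ℤ}
    (h : IsRuledModel a C α β) : (Surface.hirzebruch a).HasThreshold C (2 / α) := by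
  have hα : (0 : ℚ) < α := by exact_mod_cast h.pos
  refine ⟨h.isPrimeDivisor, by positivity, h.isCanonicalPair, fun n r hr => ?_,
    fun n r hr => ?_⟩
  · field_simp at hr
    have hr' : r * α = 2 * n := by rw [mul_comm (r : ℤ)]; exact_mod_cast hr.symm
    have he : 0 ≤ r * β - (a + 2) * n := by
      refine nonneg_of_mul_nonneg_right ?_ h.pos
      -- The relation `rα = 2n` makes every multiple of `K + (2/α)C` proportional to the one cleared
      -- by `α`.
      have : α * (r * β - (a + 2) * n) = n * (2 * β - (a + 2) * α) := by
        linear_combination β * hr'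
      rw [this]
      exact mul_nonneg (Int.natCast_nonneg n) h.nonneg
    rcases he.eq_or_lt with he | he
    · obtain ⟨G, hG0, hG⟩ := hirzebruch_exists_section h.hasClass hr' he.symm
      exact ⟨G, hG0, fun E hE => (hG E hE).ge⟩
    · obtain ⟨G, hG, -⟩ := hirzebruch_exists_pencil h.hasClass hr' he
      exact ⟨G, hG⟩
  · refine hirzebruch_not_isLogSection h.hasClass ?_
    field_simp at hr
    exact_mod_cast hr

/-- The kinds of models. -/
theorem IsModel.cases {S : Surface} {C : DivisorialValuation k} (h : IsModel S C) :
    (S = .plane ∧ S.IsPrimeDivisor C ∧ S.LinEquiv (curveDivisor C) (lineDivisor k)) ∨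
      (S = .plane ∧ ∃ d, IsPlaneModel C d) ∨
      ∃ a, S = .hirzebruch a ∧ ∃ α β, IsRuledModel a C α β := by
  cases h with
  | line C hC hl => exact Or.inl ⟨rfl, hC, hl⟩
  | plane C d hC hd hl _ ht => exact Or.inr (Or.inl ⟨rfl, d, hC, hd, hl, ht⟩)
  | quadric C α β hC hα hcl hnef ht =>
    exact Or.inr (Or.inr ⟨0, rfl, α, β, hC, hα, hcl, class_nonneg_of_isNef hα hcl hnef,
      ht.isCanonicalPair⟩)
  | hirzebruch a C α β hC hα hcl hnef hcan _ =>
    exact Or.inr (Or.inr ⟨a, rfl, α, β, hC, hα, hcl, class_nonneg_of_isNef hα hcl hnef, hcan⟩)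

/-! ### Crepant birational maps -/

/-- If `n K + r C` is trivial on both sides and the target is terminal, the map contracts no
curve. -/
theorem isPrimeDivisor_comap_of_trivial {S S' : Surface} {C C' : DivisorialValuation k}
    {φ : FunField k ≃ₐ[k] FunField k} (hφ : IsPairMap C C' φ)
    (hconst : ∀ z : FunField k, (∀ E, S.IsPrimeDivisor E → 0 ≤ E.ord z) →
      ∃ c : k, z = algebraMap k (FunField k) c)
    (hC' : S'.IsPrimeDivisor C') {c : ℚ} {n r : ℕ} (hn : 0 < n) (hc : c * n = r)
    (hter : S'.IsTerminalPair C' c) {G G' : FunField k} (hG0 : G ≠ 0)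
    (hG : ∀ E, S.IsPrimeDivisor E → E.ord G + n * canonicalDivisor E + r * curveDivisor C E = 0)
    (hG' : S'.IsLogSection C' n r G')
    {E : DivisorialValuation k} (hE : S.IsPrimeDivisor E) : S'.IsPrimeDivisor (E.comap φ) := by
  by_contra hE'
  have hpull : S.IsLogSection C n r (pullForm φ n G') :=
    hG'.pull hφ hC' hc hter.isCanonicalPair
  -- `G` trivializes `nK + rC`, so dividing the pulled-back section by it leaves a function without
  -- poles.
  obtain ⟨b, hb⟩ := hconst (pullForm φ n G' / G) fun F hF => by
    have h1 := hpull.2 F hF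
    have h2 := hG F hF
    rw [F.ord_div hpull.1 hG0]
    linarith
  -- If `E` were contracted, the pulled-back form would vanish along it, although it is a constant
  -- multiple of a form without zeros.
  have h1 := hG'.lt_ord hC' hn hc hter hE'
  rw [← ord_pullForm hφ hE hG'.1] at h1
  have h2 := hG E hE
  have h3 := E.ord_algebraMap b
  rw [← hb, E.ord_div hpull.1 hG0] at h3
  lia

/-- A birational map from a Hirzebruch surface to the plane contracts a curve. -/
theorem exists_not_isPrimeDivisor_comap (a : ℕ) (φ : FunField k ≃ₐ[k] FunField k) :
    ∃ E, (Surface.hirzebruch a).IsPrimeDivisor E ∧ ¬ Surface.plane.IsPrimeDivisor (E.comap φ) := by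
  by_contra! h
  obtain ⟨d, -, g, hg, hgE⟩ := plane_exists_degree
    (h _ ((Surface.hirzebruch a).isPrimeDivisor_standard _ (irreducible_X 1)))
  obtain ⟨d', -, g', hg', hgE'⟩ := plane_exists_degree
    (h _ ((Surface.hirzebruch a).isPrimeDivisor_standard _ (irreducible_X 0)))
  -- If no curve is contracted, linear equivalences on the plane pull back, and both `C₀` and `f`
  -- become multiples of the pull-back of one line.
  have hsec : ∀ E, (Surface.hirzebruch a).IsPrimeDivisor E →
      sectionDivisor k E = d * curveDivisor (lineCurve k) (E.comap φ) + E.ord (φ g) := by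
    intro E hE
    rw [← hE.curveDivisor_zeroSection, ← DivisorialValuation.ord_comap, ← hgE _ (h E hE),
      curveDivisor_comap]
    rfl
  have hfib : ∀ E, (Surface.hirzebruch a).IsPrimeDivisor E →
      fibreDivisor k E = d' * curveDivisor (lineCurve k) (E.comap φ) + E.ord (φ g') := by
    intro E hE
    rw [← hE.curveDivisor_zeroFibre, ← DivisorialValuation.ord_comap, ← hgE' _ (h E hE),
      curveDivisor_comap]
    rfl
  have hφg : φ g ≠ 0 := by simpa using hg
  have hφg' : φ g' ≠ 0 := by simpa using hg'
  -- The combination `d'C₀ - df` is principal, so `d = 0`; but then `C₀` itself would be principal.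
  have h1 := hirzebruch_class_independent (a := a) (i := d') (j := -d)
    (g := φ g' ^ d / φ g ^ d') (div_ne_zero (zpow_ne_zero _ hφg') (zpow_ne_zero _ hφg))
    fun E hE => by
      rw [E.ord_div (zpow_ne_zero _ hφg') (zpow_ne_zero _ hφg), E.ord_zpow, E.ord_zpow,
        hsec E hE, hfib E hE]
      ring
  have h2 := hirzebruch_class_independent (a := a) (i := 1) (j := 0) (g := (φ g)⁻¹)
    (inv_ne_zero hφg) fun E hE => by
      rw [E.ord_inv, hsec E hE, neg_eq_zero.1 h1.2]
      ring
  exact one_ne_zero h2.1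

/-- A ruled model is not birational to a plane model. -/
theorem IsRuledModel.not_isPairMap {a : ℕ} {C C' : DivisorialValuation k} {α β : ℤ} {d : ℕ}
    (h : IsRuledModel a C α β) (h' : IsPlaneModel C' d) (φ : FunField k ≃ₐ[k] FunField k) :
    ¬ IsPairMap C C' φ := by
  intro hφ
  have hcc := h.hasThreshold.eq h'.hasThreshold hφ
  obtain ⟨n, hn⟩ := Int.eq_ofNat_of_zero_le h.pos.le
  have hn0 : 0 < n := by have := h.pos; lia
  have hnQ : (α : ℚ) = n := by rw [hn]; simp
  have hnQ0 : (n : ℚ) ≠ 0 := by exact_mod_cast hn0.ne'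
  have hdQ0 : (d : ℚ) ≠ 0 := by exact_mod_cast h'.pos.ne'
  have hc : (2 / α : ℚ) * n = (2 : ℕ) := by rw [hnQ]; field_simp; norm_num
  have hr : ((2 : ℕ) : ℤ) * α = 2 * n := by rw [hn]; norm_num
  have hr' : ((2 : ℕ) : ℤ) * d = 3 * n := by
    rw [hnQ] at hcc
    field_simp at hcc
    have : (2 * d : ℚ) = 3 * n := by linarith
    exact_mod_cast this
  obtain ⟨G', hG0', hG'⟩ := plane_exists_section (d := d) h'.linEquiv hr'
  -- A positive multiple of `f` would carry two sections with quotient `x`. On the plane they would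
  -- become sections of a trivial divisor, so `x` would be constant.
  have he0 : ((2 : ℕ) : ℤ) * β - (a + 2) * n = 0 := by
    by_contra hne
    have he := h.nonneg
    obtain ⟨G, hG, hxG⟩ := hirzebruch_exists_pencil h.hasClass hr (by
      rw [hn] at he
      exact lt_of_le_of_ne (by exact_mod_cast he) (Ne.symm hne))
    have key : ∀ G, (Surface.hirzebruch a).IsLogSection C n 2 G →
        ∃ b : k, pullForm φ.symm n G / G' = algebraMap k (FunField k) b := by
      intro G hG
      have hp : Surface.plane.IsLogSection C' n 2 (pullForm φ.symm n G) :=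
        hG.pull hφ.symm h.isPrimeDivisor hc h.isCanonicalPair
      refine plane_isConst fun E hE => ?_
      have h1 := hp.2 E hE
      have h2 := hG' E hE
      rw [E.ord_div hp.1 hG0']
      linarith
    obtain ⟨b, hb⟩ := key G hG
    obtain ⟨b', hb'⟩ := key _ hxG
    refine x_ne_algebraMap (b / b') ?_
    have hG1 : pullForm φ.symm n G ≠ 0 := pullForm_ne_zero hG.1
    have h1 : pullForm φ.symm n ((x k)⁻¹ * G) = (φ.symm (x k))⁻¹ * pullForm φ.symm n G := by
      rw [pullForm, pullForm, map_mul, map_inv₀, mul_assoc]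
    have h2 : φ.symm (x k) = algebraMap k (FunField k) (b / b') := by
      rw [map_div₀, ← hb, ← hb', h1]
      have hx : φ.symm (x k) ≠ 0 := by simpa using x_ne_zero
      field_simp
    apply φ.symm.injective
    rw [h2, AlgEquiv.commutes]
  obtain ⟨G, hG0, hG⟩ := hirzebruch_exists_section h.hasClass hr he0
  -- Both log canonical divisors are now trivial, so terminality on the plane forbids the
  -- contraction that the ranks of the class groups impose.
  obtain ⟨E, hE, hE'⟩ := exists_not_isPrimeDivisor_comap a φ
  exact hE' (isPrimeDivisor_comap_of_trivial hφ (fun z => hirzebruch_isConst (a := a))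
    h'.isPrimeDivisor hn0 (by rw [← hcc]; exact hc) h'.isTerminalPair hG0 hG
    ⟨hG0', fun E hE => (hG' E hE).ge⟩ hE)

/-- Birational maps of plane models are biregular. -/
theorem IsPlaneModel.isBiregular {C C' : DivisorialValuation k} {d d' : ℕ}
    (h : IsPlaneModel C d) (h' : IsPlaneModel C' d') {φ : FunField k ≃ₐ[k] FunField k}
    (hφ : IsPairMap C C' φ) : IsBiregular .plane .plane φ := by
  have hcc := h.hasThreshold.eq h'.hasThreshold hφ
  have hdQ : (d : ℚ) ≠ 0 := by exact_mod_cast h.pos.ne'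
  have hdQ' : (d' : ℚ) ≠ 0 := by exact_mod_cast h'.pos.ne'
  obtain rfl : d = d' := by
    field_simp at hcc
    have : (d : ℚ) = d' := by linarith
    exact_mod_cast this
  have hc : (3 / d : ℚ) * d = (3 : ℕ) := by field_simp; norm_num
  obtain ⟨G, hG0, hG⟩ := plane_exists_section (d := d) h.linEquiv (n := d) (r := 3) (by norm_num)
  obtain ⟨G', hG0', hG'⟩ := plane_exists_section (d := d) h'.linEquiv (n := d) (r := 3) (by norm_num)
  -- Each direction uses terminality of its own target.
  refine isBiregular_plane_of_isPrimeDivisor fun E => ⟨fun hE => ?_, fun hE => ?_⟩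
  · exact isPrimeDivisor_comap_of_trivial hφ (fun z => plane_isConst) h'.isPrimeDivisor h.pos hc
      h'.isTerminalPair hG0 hG ⟨hG0', fun E hE => (hG' E hE).ge⟩ hE
  · have := isPrimeDivisor_comap_of_trivial hφ.symm (fun z => plane_isConst) h.isPrimeDivisor h.pos
      hc h.isTerminalPair hG0' hG' ⟨hG0, fun E hE => (hG E hE).ge⟩ hE
    rwa [DivisorialValuation.comap_comap_symm] at this

/-! ### Birational maps of ruled models -/

/-- Both thresholds `2/α` and `2/α'` are the same birational invariant. -/
theorem IsRuledModel.fibreDegree_eq {a a' : ℕ} {C C' : DivisorialValuation k} {α β α' β' : ℤ}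
    (h : IsRuledModel a C α β) (h' : IsRuledModel a' C' α' β')
    {φ : FunField k ≃ₐ[k] FunField k} (hφ : IsPairMap C C' φ) : α = α' := by
  have hcc := h.hasThreshold.eq h'.hasThreshold hφ
  have hα : (α : ℚ) ≠ 0 := by exact_mod_cast h.pos.ne'
  have hα' : (α' : ℚ) ≠ 0 := by exact_mod_cast h'.pos.ne'
  field_simp at hcc
  exact_mod_cast hcc.symm

/-- Pulling back a moving multiple of the fibre. -/
theorem IsRuledModel.pull_x {a a' : ℕ} {C C' : DivisorialValuation k} {α β β' : ℤ}
    (h : IsRuledModel a C α β) (h' : IsRuledModel a' C' α β')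
    {φ : FunField k ≃ₐ[k] FunField k} (hφ : IsPairMap C C' φ)
    (he' : 0 < 2 * β' - (a' + 2) * α) :
    0 < 2 * β - (a + 2) * α ∧ φ (x k) ∈ baseField k := by
  obtain ⟨n, rfl⟩ := Int.eq_ofNat_of_zero_le h.pos.le
  have hn0 : (n : ℚ) ≠ 0 := by exact_mod_cast h.pos.ne'
  have hc : (2 / ((n : ℤ) : ℚ)) * n = (2 : ℕ) := by
    rw [Int.cast_natCast]; field_simp; norm_num
  obtain ⟨G, hG, hxG⟩ := hirzebruch_exists_pencil h'.hasClass (n := n) (r := 2) (by norm_num)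
    (by exact_mod_cast he')
  have hp : (Surface.hirzebruch a).IsLogSection C n 2 (pullForm φ n G) :=
    hG.pull hφ h'.isPrimeDivisor hc h'.isCanonicalPair
  have hp' : (Surface.hirzebruch a).IsLogSection C n 2 (pullForm φ n ((x k)⁻¹ * G)) :=
    hxG.pull hφ h'.isPrimeDivisor hc h'.isCanonicalPair
  -- The Jacobian factors cancel in the quotient, so the pulled-back pencil defines the pulled-back
  -- ruling.
  have hquot : pullForm φ n G / pullForm φ n ((x k)⁻¹ * G) = φ (x k) := by
    have hφx : φ (x k) ≠ 0 := by simpa using x_ne_zero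
    have hG1 := hp.1
    have h1 : pullForm φ n ((x k)⁻¹ * G) = (φ (x k))⁻¹ * pullForm φ n G := by
      rw [pullForm, pullForm, map_mul, map_inv₀, mul_assoc]
    rw [h1]
    field_simp
  constructor
  -- If the divisor on the source were trivial, the two pulled-back sections would be proportional
  -- and `x` would be constant.
  · refine lt_of_le_of_ne h.nonneg fun he => ?_
    obtain ⟨b, hb⟩ := hirzebruch_div_isConst h.hasClass (n := n) (r := 2) (by norm_num)
      (by exact_mod_cast he.symm) hp hp'
    refine x_ne_algebraMap b (φ.injective ?_)
    rw [← hquot, hb, AlgEquiv.commutes]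
  · rw [← hquot]
    exact hirzebruch_div_mem_baseField h.hasClass (n := n) (r := 2) (by norm_num)
      (by exact_mod_cast h.nonneg) hp hp'

/-- Iitaka dimension one excludes the trivial multiple of `f` on the source. Applying
`IsRuledModel.pull_x` to the inverse map transfers positivity to the target, after which it applies
in the original direction too. -/
theorem IsRuledModel.isIsoOnGenericFibre {a a' : ℕ} {C C' : DivisorialValuation k}
    {α β α' β' : ℤ} (h : IsRuledModel a C α β) (h' : IsRuledModel a' C' α' β')
    {φ : FunField k ≃ₐ[k] FunField k} (hφ : IsPairMap C C' φ)
    (hκ : (Surface.hirzebruch a).logKodairaDim C (2 / (α : ℚ)) = 1) :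
    IsIsoOnGenericFibre (.hirzebruch a) (.hirzebruch a') φ := by
  obtain rfl := h.fibreDegree_eq h' hφ
  have he : 0 < 2 * β - (a + 2) * α := by
    refine lt_of_le_of_ne h.nonneg fun he => ?_
    have := logKodairaDim_le_zero h.pos h.hasClass he.symm
    rw [hκ] at this
    exact absurd this (by decide)
  obtain ⟨he', hx'⟩ := h'.pull_x h hφ.symm he
  obtain ⟨-, hx⟩ := h.pull_x h' hφ he'
  exact isIsoOnGenericFibre_of_map ⟨_, hx', φ.apply_symm_apply _⟩ hx

end PlanePairs

end

/-! ### The theorem on birational models. -/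

open PlanePairs in
theorem proposition3 {k : Type*} [Field k] [IsAlgClosed k] [CharZero k]
    (S S' : Surface) (C C' : DivisorialValuation k)
    (hC : IsModel S C) (hC' : IsModel S' C')
    (hbir : ∃ φ : FunField k ≃ₐ[k] FunField k, IsPairMap C C' φ)
    (hnot : ¬ ∃ φ : FunField k ≃ₐ[k] FunField k, IsPairMap C C' φ ∧ IsBiregular S S' φ) :
    (∃ a : ℕ, S = .hirzebruch a) ∧ (∃ a' : ℕ, S' = .hirzebruch a') ∧
    ∀ φ : FunField k ≃ₐ[k] FunField k, IsPairMap C C' φ →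
    ∀ α β α' β' : ℤ, S.HasClass C α β → S'.HasClass C' α' β' →
      α = α' ∧
      (S.logKodairaDim C (2 / (α : ℚ)) = 1 → IsIsoOnGenericFibre S S' φ) := by
  obtain ⟨ψ, hψ⟩ := hbir
  rcases hC.cases with ⟨rfl, hP, hl⟩ | ⟨rfl, d, hM⟩ | ⟨a, rfl, α₀, β₀, hM⟩ <;>
    rcases hC'.cases with ⟨rfl, hP', hl'⟩ | ⟨rfl, d', hM'⟩ | ⟨a', rfl, α₀', β₀', hM'⟩
  · exact absurd (exists_isBiregular_lines hP hl hP' hl') hnot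
  · exact absurd hψ (hM'.hasThreshold.not_line hl ψ)
  · exact absurd hψ (hM'.hasThreshold.not_line hl ψ)
  · exact absurd hψ.symm (hM.hasThreshold.not_line hl' ψ.symm)
  · exact absurd ⟨ψ, hψ, hM.isBiregular hM' hψ⟩ hnot
  · exact absurd hψ.symm (hM'.not_isPairMap hM ψ.symm)
  · exact absurd hψ.symm (hM.hasThreshold.not_line hl' ψ.symm)
  · exact absurd hψ (hM.not_isPairMap hM' ψ)
  · refine ⟨⟨a, rfl⟩, ⟨a', rfl⟩, fun φ hφ α β α' β' hcl hcl' => ?_⟩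
    -- A curve has only one class, so the given coefficients are those occurring in the model.
    obtain ⟨rfl, rfl⟩ := hasClass_unique hM.hasClass hcl
    obtain ⟨rfl, rfl⟩ := hasClass_unique hM'.hasClass hcl'
    exact ⟨hM.fibreDegree_eq hM' hφ, hM.isIsoOnGenericFibre hM' hφ⟩
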